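/- **Theorem (Quasi-optimality of $M_S$).** There is a function $C_{d,p,\gamma}$ of $d,p\in\mathbb N$ and $\gamma\in\mathbb R$, nondecreasing in $\gamma$ and in $p$, such that the following holds. *Setting.* Let $d\ge 2$, $p\ge 2$, let $\Omega\subseteq\mathbb R^d$ be open, bounded, connected and polyhedral with Lipschitz boundary, and let $\mathcal M$ be a simplicial face-to-face mesh of $\Omega$ with $\#\mathcal M>1$: a finite set of $d$-simplices with union $\overline\Omega$ such that any two intersect in the convex hull of their common vertices. Let $\gamma_{\mathcal M}=\max_{K\in\mathcal M} h_K/\rho_K$, where $h_K$ is the diameter of $K$ and $\rho_K$ the diameter of its largest inscribed ball. Faces are the $(d-1)$-dimensional faces of the elements; boundary faces are those contained in $\partial\Omega$, the others are interior. For a simplex $C$ let $\mathcal L_k(C)$, $k\ge1$, be the set of its points whose barycentric coordinates are integer multiples of $1/k$, and $\mathbb P_k(C)$ the polynomials on $C$ of total degree $\le k$. For $k \geq 1$ and $z\in\bigcup_K\mathcal L_k(K)$, let $\Phi^k_z$ be the continuous piecewise polynomial of degree $\le k$ on $\mathcal M$ that is $1$ at $z$ and $0$ at all other points of $\bigcup_K\mathcal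 L_k(K)$. Put $\Phi_F=\prod_{z\in \mathcal L_1(F)}\Phi^1_z$ for faces and $\Phi_K=\prod_{z\in\mathcal L_1(K)}\Phi^1_z$ for elements. *Spaces.* Let $\mathbb P_p(\mathcal M)=\{s\in L^2(\Omega): s_{|K}\in\mathbb P_p(K)\ \forall K\in\mathcal M\}$, $S^p_0=H^1_0(\Omega)\cap\mathbb P_p(\mathcal M)$ and $$CR_p=\Big\{s\in\mathbb P_p(\mathcal M): \int_F [\![s]\!]_F\,q=0\ \text{ for all faces } F \text{ and all } q\in\mathbb P_{p-1}(F)\Big\},$$ where $[\![s]\!]_F=s_{|K_1}-s_{|K_2}$ if $F=K_1\cap K_2$ is an interior face and $[\![s]\!]_F=s_{|K}$ if $F\subseteq K$ is a boundary face. Let $S$ be any linear space with $S^p_0\subseteq S\subseteq CR_p$. Let $V=H^1_0(\Omega)$, let $\nabla_{\mathcal M}$ be the piecewise gradient, $\tilde a(v,w)=\int_\Omega\nabla_{\mathcal M}v\cdot\nabla_{\mathcal M}w$ on $V+S$, and $\|\cdot\|=\tilde a(\cdot,\cdot)^{1/2}=\|\nabla_{\mathcal M}\cdot\|_{L^2(\Omega)}$.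 *Smoothing operator.* For every $z\in\Omega\cap\bigcup_K\mathcal L_p(K)$ choose an element $K_z\ni z$, and let $A_p\sigma=\sum_{z}\sigma_{|K_z}(z)\Phi^p_z$, the sum being over these $z$. For an interior face $F$ define $Q_Fv\in\mathbb P_{p-1}(F)$ by $\int_F (Q_Fv)\,q\,\Phi_F=\int_F vq$ for all $q\in\mathbb P_{p-1}(F)$, and for $K\in\mathcal M$ define $Q_Kv\in\mathbb P_{p-2}(K)$ by $\int_K(Q_Kv)\,r\,\Phi_K=\int_Kvr$ for all $r\in\mathbb P_{p-2}(K)$. Put $$B_{\mathcal F}v=\sum_{F\text{ interior}}\ \sum_{z\in\mathcal L_{p-1}(F)}(Q_Fv)(z)\,\Phi^{p-1}_z\,\Phi_F,\qquad B_{\mathcal M}v=\sum_{K\in\mathcal M}(Q_Kv)\,\Phi_K,$$ $$B_pv=B_{\mathcal F}v+B_{\mathcal M}(v-B_{\mathcal F}v),\qquad E_p\sigma=A_p\sigma+B_p(\sigma-A_p\sigma).$$ *Claim.* Every function in $V+S$ is piecewise $H^1$ over $\mathcal M$, $\tilde a$ is a scalar product on $V+S$, $E_p$ is a linear operator from $S$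 to $V$, and $M_S=(S,\tilde a_{|S\times S},E_p)$ is a nonconforming method: $S$ is finite-dimensional and $\tilde a_{|S\times S}$ is nondegenerate, so that for each $\ell\in V'$ there is exactly one $M_S\ell\in S$ with $\tilde a(M_S\ell,\sigma)=\langle\ell,E_p\sigma\rangle$ for all $\sigma\in S$. It is a nonconforming Galerkin method, i.e. its bilinear form coincides with $\tilde a$ on $S\cap V$ and $E_p$ is the identity on $S\cap V$. It is quasi-optimal for the Poisson problem $-\Delta u=f$ in $\Omega$, $u=0$ on $\partial\Omega$: there is a constant $C\ge1$ with $$\|\nabla_{\mathcal M}(u-M_S(\tilde a(u,\cdot)))\|_{L^2(\Omega)}\le C\inf_{s\in S}\|\nabla_{\mathcal M}(u-s)\|_{L^2(\Omega)}\qquad\text{for all }u\in V,$$ and the smallest such constant is $\le C_{d,p,\gamma_{\mathcal M}}$. -/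

import Mathlib

open MeasureTheory
open scoped NNReal ContDiff Topology

noncomputable section

/-! ### Abstract nonconforming methods

`V` and `S` are subspaces of a common real vector space `X`, and `aext` is a bilinear form on `V + S`
extending the form `a` of the continuous problem on `V`. -/

namespace Nonconforming

variable {X : Type*} [AddCommGroup X] [Module ℝ X] {V S : Submodule ℝ X}

/-- `V → V + S`. -/
def inclV (V S : Submodule ℝ X) : V →ₗ[ℝ] ↥(V ⊔ S) := Submodule.inclusion le_sup_left

/-- `S → V + S`. -/
def inclS (V S : Submodule ℝ X) : S →ₗ[ℝ] ↥(V ⊔ S) := Submodule.inclusion le_sup_right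

/-- A symmetric and positive definite bilinear form. -/
structure IsScalarProduct {W : Type*} [AddCommGroup W] [Module ℝ W]
    (a : LinearMap.BilinForm ℝ W) : Prop where
  symm : ∀ v w, a v w = a w v
  pos : ∀ w, w ≠ 0 → 0 < a w w

/-- The extended energy norm. -/
def energyNorm (aext : LinearMap.BilinForm ℝ ↥(V ⊔ S)) (w : ↥(V ⊔ S)) : ℝ :=
  Real.sqrt (aext w w)

/-- The continuous form `a` on `V`; as a linear map it is `A : u ↦ a(u, ·)`. -/
def contForm (aext : LinearMap.BilinForm ℝ ↥(V ⊔ S)) : LinearMap.BilinForm ℝ V :=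
  aext.compl₁₂ (inclV V S) (inclV V S)

/-- A nonconforming method `(S, b, E)`: finite-dimensional `S`, nondegenerate `b` on `S`,
smoothing operator `E : S → V`. -/
structure Method (V S : Submodule ℝ X) where
  finiteDim : FiniteDimensional ℝ S
  b : LinearMap.BilinForm ℝ S
  nondegenerate : ∀ s : S, (∀ σ : S, b s σ = 0) → s = 0
  E : S →ₗ[ℝ] V

namespace Method

/-- `B : S → S'`, `s ↦ b(s, ·)`. -/
def B (M : Method V S) : S ≃ₗ[ℝ] Module.Dual ℝ S :=
  haveI := M.finiteDim
  LinearEquiv.ofInjectiveOfFinrankEq (M.b : S →ₗ[ℝ] Module.Dual ℝ S)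
    (by
      refine (injective_iff_map_eq_zero _).2 fun s hs => M.nondegenerate s fun σ => ?_
      rw [hs]; rfl)
    Subspace.dual_finrank_eq.symm

/-- The discrete solution `M ℓ ∈ S`, i.e. `b(M ℓ, σ) = ⟨ℓ, E σ⟩` for all `σ ∈ S`. -/
def app (M : Method V S) (l : Module.Dual ℝ V) : S := M.B.symm (l ∘ₗ M.E)

theorem app_spec (M : Method V S) (l : Module.Dual ℝ V) (σ : S) :
    M.b (M.app l) σ = l (M.E σ) := by
  have h : M.B (M.app l) = l ∘ₗ M.E := M.B.apply_symm_apply _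
  exact congrArg (fun f : Module.Dual ℝ S => f σ) h

/-- The approximation operator `P = M A : V → S`. -/
def approx (M : Method V S) (aext : LinearMap.BilinForm ℝ ↥(V ⊔ S)) (u : V) : S :=
  M.app (contForm aext u)

/-- `C ≥ 1` and `‖u - P u‖ ≤ C inf_{s ∈ S} ‖u - s‖` for all `u ∈ V`. -/
def QuasiOptimalWith (M : Method V S) (aext : LinearMap.BilinForm ℝ ↥(V ⊔ S)) (C : ℝ) : Prop :=
  1 ≤ C ∧ ∀ u : V,
    energyNorm aext (inclV V S u - inclS V S (M.approx aext u)) ≤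
      C * ⨅ s : S, energyNorm aext (inclV V S u - inclS V S s)

/-- Quasi-optimality with respect to the extended energy norm. -/
def IsQuasiOptimal (M : Method V S) (aext : LinearMap.BilinForm ℝ ↥(V ⊔ S)) : Prop :=
  ∃ C : ℝ, M.QuasiOptimalWith aext C

/-- The quasi-optimality constant. -/
def Cqopt (M : Method V S) (aext : LinearMap.BilinForm ℝ ↥(V ⊔ S)) : ℝ :=
  sInf {C : ℝ | M.QuasiOptimalWith aext C}

/-- `b = a` on `(S ∩ V) × (S ∩ V)` and `E = id` on `S ∩ V`. -/
def IsGalerkin (M : Method V S) (aext : LinearMap.BilinForm ℝ ↥(V ⊔ S)) : Prop :=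
  (∀ s σ : S, (s : X) ∈ V → (σ : X) ∈ V →
    M.b s σ = aext (inclS V S s) (inclS V S σ)) ∧
  ∀ s : S, (s : X) ∈ V → (M.E s : X) = s

end Method

end Nonconforming

namespace FEM

/-- `ℝ^d` with the Euclidean norm. -/
abbrev E (d : ℕ) : Type := EuclideanSpace ℝ (Fin d)

variable {d : ℕ}

/-! ### Domains and meshes -/

/-- Lipschitz boundary: near every boundary point, `Ω` is, in a suitable orthonormal coordinate
system with last axis `e`, the strict epigraph of a Lipschitz function of the other coordinates. -/
def HasLipschitzBoundary (Ω : Set (E d)) : Prop :=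
  ∀ x ∈ frontier Ω, ∃ e : E d, ‖e‖ = 1 ∧ ∃ (L : ℝ≥0) (g : E d → ℝ), LipschitzWith L g ∧
    ∀ᶠ y in 𝓝 x, (y ∈ Ω ↔ g (y - inner ℝ e y • e) < inner ℝ e y)

/-- The simplex with a given set of vertices. -/
def hull (K : Finset (E d)) : Set (E d) := convexHull ℝ (K : Set (E d))

/-- A simplicial face-to-face mesh of `Ω`. Elements are represented by their vertex sets. -/
structure Mesh (Ω : Set (E d)) where
  elems : Finset (Finset (E d))
  card_eq : ∀ K ∈ elems, K.card = d + 1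
  affineIndependent : ∀ K ∈ elems, AffineIndependent ℝ (fun z : K => (z : E d))
  closure_eq : closure Ω = ⋃ K ∈ elems, hull K
  conforming : ∀ K₁ ∈ elems, ∀ K₂ ∈ elems,
    hull K₁ ∩ hull K₂ = convexHull ℝ ((K₁ : Set (E d)) ∩ (K₂ : Set (E d)))

/-- Diameter of the largest ball inscribed in the simplex `K`. -/
def inDiam (K : Finset (E d)) : ℝ :=
  sSup {δ : ℝ | ∃ (x : E d) (r : ℝ), 0 ≤ r ∧ δ = 2 * r ∧ Metric.closedBall x r ⊆ hull K}

/-- The shape coefficient `h_K / ρ_K`. -/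
def shapeCoeff (K : Finset (E d)) : ℝ := Metric.diam (hull K) / inDiam K

/-- The Lagrange nodes of order `p` of the simplex `C`, i.e. (for `p ≥ 1`) the points whose
barycentric coordinates are integer multiples of `1 / p`. -/
def nodes (p : ℕ) (C : Finset (E d)) : Finset (E d) :=
  open Classical in
  (C.piAntidiag p).image fun α => ∑ z ∈ C, ((α z : ℝ) / p) • z

/-! ### Polynomials -/

/-- Polynomials in `d` real variables. -/
abbrev Poly (d : ℕ) : Type := MvPolynomial (Fin d) ℝ

/-- The value `q(x)`. -/
def ev (q : Poly d) (x : E d) : ℝ := MvPolynomial.eval (fun i => x i) q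

/-- Integral over a `(d-1)`-simplex `F` with respect to the `(d-1)`-dimensional (normalized)
Hausdorff measure. -/
def faceIntegral (F : Finset (E d)) (f : E d → ℝ) : ℝ :=
  ∫ x in hull F, f x ∂(μHE[d - 1] : Measure (E d))

/-- The restriction to the element `K` of the Lagrange basis function `Φ_z^p`: the polynomial of
degree `≤ p` with value `1` at `z` and `0` at every other Lagrange node of `K` (so it is the zero
polynomial if `z` is not a node of `K`). -/
def lagrange (p : ℕ) (z : E d) (K : Finset (E d)) : Poly d :=
  open Classical in
  Classical.epsilon fun q : Poly d =>
    q.totalDegree ≤ p ∧ ∀ y ∈ nodes p K, ev q y = if y = z then 1 else 0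

/-- The restriction to the element `K` of the bubble `∏_{z ∈ C} Φ_z^1`. For a face `C = F` this is
`Φ_F`, for an element `C` it is the element bubble. -/
def bubble (C K : Finset (E d)) : Poly d := ∏ z ∈ C, lagrange 1 z K

/-! ### Function spaces on `Ω` -/

/-- `L²(Ω)`. -/
abbrev L2 (Ω : Set (E d)) : Type := Lp ℝ 2 (volume.restrict Ω)

/-- `L²(Ω; ℝ^d)`. -/
abbrev L2Vec (Ω : Set (E d)) : Type := Lp (E d) 2 (volume.restrict Ω)

/-- `φ ∈ C_c^∞(U)`. -/
def IsTest (U : Set (E d)) (φ : E d → ℝ) : Prop :=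
  ContDiff ℝ ∞ φ ∧ HasCompactSupport φ ∧ tsupport φ ⊆ U

/-- `H^1_0(Ω)`: the closure of `C_c^∞(Ω)` with respect to the `H^1` norm, realized as the first
components of the closure of `{(φ, ∇φ)}` in `L²(Ω) × L²(Ω; ℝ^d)`. -/
def H10 (Ω : Set (E d)) : Submodule ℝ (L2 Ω) :=
  (Submodule.span ℝ {w : L2 Ω × L2Vec Ω | ∃ φ : E d → ℝ, IsTest Ω φ ∧
      (w.1 : E d → ℝ) =ᵐ[volume.restrict Ω] φ ∧
      (w.2 : E d → E d) =ᵐ[volume.restrict Ω] gradient φ}).topologicalClosure.map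
    (LinearMap.fst ℝ (L2 Ω) (L2Vec Ω))

/-- `g` is the weak gradient of `w` on the open set `U`. -/
def HasWeakGradientOn (U : Set (E d)) (w : E d → ℝ) (g : E d → E d) : Prop :=
  ∀ φ : E d → ℝ, IsTest U φ →
    ∫ x in U, w x • gradient φ x = - ∫ x in U, φ x • g x

namespace Mesh

variable {Ω : Set (E d)} (M : Mesh Ω)

/-- The shape coefficient `γ_M` of the mesh. -/
def shape : ℝ := ⨆ K : {K : Finset (E d) // K ∈ M.elems}, shapeCoeff K.1

/-- The `(d-1)`-dimensional faces of the mesh, represented by their vertex sets. -/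
def faces : Finset (Finset (E d)) :=
  open Classical in M.elems.biUnion fun K => K.powersetCard d

/-- Boundary faces. -/
def bdFaces : Finset (Finset (E d)) :=
  open Classical in M.faces.filter fun F => hull F ⊆ frontier Ω

/-- Interior faces. -/
def intFaces : Finset (Finset (E d)) :=
  open Classical in M.faces.filter fun F => ¬ hull F ⊆ frontier Ω

/-- The Lagrange nodes of order `p` of the mesh that lie in `Ω`. -/
def intNodes (p : ℕ) : Finset (E d) :=
  open Classical in (M.elems.biUnion fun K => nodes p K).filter fun z => z ∈ Ω

/-- `g ∈ L²(Ω; ℝ^d)` is the piecewise gradient of `w`. -/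
def IsBrokenGrad (w : L2 Ω) (g : L2Vec Ω) : Prop :=
  ∀ K ∈ M.elems, HasWeakGradientOn (interior (hull K)) w g

/-- The broken space `H^1(M)`. -/
def H1 : Set (L2 Ω) := {w | ∃ g : L2Vec Ω, M.IsBrokenGrad w g}

/-- The piecewise gradient `∇_M w` of `w ∈ H^1(M)`. -/
def grad (w : L2 Ω) : L2Vec Ω := Classical.epsilon fun g => M.IsBrokenGrad w g

/-- The form `a_M(w₁, w₂) = ∫_Ω ∇_M w₁ · ∇_M w₂`. -/
def aM (w₁ w₂ : L2 Ω) : ℝ :=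
  ∫ x in Ω, inner ℝ ((M.grad w₁ : E d → E d) x) ((M.grad w₂ : E d → E d) x)

/-- `s` coincides on the element `K` with the polynomial `q`. -/
def IsPiece (s : L2 Ω) (K : Finset (E d)) (q : Poly d) : Prop :=
  (s : E d → ℝ) =ᵐ[volume.restrict (Ω ∩ hull K)] ev q

/-- Discontinuous piecewise polynomials of degree `≤ p`. -/
def polySpace (p : ℕ) : Submodule ℝ (L2 Ω) where
  carrier := {s | ∀ K ∈ M.elems, ∃ q : Poly d, q.totalDegree ≤ p ∧ IsPiece s K q}
  zero_mem' := by
    intro K _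
    refine ⟨0, by simp, ?_⟩
    have h := ae_restrict_of_ae_restrict_of_subset (Set.inter_subset_left (s := Ω) (t := hull K))
      (Lp.coeFn_zero ℝ 2 (volume.restrict Ω))
    filter_upwards [h] with x hx
    refine hx.trans ?_
    simp [ev]
  add_mem' := by
    intro s t hs ht K hK
    obtain ⟨q, hq, hsq⟩ := hs K hK
    obtain ⟨r, hr, htr⟩ := ht K hK
    refine ⟨q + r, (MvPolynomial.totalDegree_add q r).trans (max_le hq hr), ?_⟩
    have h := ae_restrict_of_ae_restrict_of_subset (Set.inter_subset_left (s := Ω) (t := hull K))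
      (Lp.coeFn_add s t)
    filter_upwards [h, hsq, htr] with x hx h1 h2
    rw [hx, Pi.add_apply, h1, h2]
    simp [ev]
  smul_mem' := by
    intro c s hs K hK
    obtain ⟨q, hq, hsq⟩ := hs K hK
    refine ⟨c • q, (MvPolynomial.totalDegree_smul_le c q).trans hq, ?_⟩
    have h := ae_restrict_of_ae_restrict_of_subset (Set.inter_subset_left (s := Ω) (t := hull K))
      (Lp.coeFn_smul c s)
    filter_upwards [h, hsq] with x hx h1
    rw [hx, Pi.smul_apply, h1]
    simp [ev, MvPolynomial.smul_eval]

/-- Continuous piecewise polynomials of degree `≤ p` with vanishing trace. -/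
def lagrangeSpace (p : ℕ) : Submodule ℝ (L2 Ω) := H10 Ω ⊓ M.polySpace p

/-- The polynomial `s_{|K}`. -/
def piece (s : L2 Ω) (K : Finset (E d)) : Poly d := Classical.epsilon fun q => IsPiece s K q

/-- The space `CR_p`: the moments up to order `p - 1` of the jumps across all faces vanish, where
the jump across a boundary face is the trace from the adjacent element. -/
def crSpace (p : ℕ) : Set (L2 Ω) :=
  {s | s ∈ M.polySpace p ∧
    (∀ F ∈ M.intFaces, ∀ K₁ ∈ M.elems, ∀ K₂ ∈ M.elems, K₁ ≠ K₂ → F ⊆ K₁ → F ⊆ K₂ →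
      ∀ q : Poly d, q.totalDegree ≤ p - 1 →
        faceIntegral F (fun x => (ev (piece s K₁) x - ev (piece s K₂) x) * ev q x) = 0) ∧
    (∀ F ∈ M.bdFaces, ∀ K ∈ M.elems, F ⊆ K →
      ∀ q : Poly d, q.totalDegree ≤ p - 1 →
        faceIntegral F (fun x => ev (piece s K) x * ev q x) = 0)}

/-! ### The smoothing operator

Piecewise polynomials are handled here as families `K ↦ v_{|K}` of polynomials. -/

/-- A choice, for every interior Lagrange node `z`, of an element `K_z` containing `z`. -/
def IsNodeChoice (p : ℕ) (Kz : E d → Finset (E d)) : Prop :=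
  ∀ z ∈ M.intNodes p, Kz z ∈ M.elems ∧ z ∈ hull (Kz z)

/-- Simplified nodal averaging `A_p`. -/
def avg (p : ℕ) (Kz : E d → Finset (E d)) (v : Finset (E d) → Poly d) :
    Finset (E d) → Poly d :=
  fun K => ∑ z ∈ M.intNodes p, MvPolynomial.C (ev (v (Kz z)) z) * lagrange p z K

/-- `Q_F v ∈ P_{p-1}(F)`, represented by a polynomial on `ℝ^d` (whose restriction to `F` is
unique): `∫_F (Q_F v) q Φ_F = ∫_F v q` for all `q ∈ P_{p-1}(F)`. For `v ∈ CR_p`, the right-hand side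
does not depend on the element `K ⊇ F` from which `v` is taken. -/
def QF (p : ℕ) (v : Finset (E d) → Poly d) (F : Finset (E d)) : Poly d :=
  Classical.epsilon fun Q : Poly d => Q.totalDegree ≤ p - 1 ∧
    ∀ K ∈ M.elems, F ⊆ K → ∀ q : Poly d, q.totalDegree ≤ p - 1 →
      faceIntegral F (fun x => ev Q x * ev q x * ev (bubble F K) x) =
        faceIntegral F (fun x => ev (v K) x * ev q x)

/-- `Q_K v ∈ P_{p-2}(K)`: `∫_K (Q_K v) r Φ_K = ∫_K v r` for all `r ∈ P_{p-2}(K)`. -/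
def QK (p : ℕ) (v : Finset (E d) → Poly d) (K : Finset (E d)) : Poly d :=
  Classical.epsilon fun Q : Poly d => Q.totalDegree ≤ p - 2 ∧
    ∀ r : Poly d, r.totalDegree ≤ p - 2 →
      ∫ x in hull K, ev Q x * ev r x * ev (bubble K K) x =
        ∫ x in hull K, ev (v K) x * ev r x

/-- The face bubble operator. -/
def faceBubble (p : ℕ) (v : Finset (E d) → Poly d) : Finset (E d) → Poly d :=
  fun K => ∑ F ∈ M.intFaces, ∑ z ∈ nodes (p - 1) F,
    MvPolynomial.C (ev (M.QF p v F) z) * lagrange (p - 1) z K * bubble F K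

/-- The element bubble operator. -/
def elemBubble (p : ℕ) (v : Finset (E d) → Poly d) : Finset (E d) → Poly d :=
  fun K => ∑ K' ∈ M.elems, QK p v K' * bubble K' K

/-- The higher order bubble smoother `B_p`. -/
def bubbleSmoother (p : ℕ) (v : Finset (E d) → Poly d) : Finset (E d) → Poly d :=
  M.faceBubble p v + M.elemBubble p (v - M.faceBubble p v)

/-- `A_p v + B_p (v - A_p v)`. -/
def smoothPieces (p : ℕ) (Kz : E d → Finset (E d)) (v : Finset (E d) → Poly d) :
    Finset (E d) → Poly d :=
  M.avg p Kz v + M.bubbleSmoother p (v - M.avg p Kz v)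

/-- The piecewise polynomial function with the given pieces (set to `0` on the skeleton of the
mesh, which is a null set). -/
def glue (v : Finset (E d) → Poly d) : E d → ℝ :=
  fun x => ∑ K ∈ M.elems, (interior (hull K)).indicator (ev (v K)) x

theorem memLp_glue (v : Finset (E d) → Poly d) : MemLp (M.glue v) 2 (volume.restrict Ω) := by
  refine memLp_finsetSum _ fun K _ => ?_
  rw [memLp_indicator_iff_restrict isOpen_interior.measurableSet]
  have hc : Continuous (ev (v K)) := by
    unfold ev
    refine (MvPolynomial.continuous_eval (v K)).comp ?_
    fun_prop
  have hK : IsCompact (hull K) := K.finite_toSet.isCompact_convexHull (𝕜 := ℝ)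
  obtain ⟨C, hC⟩ := hK.exists_bound_of_continuousOn hc.continuousOn
  have hfin : volume (interior (hull K)) < ⊤ :=
    (measure_mono interior_subset).trans_lt hK.measure_lt_top
  haveI : IsFiniteMeasure ((volume.restrict Ω).restrict (interior (hull K))) :=
    ⟨by
      rw [Measure.restrict_apply_univ]
      exact (Measure.restrict_apply_le Ω _).trans_lt hfin⟩
  refine MemLp.of_bound hc.aestronglyMeasurable C ?_
  refine (ae_restrict_iff' isOpen_interior.measurableSet).2 (Filter.Eventually.of_forall ?_)
  exact fun x hx => hC x (interior_subset hx)

/-- The smoothing operator `E_p`. -/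
def smoother (p : ℕ) (Kz : E d → Finset (E d)) (σ : L2 Ω) : L2 Ω :=
  (M.memLp_glue (M.smoothPieces p Kz (piece σ))).toLp

end Mesh

end FEM

end

/-! Two properties of the smoother give quasi-optimality: overconsistency, ã(s, σ − E_p σ) = 0 for
all s, σ in S, and stability, ‖E_p σ‖ ≤ C‖σ‖. If P is the discrete solution for u and τ = P − s with
s in S, they yield ‖τ‖² = ã(u − s, E_p τ) ≤ C‖u − s‖‖τ‖, and the triangle inequality bounds the
quasi-optimality constant by 1 + C (`Method.quasiOptimalWith_of_stable`).

Overconsistency is elementwise integration by parts. With w = σ − E_p σ one has ∇s·∇w = div(w∇s) −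
wΔs, so it suffices that w has vanishing moments of degree p − 1 on all faces and p − 2 on all
elements (`IsSimplex.integral_grad_eq_zero`). The operator B_p preserves exactly these moments: face
bubbles match the face moments, and element bubbles, which vanish on faces, then repair the element
moments without disturbing them.

Stability is a scaling argument. Bubbles pull back to fixed functions on the reference simplex, so
B_p is bounded in the maximum norm of each element by a constant depending on d and p only. It
remains to bound v − A_p v at a node z, that is, to compare the values at z of pieces of v on
different elements. Two such elements are joined by a chain in which neighbours share an interior
face through z. The jump across a face has mean zero, hence is at most the sum of the oscillations
on both sides, and oscillations are bounded by gradients. Shape regularity bounds the length of the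
chain and the decay of element sizes along it. For a boundary node, the chain ends at a boundary
face, where the piece itself has mean zero. An inverse estimate leads back to gradients
(`Mesh.exists_smoother_bound`).

The chains come from topology (`Mesh.cluster_mem_nhds`): the (d−2)-skeleton is too small to separate
a ball, so the elements reachable from one element through faces at z fill a neighbourhood of z
unless a boundary face intervenes. The same fact upgrades continuity across faces to continuity, and
with compactness it shows that chains reach the boundary.

Continuous piecewise polynomials vanishing on the boundary are Lipschitz after extension by zero and
hence lie in H^1_0 (`mem_H10_of_lipschitz`), so E_p maps into V. Conversely, piecewise polynomials
in H^1_0 are continuous with zero boundary values (`Mesh.isConforming_of_mem_H10`); therefore A_p,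
and with it E_p, reproduces S ∩ V. This converse also gives definiteness: a function of V + S with
zero piecewise gradient is piecewise constant, its jumps are those of the part in S, which have mean
zero, and at a boundary face the constant is zero. -/

noncomputable section

/-! ### Polynomials on one simplex: Lagrange nodes, unisolvence, barycentric coordinates. -/

namespace FEM

variable {d : ℕ}

/-! ### Evaluation of polynomials -/

@[simp] theorem ev_add (q r : Poly d) (x : E d) : ev (q + r) x = ev q x + ev r x := by simp [ev]
@[simp] theorem ev_sub (q r : Poly d) (x : E d) : ev (q - r) x = ev q x - ev r x := by simp [ev]
@[simp] theorem ev_mul (q r : Poly d) (x : E d) : ev (q * r) x = ev q x * ev r x := by simp [ev]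
@[simp] theorem ev_zero (x : E d) : ev (0 : Poly d) x = 0 := by simp [ev]
@[simp] theorem ev_one (x : E d) : ev (1 : Poly d) x = 1 := by simp [ev]
@[simp] theorem ev_C (c : ℝ) (x : E d) : ev (MvPolynomial.C c) x = c := by simp [ev]
@[simp] theorem ev_X (i : Fin d) (x : E d) : ev (MvPolynomial.X i) x = x i := by simp [ev]
@[simp] theorem ev_smul (c : ℝ) (q : Poly d) (x : E d) : ev (c • q) x = c * ev q x := by
  simp [ev, MvPolynomial.smul_eval]
theorem ev_sum {ι : Type*} (s : Finset ι) (f : ι → Poly d) (x : E d) :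
    ev (∑ i ∈ s, f i) x = ∑ i ∈ s, ev (f i) x := by simp [ev]
theorem ev_prod {ι : Type*} (s : Finset ι) (f : ι → Poly d) (x : E d) :
    ev (∏ i ∈ s, f i) x = ∏ i ∈ s, ev (f i) x := by simp [ev]

theorem continuous_ev (q : Poly d) : Continuous (ev q) := by
  unfold ev
  exact (MvPolynomial.continuous_eval q).comp (by fun_prop)

/-- Two polynomials that agree on a nonempty open set are equal. -/
theorem eq_of_ev_eq_on_open {U : Set (E d)} (hU : IsOpen U) (hne : U.Nonempty) {q r : Poly d}
    (h : ∀ x ∈ U, ev q x = ev r x) : q = r := by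
  obtain ⟨x, hx⟩ := hne
  have hV : (fun y : Fin d → ℝ => (WithLp.toLp 2 y : E d)) ⁻¹' U ∈ 𝓝 (fun i => x i) :=
    (hU.preimage (PiLp.continuous_toLp 2 _)).mem_nhds (by simpa using hx)
  -- A neighbourhood contains a box with infinite sides, and a polynomial is determined by its
  -- values on such a box.
  rw [nhds_pi, Filter.mem_pi'] at hV
  obtain ⟨I, t, ht, hsub⟩ := hV
  refine MvPolynomial.funext_set t (fun i => infinite_of_mem_nhds _ (ht i)) fun y hy => ?_
  exact h (WithLp.toLp 2 y) (hsub fun i _ => hy i (Set.mem_univ i))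

/-! ### Full-dimensional simplices -/

/-- The finite set `K` consists of the `d + 1` vertices of a nondegenerate simplex in `ℝ^d`. -/
structure IsSimplex (K : Finset (E d)) : Prop where
  card : K.card = d + 1
  indep : AffineIndependent ℝ (fun z : K => (z : E d))

theorem Mesh.isSimplex {Ω : Set (E d)} (M : Mesh Ω) {K : Finset (E d)} (hK : K ∈ M.elems) :
    IsSimplex K := ⟨M.card_eq K hK, M.affineIndependent K hK⟩

/-- The vertices of a nondegenerate simplex as an affine basis. -/
def IsSimplex.basis {K : Finset (E d)} (hK : IsSimplex K) : AffineBasis K ℝ (E d) where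
  toFun := fun z => z
  ind' := hK.indep
  tot' := by
    rw [hK.indep.affineSpan_eq_top_iff_card_eq_finrank_add_one]
    simp [hK.card]

theorem IsSimplex.basis_apply {K : Finset (E d)} (hK : IsSimplex K) (z : K) :
    hK.basis z = z := rfl

theorem IsSimplex.range_basis {K : Finset (E d)} (hK : IsSimplex K) :
    Set.range hK.basis = (K : Set (E d)) := by
  ext x; simp [IsSimplex.basis_apply]

theorem affineMap_apply_sum {ι : Type*} (f : E d →ᵃ[ℝ] ℝ) (s : Finset ι) (w : ι → ℝ) (y : ι → E d)
    (hw : ∑ i ∈ s, w i = 1) : f (∑ i ∈ s, w i • y i) = ∑ i ∈ s, w i * f (y i) := by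
  have h : ∀ x, f x = f.linear x + f 0 := fun x => congrFun f.decomp x
  rw [h, map_sum]
  have : ∑ i ∈ s, w i * f (y i) = ∑ i ∈ s, w i * f.linear (y i) + (∑ i ∈ s, w i) * f 0 := by
    rw [Finset.sum_mul, ← Finset.sum_add_distrib]
    exact Finset.sum_congr rfl fun i _ => by rw [h (y i)]; ring
  rw [this, hw]; simp

theorem exists_poly_of_affineMap (f : E d →ᵃ[ℝ] ℝ) :
    ∃ q : Poly d, q.totalDegree ≤ 1 ∧ ∀ x, ev q x = f x := by
  refine ⟨MvPolynomial.C (f 0) + ∑ i, MvPolynomial.C (f.linear (EuclideanSpace.single i 1)) *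
    MvPolynomial.X i, ?_, fun x => ?_⟩
  · refine (MvPolynomial.totalDegree_add _ _).trans (max_le (by simp) ?_)
    refine MvPolynomial.totalDegree_finsetSum_le fun i _ => ?_
    exact (MvPolynomial.totalDegree_mul _ _).trans (by simp)
  · have h : f x = f.linear x + f 0 := congrFun f.decomp x
    have hx : x = ∑ i, x i • EuclideanSpace.single i (1 : ℝ) := by
      ext j; simp [Finset.sum_apply, Pi.single_apply]
    rw [h]
    conv_rhs => rw [hx, map_sum]
    simp only [ev_add, ev_C, ev_sum, ev_mul, ev_X, map_smul, smul_eq_mul]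
    rw [add_comm]
    congr 1
    exact Finset.sum_congr rfl fun i _ => mul_comm _ _

/-- Barycentric coordinates as polynomials. -/
def IsSimplex.coordPoly {K : Finset (E d)} (hK : IsSimplex K) (z : K) : Poly d :=
  (exists_poly_of_affineMap (hK.basis.coord z)).choose

theorem IsSimplex.totalDegree_coordPoly {K : Finset (E d)} (hK : IsSimplex K) (z : K) :
    (hK.coordPoly z).totalDegree ≤ 1 :=
  (exists_poly_of_affineMap (hK.basis.coord z)).choose_spec.1

theorem IsSimplex.ev_coordPoly {K : Finset (E d)} (hK : IsSimplex K) (z : K) (x : E d) :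
    ev (hK.coordPoly z) x = hK.basis.coord z x :=
  (exists_poly_of_affineMap (hK.basis.coord z)).choose_spec.2 x

/-! ### Lagrange nodes -/

/-- The point of `C` with barycentric coordinates `α / p`. -/
def node (p : ℕ) (C : Finset (E d)) (α : E d → ℕ) : E d := ∑ z ∈ C, ((α z : ℝ) / p) • z

theorem mem_nodes {p : ℕ} {C : Finset (E d)} {x : E d} :
    x ∈ nodes p C ↔ ∃ α : E d → ℕ, (∑ z ∈ C, α z = p ∧ ∀ z, α z ≠ 0 → z ∈ C) ∧ node p C α = x := by
  classical
  unfold nodes node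
  simp only [Finset.mem_image, Finset.mem_piAntidiag]

theorem sum_div_eq_one {p : ℕ} (hp : 1 ≤ p) {C : Finset (E d)} {α : E d → ℕ}
    (hα : ∑ z ∈ C, α z = p) : ∑ z ∈ C, ((α z : ℝ) / p) = 1 := by
  rw [← Finset.sum_div, ← Nat.cast_sum, hα, div_self]
  positivity

theorem node_mem_hull {p : ℕ} (hp : 1 ≤ p) {C : Finset (E d)} {α : E d → ℕ}
    (hα : ∑ z ∈ C, α z = p) : node p C α ∈ hull C :=
  (convex_convexHull ℝ _).sum_mem (fun z _ => by positivity) (sum_div_eq_one hp hα)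
    fun z hz => subset_convexHull ℝ _ hz

theorem nodes_subset_hull {p : ℕ} (hp : 1 ≤ p) {C : Finset (E d)} {x : E d} (hx : x ∈ nodes p C) :
    x ∈ hull C := by
  obtain ⟨α, hα, rfl⟩ := mem_nodes.1 hx
  exact node_mem_hull hp hα.1

theorem nodes_mono {p : ℕ} {C K : Finset (E d)} (h : C ⊆ K) : nodes p C ⊆ nodes p K := by
  intro x hx
  obtain ⟨α, hα, rfl⟩ := mem_nodes.1 hx
  have h0 : ∀ z ∈ K, z ∉ C → α z = 0 := fun z _ hz => by
    by_contra h; exact hz (hα.2 z h)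
  refine mem_nodes.2 ⟨α, ⟨?_, fun z hz => h (hα.2 z hz)⟩, ?_⟩
  · rw [← hα.1]; exact (Finset.sum_subset h h0).symm
  · exact (Finset.sum_subset h fun z hz hz' => by simp [h0 z hz hz']).symm

/-- Makes every result on Lagrange functions available for barycentric coordinates, which are the
case of order one. -/
theorem nodes_one (C : Finset (E d)) : nodes 1 C = C := by
  classical
  ext x
  rw [mem_nodes]
  constructor
  · rintro ⟨α, ⟨hα, hs⟩, rfl⟩
    obtain ⟨z, hz, hne⟩ : ∃ z ∈ C, α z ≠ 0 := by
      by_contra! h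
      rw [Finset.sum_eq_zero h] at hα; omega
    have h1 : α z + ∑ y ∈ C.erase z, α y = 1 := by rw [Finset.add_sum_erase _ _ hz, hα]
    have h2 : ∑ y ∈ C.erase z, α y = 0 := by omega
    have h3 : ∀ y ∈ C, y ≠ z → α y = 0 := fun y hy hyz =>
      Finset.sum_eq_zero_iff.1 h2 y (Finset.mem_erase.2 ⟨hyz, hy⟩)
    have h4 : node 1 C α = z := by
      unfold node
      rw [Finset.sum_eq_single z (fun y hy hyz => by simp [h3 y hy hyz]) (fun h => absurd hz h)]
      have : α z = 1 := by omega
      simp [this]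
    rw [h4]; exact hz
  · intro hx
    refine ⟨fun y => if y = x then 1 else 0, ⟨by simp [hx], fun z hz => ?_⟩, ?_⟩
    · by_cases h : z = x
      · rwa [h]
      · simp [h] at hz
    · simp [node, hx]

theorem IsSimplex.coord_node {K : Finset (E d)} (hK : IsSimplex K) {p : ℕ} (hp : 1 ≤ p)
    {α : E d → ℕ} (hα : ∑ z ∈ K, α z = p) (z : K) :
    hK.basis.coord z (node p K α) = (α z : ℝ) / p := by
  classical
  unfold node
  rw [affineMap_apply_sum _ _ _ _ (sum_div_eq_one hp hα), Finset.sum_eq_single (z : E d)]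
  · have : hK.basis.coord z (hK.basis z) = 1 := hK.basis.coord_apply_eq z
    rw [IsSimplex.basis_apply] at this; rw [this, mul_one]
  · intro y hy hyz
    have : hK.basis.coord z (hK.basis ⟨y, hy⟩) = 0 :=
      hK.basis.coord_apply_ne fun h => hyz (by rw [h])
    rw [IsSimplex.basis_apply] at this; rw [this, mul_zero]
  · exact fun h => absurd z.2 h

/-! ### The explicit Lagrange basis and unisolvence -/

/-- The polynomial of degree `|α|` with value `1` at the node `α` and `0` at all others. -/
def IsSimplex.lag {K : Finset (E d)} (hK : IsSimplex K) (p : ℕ) (α : E d → ℕ) : Poly d :=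
  ∏ z : K, ∏ j ∈ Finset.range (α z),
    MvPolynomial.C (((α z : ℝ) - j)⁻¹) *
      (MvPolynomial.C (p : ℝ) * hK.coordPoly z - MvPolynomial.C (j : ℝ))

theorem IsSimplex.totalDegree_lag {K : Finset (E d)} (hK : IsSimplex K) {p : ℕ} {α : E d → ℕ}
    (hα : ∑ z ∈ K, α z = p) : (hK.lag p α).totalDegree ≤ p := by
  unfold IsSimplex.lag
  refine (MvPolynomial.totalDegree_finsetProd _ _).trans ?_
  calc _ ≤ ∑ z : K, α z := Finset.sum_le_sum fun z _ => by
        refine (MvPolynomial.totalDegree_finsetProd _ _).trans ?_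
        refine (Finset.sum_le_card_nsmul _ _ 1 fun j _ => ?_).trans (by simp)
        refine (MvPolynomial.totalDegree_mul _ _).trans ?_
        rw [MvPolynomial.totalDegree_C, zero_add]
        refine (MvPolynomial.totalDegree_sub _ _).trans
          (max_le ?_ ((MvPolynomial.totalDegree_C _).trans_le zero_le_one))
        refine (MvPolynomial.totalDegree_mul _ _).trans ?_
        rw [MvPolynomial.totalDegree_C, zero_add]
        exact hK.totalDegree_coordPoly z
    _ = p := by rw [← hα, ← Finset.sum_coe_sort K]

theorem IsSimplex.ev_lag {K : Finset (E d)} (hK : IsSimplex K) (p : ℕ) (α : E d → ℕ) (x : E d) :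
    ev (hK.lag p α) x = ∏ z : K, ∏ j ∈ Finset.range (α z),
      ((α z : ℝ) - j)⁻¹ * (p * hK.basis.coord z x - j) := by
  simp only [IsSimplex.lag, ev_prod, ev_mul, ev_sub, ev_C, hK.ev_coordPoly]

/-- Two different multi-indices with equal sums satisfy `β z < α z` for some `z`; the factor of
`hK.lag p α` with `j = β z` then vanishes at the node of `β`. -/
theorem IsSimplex.ev_lag_node {K : Finset (E d)} (hK : IsSimplex K) {p : ℕ} (hp : 1 ≤ p)
    {α β : E d → ℕ} (hα : ∑ z ∈ K, α z = p) (hβ : ∑ z ∈ K, β z = p) :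
    ev (hK.lag p α) (node p K β) = open Classical in if ∀ z ∈ K, α z = β z then 1 else 0 := by
  classical
  have hp0 : (p : ℝ) ≠ 0 := by positivity
  rw [hK.ev_lag]
  simp only [hK.coord_node hp hβ, mul_div_cancel₀ _ hp0]
  split_ifs with h
  · refine Finset.prod_eq_one fun z _ => Finset.prod_eq_one fun j hj => ?_
    rw [← h z z.2]
    refine inv_mul_cancel₀ (sub_ne_zero.2 ?_)
    exact_mod_cast (Finset.mem_range.1 hj).ne'
  · obtain ⟨z, hz, hlt⟩ : ∃ z ∈ K, β z < α z := by
      by_contra! hle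
      exact h ((Finset.sum_eq_sum_iff_of_le hle).1 (hα.trans hβ.symm))
    refine Finset.prod_eq_zero (Finset.mem_univ ⟨z, hz⟩) ?_
    exact Finset.prod_eq_zero (Finset.mem_range.2 hlt) (by simp)

/-- An exponent of degree at most `p` in `d` variables becomes a multi-index of sum exactly `p` on
the `d + 1` vertices by adding the slack `p - ∑ i, n i` as a further entry. One inequality suffices,
since the other follows from the Lagrange basis. -/
theorem IsSimplex.card_monomials_le {K : Finset (E d)} (hK : IsSimplex K) (p : ℕ) :
    Module.finrank ℝ (MvPolynomial.restrictTotalDegree (Fin d) ℝ p) ≤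
      (open Classical in K.piAntidiag p).card := by
  classical
  have e : K ≃ Fin (d + 1) := K.equivFinOfCardEq hK.card
  have b := MvPolynomial.basisRestrictSupport ℝ
    {n : Fin d →₀ ℕ | (n.sum fun _ e => e) ≤ p}
  have hfr : Module.finrank ℝ (MvPolynomial.restrictTotalDegree (Fin d) ℝ p) =
    Nat.card {n : Fin d →₀ ℕ | (n.sum fun _ e => e) ≤ p} := Module.finrank_eq_nat_card_basis b
  rw [hfr]
  let F : {n : Fin d →₀ ℕ | (n.sum fun _ e => e) ≤ p} → (K.piAntidiag p) := fun n =>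
    ⟨fun z => if h : z ∈ K then
      (Fin.cons (p - ∑ i, n.1 i) (fun i => n.1 i) : Fin (d + 1) → ℕ) (e ⟨z, h⟩) else 0, by
      have hn : ∑ i, n.1 i ≤ p := by
        have := n.2
        rw [Set.mem_ofPred_eq, Finsupp.sum_fintype _ _ (fun _ => rfl)] at this
        exact this
      rw [Finset.mem_piAntidiag]
      refine ⟨?_, fun z hz => by by_contra h; simp [h] at hz⟩
      rw [← Finset.sum_coe_sort K]
      simp only [Subtype.coe_eta, Finset.coe_mem, dite_true]
      rw [e.sum_comp (Fin.cons (p - ∑ i, n.1 i) (fun i => n.1 i) : Fin (d + 1) → ℕ), Fin.sum_cons]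
      omega⟩
  have hF : Function.Injective F := by
    intro m n hmn
    ext i
    have h1 := congrFun (congrArg Subtype.val hmn) (e.symm i.succ : K)
    simpa [F] using h1
  calc _ ≤ Nat.card (K.piAntidiag p) := Nat.card_le_card_of_injective F hF
    _ = _ := by rw [Nat.card_eq_fintype_card, Fintype.card_coe]

/-- Evaluation at the Lagrange nodes is injective on polynomials of degree `≤ p`. -/
theorem IsSimplex.eq_zero_of_nodes {K : Finset (E d)} (hK : IsSimplex K) {p : ℕ} (hp : 1 ≤ p)
    {q : Poly d} (hq : q.totalDegree ≤ p) (h : ∀ y ∈ nodes p K, ev q y = 0) : q = 0 := by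
  classical
  let W := MvPolynomial.restrictTotalDegree (Fin d) ℝ p
  let T : W →ₗ[ℝ] (K.piAntidiag p → ℝ) :=
    { toFun := fun q α => ev q.1 (node p K α)
      map_add' := fun q r => by ext α; simp
      map_smul' := fun c q => by ext α; simp }
  have hT : Function.Surjective T := by
    rw [← LinearMap.range_eq_top, eq_top_iff, ← (Pi.basisFun ℝ (K.piAntidiag p)).span_eq,
      Submodule.span_le]
    rintro _ ⟨α, rfl⟩
    have hα := Finset.mem_piAntidiag.1 α.2
    refine ⟨⟨hK.lag p α, (MvPolynomial.mem_restrictTotalDegree _ _ _).2 (hK.totalDegree_lag hα.1)⟩, ?_⟩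
    ext β
    have hβ := Finset.mem_piAntidiag.1 β.2
    change ev (hK.lag p α) (node p K β) = _
    rw [hK.ev_lag_node hp hα.1 hβ.1, Pi.basisFun_apply, Pi.single_apply]
    congr 1
    simp only [eq_iff_iff]
    constructor
    · intro h
      ext z
      by_cases hz : z ∈ K
      · exact (h z hz).symm
      · have h1 : β.1 z = 0 := by by_contra h'; exact hz (hβ.2 z h')
        have h2 : α.1 z = 0 := by by_contra h'; exact hz (hα.2 z h')
        rw [h1, h2]
    · rintro rfl z _; rfl
  -- Surjectivity gives one inequality and the monomial count the other; with equal dimensions,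
  -- surjectivity becomes injectivity.
  have hfin : Module.finrank ℝ W = Module.finrank ℝ (K.piAntidiag p → ℝ) := by
    refine le_antisymm ?_ (LinearMap.finrank_le_finrank_of_surjective hT)
    simpa using hK.card_monomials_le p
  have hinj := (LinearMap.injective_iff_surjective_of_finrank_eq_finrank hfin).2 hT
  have : (⟨q, (MvPolynomial.mem_restrictTotalDegree _ _ _).2 hq⟩ : W) = 0 := by
    apply hinj
    ext α
    have hα := Finset.mem_piAntidiag.1 α.2
    simpa [T] using h _ (mem_nodes.2 ⟨α, hα, rfl⟩)
  exact congrArg Subtype.val this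

theorem IsSimplex.node_injective {K : Finset (E d)} (hK : IsSimplex K) {p : ℕ} (hp : 1 ≤ p)
    {α β : E d → ℕ} (hα : ∑ z ∈ K, α z = p) (hβ : ∑ z ∈ K, β z = p)
    (h : node p K α = node p K β) : ∀ z ∈ K, α z = β z := by
  intro z hz
  have h1 := hK.coord_node hp hα ⟨z, hz⟩
  rw [h, hK.coord_node hp hβ ⟨z, hz⟩] at h1
  have hp0 : (p : ℝ) ≠ 0 := by positivity
  field_simp at h1
  exact_mod_cast h1.symm

/-- Provides the witness for the `Classical.epsilon` in `lagrange`. If `z` is not a node of `K`, the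
zero polynomial qualifies. -/
theorem IsSimplex.exists_lagrange {K : Finset (E d)} (hK : IsSimplex K) {p : ℕ} (hp : 1 ≤ p)
    (z : E d) : ∃ q : Poly d, q.totalDegree ≤ p ∧
      ∀ y ∈ nodes p K, ev q y = open Classical in if y = z then 1 else 0 := by
  classical
  by_cases hz : z ∈ nodes p K
  · obtain ⟨α, hα, rfl⟩ := mem_nodes.1 hz
    refine ⟨hK.lag p α, hK.totalDegree_lag hα.1, fun y hy => ?_⟩
    obtain ⟨β, hβ, rfl⟩ := mem_nodes.1 hy
    rw [hK.ev_lag_node hp hα.1 hβ.1]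
    congr 1
    simp only [eq_iff_iff]
    refine ⟨fun h => ?_, fun h => hK.node_injective hp hα.1 hβ.1 h.symm⟩
    exact Finset.sum_congr rfl fun w hw => by rw [h w hw]
  · exact ⟨0, by simp, fun y hy => by simp [ne_of_mem_of_not_mem hy hz]⟩

theorem IsSimplex.lagrange_spec {K : Finset (E d)} (hK : IsSimplex K) {p : ℕ} (hp : 1 ≤ p)
    (z : E d) : (lagrange p z K).totalDegree ≤ p ∧
      ∀ y ∈ nodes p K, ev (lagrange p z K) y = open Classical in if y = z then 1 else 0 :=
  Classical.epsilon_spec (hK.exists_lagrange hp z)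

theorem IsSimplex.totalDegree_lagrange {K : Finset (E d)} (hK : IsSimplex K) {p : ℕ} (hp : 1 ≤ p)
    (z : E d) : (lagrange p z K).totalDegree ≤ p := (hK.lagrange_spec hp z).1

theorem IsSimplex.eq_of_nodes {K : Finset (E d)} (hK : IsSimplex K) {p : ℕ} (hp : 1 ≤ p)
    {q r : Poly d} (hq : q.totalDegree ≤ p) (hr : r.totalDegree ≤ p)
    (h : ∀ y ∈ nodes p K, ev q y = ev r y) : q = r :=
  sub_eq_zero.1 <| hK.eq_zero_of_nodes hp ((MvPolynomial.totalDegree_sub _ _).trans (max_le hq hr))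
    fun y hy => by simp [h y hy]

theorem IsSimplex.lagrange_eq_zero {K : Finset (E d)} (hK : IsSimplex K) {p : ℕ} (hp : 1 ≤ p)
    {z : E d} (hz : z ∉ nodes p K) : lagrange p z K = 0 :=
  hK.eq_zero_of_nodes hp (hK.totalDegree_lagrange hp z) fun y hy => by
    rw [(hK.lagrange_spec hp z).2 y hy, if_neg (ne_of_mem_of_not_mem hy hz)]

theorem IsSimplex.lagrange_node {K : Finset (E d)} (hK : IsSimplex K) {p : ℕ} (hp : 1 ≤ p)
    {α : E d → ℕ} (hα : ∑ z ∈ K, α z = p) :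
    lagrange p (node p K α) K = hK.lag p α := by
  classical
  refine hK.eq_of_nodes hp (hK.totalDegree_lagrange hp _) (hK.totalDegree_lag hα) fun y hy => ?_
  rw [(hK.lagrange_spec hp _).2 y hy]
  obtain ⟨β, hβ, rfl⟩ := mem_nodes.1 hy
  rw [hK.ev_lag_node hp hα hβ.1]
  congr 1
  simp only [eq_iff_iff]
  refine ⟨fun h => hK.node_injective hp hα hβ.1 h.symm, fun h => ?_⟩
  exact Finset.sum_congr rfl fun w hw => by rw [h w hw]

/-- Lagrange interpolation reproduces polynomials of degree `≤ p`. -/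
theorem IsSimplex.eq_sum_lagrange {K : Finset (E d)} (hK : IsSimplex K) {p : ℕ} (hp : 1 ≤ p)
    {q : Poly d} (hq : q.totalDegree ≤ p) :
    q = ∑ z ∈ nodes p K, MvPolynomial.C (ev q z) * lagrange p z K := by
  classical
  refine hK.eq_of_nodes hp hq (MvPolynomial.totalDegree_finsetSum_le fun z _ => ?_) fun y hy => ?_
  · refine (MvPolynomial.totalDegree_mul _ _).trans ?_
    rw [MvPolynomial.totalDegree_C, zero_add]
    exact hK.totalDegree_lagrange hp z
  · rw [ev_sum, Finset.sum_eq_single y]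
    · simp [(hK.lagrange_spec hp y).2 y hy]
    · intro z _ hzy
      simp [(hK.lagrange_spec hp z).2 y hy, hzy.symm]
    · exact fun h => absurd hy h

/-! ### Barycentric coordinates -/

/-- The barycentric coordinate of `x` with respect to the vertex `z` of `K`; zero if `z ∉ K`. -/
def lam (K : Finset (E d)) (z x : E d) : ℝ := ev (lagrange 1 z K) x

theorem continuous_lam (K : Finset (E d)) (z : E d) : Continuous (lam K z) := continuous_ev _

theorem isCompact_hull (K : Finset (E d)) : IsCompact (hull K) :=
  K.finite_toSet.isCompact_convexHull (𝕜 := ℝ)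

namespace IsSimplex

variable {K : Finset (E d)} (hK : IsSimplex K)
include hK

theorem lam_eq_coord (z : K) (x : E d) : lam K z x = hK.basis.coord z x := by
  classical
  have h : lagrange 1 (z : E d) K = hK.coordPoly z := by
    refine hK.eq_of_nodes le_rfl (hK.totalDegree_lagrange le_rfl _) (hK.totalDegree_coordPoly z)
      fun y hy => ?_
    rw [(hK.lagrange_spec le_rfl _).2 y hy, hK.ev_coordPoly]
    rw [nodes_one] at hy
    have := hK.basis.coord_apply z ⟨y, hy⟩
    rw [hK.basis_apply] at this
    rw [this]
    congr 1
    simp only [eq_iff_iff, Subtype.ext_iff]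
    exact eq_comm
  rw [lam, h, hK.ev_coordPoly]

theorem lam_of_notMem {z : E d} (hz : z ∉ K) (x : E d) : lam K z x = 0 := by
  rw [lam, hK.lagrange_eq_zero le_rfl (by rwa [nodes_one])]; simp

theorem lam_vertex {z y : E d} (hy : y ∈ K) :
    lam K z y = open Classical in if y = z then 1 else 0 :=
  (hK.lagrange_spec le_rfl z).2 y (by rwa [nodes_one])

theorem sum_lam (x : E d) : ∑ z ∈ K, lam K z x = 1 := by
  rw [← Finset.sum_coe_sort K]
  simp only [hK.lam_eq_coord]
  exact hK.basis.sum_coord_apply_eq_one x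

theorem sum_lam_smul (x : E d) : ∑ z ∈ K, lam K z x • z = x := by
  rw [← Finset.sum_coe_sort K (fun z => lam K z x • z)]
  simp only [hK.lam_eq_coord]
  exact hK.basis.linear_combination_coord_eq_self x

theorem lam_sum {ι : Type*} (z : E d) (s : Finset ι) (w : ι → ℝ) (y : ι → E d)
    (hw : ∑ i ∈ s, w i = 1) : lam K z (∑ i ∈ s, w i • y i) = ∑ i ∈ s, w i * lam K z (y i) := by
  by_cases hz : z ∈ K
  · have h := hK.lam_eq_coord ⟨z, hz⟩
    simp only at h
    simp only [h]
    exact affineMap_apply_sum _ _ _ _ hw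
  · simp [hK.lam_of_notMem hz]

theorem lam_combo (z x y : E d) (a b : ℝ) (hab : a + b = 1) :
    lam K z (a • x + b • y) = a * lam K z x + b * lam K z y := by
  have := hK.lam_sum z Finset.univ ![a, b] ![x, y] (by simpa using hab)
  simpa using this

theorem lam_add_smul_sub (z x y v : E d) (t : ℝ) :
    lam K z (v + t • (y - x)) = lam K z v + t * (lam K z y - lam K z x) := by
  have := hK.lam_sum z Finset.univ ![1, t, -t] ![v, y, x] (by simp [Fin.sum_univ_three])
  simp only [Fin.sum_univ_three] at this
  simp only [Matrix.cons_val_zero, Matrix.cons_val_one, Matrix.cons_val] at this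
  rw [show v + t • (y - x) = (1 : ℝ) • v + t • y + (-t) • x by module, this]
  ring

theorem hull_eq : hull K = {x | ∀ z ∈ K, 0 ≤ lam K z x} := by
  have := hK.basis.convexHull_eq_nonneg_coord
  rw [hK.range_basis] at this
  rw [hull, this]
  ext x
  simp only [Set.mem_ofPred_eq, Subtype.forall]
  exact forall₂_congr fun z hz => by rw [← hK.lam_eq_coord ⟨z, hz⟩]

theorem mem_hull {x : E d} : x ∈ hull K ↔ ∀ z ∈ K, 0 ≤ lam K z x := by rw [hK.hull_eq]; rfl

theorem lam_nonneg {x : E d} (hx : x ∈ hull K) (z : E d) : 0 ≤ lam K z x := by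
  by_cases hz : z ∈ K
  · exact hK.mem_hull.1 hx z hz
  · rw [hK.lam_of_notMem hz]

theorem lam_le_one {x : E d} (hx : x ∈ hull K) (z : E d) : lam K z x ≤ 1 := by
  by_cases hz : z ∈ K
  · rw [← hK.sum_lam x]
    exact Finset.single_le_sum (f := fun z => lam K z x) (fun y _ => hK.lam_nonneg hx y) hz
  · rw [hK.lam_of_notMem hz]; exact zero_le_one

theorem mem_interior {x : E d} : x ∈ interior (hull K) ↔ ∀ z ∈ K, 0 < lam K z x := by
  have := hK.basis.interior_convexHull
  rw [hK.range_basis] at this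
  rw [hull, this]
  simp only [Set.mem_ofPred_eq, Subtype.forall]
  exact forall₂_congr fun z hz => by rw [← hK.lam_eq_coord ⟨z, hz⟩]

theorem mem_hull_face {C : Finset (E d)} (hC : C ⊆ K) {x : E d} :
    x ∈ hull C ↔ x ∈ hull K ∧ ∀ z ∈ K, z ∉ C → lam K z x = 0 := by
  classical
  constructor
  · intro hx
    refine ⟨convexHull_mono (by exact_mod_cast hC) hx, fun z hz hzC => ?_⟩
    rw [hull, Finset.mem_convexHull'] at hx
    obtain ⟨w, -, hw1, rfl⟩ := hx
    rw [hK.lam_sum z C w (fun y => y) hw1]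
    refine Finset.sum_eq_zero fun y hy => ?_
    rw [hK.lam_vertex (hC hy), if_neg (ne_of_mem_of_not_mem hy hzC), mul_zero]
  · rintro ⟨hx, h0⟩
    rw [hull, Finset.mem_convexHull']
    refine ⟨fun z => lam K z x, fun z _ => hK.lam_nonneg hx z, ?_, ?_⟩
    · rw [Finset.sum_subset hC h0, hK.sum_lam]
    · rw [Finset.sum_subset hC fun z hz hzC => by simp [h0 z hz hzC], hK.sum_lam_smul]

theorem nonempty : K.Nonempty := by
  rw [← Finset.card_pos, hK.card]; omega

theorem interior_nonempty : (interior (hull K)).Nonempty := by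
  refine ⟨∑ z ∈ K, ((d : ℝ) + 1)⁻¹ • z, hK.mem_interior.2 fun z hz => ?_⟩
  classical
  have h1 : ∑ z ∈ K, ((d : ℝ) + 1)⁻¹ = 1 := by
    rw [Finset.sum_const, hK.card, nsmul_eq_mul]; push_cast; field_simp
  rw [hK.lam_sum z K (fun _ => ((d : ℝ) + 1)⁻¹) (fun y => y) h1,
    Finset.sum_eq_single z (fun y hy hyz => by rw [hK.lam_vertex hy, if_neg hyz, mul_zero])
    (fun h => absurd hz h), hK.lam_vertex hz]
  simp only [if_true]
  positivity

end IsSimplex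

/-! ### Lagrange functions on faces -/

namespace IsSimplex

variable {K : Finset (E d)} (hK : IsSimplex K) {p : ℕ} (hp : 1 ≤ p)
include hK hp

/-- A node outside the face has a positive entry `α w` at some vertex `w ∉ C`. The factor `j = 0` of
the Lagrange polynomial is then a multiple of the barycentric coordinate of `w`, which is zero on
the face. -/
theorem lagrange_eq_zero_on_face {C : Finset (E d)} (hC : C ⊆ K) {z x : E d}
    (hz : z ∉ nodes p C) (hx : x ∈ hull C) : ev (lagrange p z K) x = 0 := by
  by_cases hzK : z ∈ nodes p K
  · obtain ⟨α, hα, rfl⟩ := mem_nodes.1 hzK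
    obtain ⟨w, hw, hwC⟩ : ∃ w, α w ≠ 0 ∧ w ∉ C := by
      by_contra! h
      have h0 : ∀ z ∈ K, z ∉ C → α z = 0 := fun z _ hzC => by
        by_contra h'; exact hzC (h z h')
      refine hz (mem_nodes.2 ⟨α, ⟨?_, h⟩, ?_⟩)
      · rw [← hα.1]; exact Finset.sum_subset hC h0
      · exact Finset.sum_subset hC fun z hz hzC => by simp [h0 z hz hzC]
    have hwK := hα.2 w hw
    rw [hK.lagrange_node hp hα.1, hK.ev_lag]
    refine Finset.prod_eq_zero (Finset.mem_univ ⟨w, hwK⟩) ?_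
    refine Finset.prod_eq_zero (Finset.mem_range.2 (Nat.pos_of_ne_zero hw)) ?_
    rw [← hK.lam_eq_coord ⟨w, hwK⟩, ((hK.mem_hull_face hC).1 hx).2 w hwK hwC]
    simp
  · rw [hK.lagrange_eq_zero hp hzK, ev_zero]

theorem ev_eq_sum_face {C : Finset (E d)} (hC : C ⊆ K) {q : Poly d} (hq : q.totalDegree ≤ p)
    {x : E d} (hx : x ∈ hull C) :
    ev q x = ∑ z ∈ nodes p C, ev q z * ev (lagrange p z K) x := by
  conv_lhs => rw [hK.eq_sum_lagrange hp hq]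
  rw [ev_sum, ← Finset.sum_subset (nodes_mono hC)]
  · simp
  · intro z _ hz
    simp [hK.lagrange_eq_zero_on_face hp hC hz hx]

/-- On a common face both restrictions are determined by their values at the nodes of the face, and
these agree. This makes the elementwise functions `lagrange p z` fit together to a continuous
function. -/
theorem lagrange_continuous {K' C : Finset (E d)} (hK' : IsSimplex K') (hC : C ⊆ K)
    (hC' : C ⊆ K') (z : E d) {x : E d} (hx : x ∈ hull C) :
    ev (lagrange p z K) x = ev (lagrange p z K') x := by
  classical
  rw [hK'.ev_eq_sum_face hp hC' (hK.totalDegree_lagrange hp z) hx]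
  by_cases hz : z ∈ nodes p C
  · rw [Finset.sum_eq_single z]
    · rw [(hK.lagrange_spec hp z).2 z (nodes_mono hC hz)]; simp
    · intro y hy hyz
      rw [(hK.lagrange_spec hp z).2 y (nodes_mono hC hy), if_neg hyz, zero_mul]
    · exact fun h => absurd hz h
  · rw [hK'.lagrange_eq_zero_on_face hp hC' hz hx]
    refine Finset.sum_eq_zero fun y hy => ?_
    rw [(hK.lagrange_spec hp z).2 y (nodes_mono hC hy), if_neg (ne_of_mem_of_not_mem hy hz),
      zero_mul]

/-- The Lagrange polynomial is a product of `p` factors. Their denominators `α z - j` are at least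
`1`, and their numerators have modulus at most `p` on the simplex. -/
theorem abs_lagrange_le (z : E d) {x : E d} (hx : x ∈ hull K) :
    |ev (lagrange p z K) x| ≤ (p : ℝ) ^ p := by
  by_cases hzK : z ∈ nodes p K
  · obtain ⟨α, hα, rfl⟩ := mem_nodes.1 hzK
    rw [hK.lagrange_node hp hα.1, hK.ev_lag, Finset.abs_prod]
    have hp1 : (1 : ℝ) ≤ p := by exact_mod_cast hp
    calc _ ≤ ∏ z : K, (p : ℝ) ^ (α z) := by
          refine Finset.prod_le_prod (fun _ _ => abs_nonneg _) fun w _ => ?_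
          rw [Finset.abs_prod]
          refine (Finset.prod_le_prod (g := fun _ => (p : ℝ)) (fun _ _ => abs_nonneg _)
            fun j hj => ?_).trans (by simp)
          have hj' := Finset.mem_range.1 hj
          have h1 : (1 : ℝ) ≤ (α w : ℝ) - j := by
            rw [le_sub_iff_add_le]; exact_mod_cast (by omega : 1 + j ≤ α w)
          have hαp : (α w : ℕ) ≤ p := by
            rw [← hα.1]; exact Finset.single_le_sum (f := α) (fun _ _ => Nat.zero_le _) w.2
          have hjp : (j : ℝ) ≤ p := by exact_mod_cast (by omega : j ≤ p)
          rw [abs_mul, abs_inv, abs_of_nonneg (zero_le_one.trans h1)]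
          have h2 := hK.lam_nonneg hx w
          have h3 := hK.lam_le_one hx w
          rw [hK.lam_eq_coord] at h2 h3
          have h4 : |(p : ℝ) * hK.basis.coord w x - j| ≤ p := by
            rw [abs_le]
            have : (p : ℝ) * hK.basis.coord w x ≤ p * 1 := by gcongr
            have : 0 ≤ (p : ℝ) * hK.basis.coord w x := by positivity
            constructor <;> nlinarith [(Nat.cast_nonneg j : (0 : ℝ) ≤ j)]
          calc _ ≤ 1 * (p : ℝ) := by
                gcongr
                exact inv_le_one_of_one_le₀ h1
            _ = p := one_mul _
      _ = (p : ℝ) ^ p := by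
          rw [Finset.prod_pow_eq_pow_sum, Finset.sum_coe_sort K, hα.1]
  · rw [hK.lagrange_eq_zero hp hzK]; simp

end IsSimplex

theorem card_nodes_le (p : ℕ) (C : Finset (E d)) : (nodes p C).card ≤ (p + 1) ^ C.card := by
  classical
  unfold nodes
  refine Finset.card_image_le.trans ?_
  calc (C.piAntidiag p).card ≤ (Fintype.piFinset fun _ : C => Finset.range (p + 1)).card := by
        refine Finset.card_le_card_of_injOn (fun α z => α z) ?_ ?_
        · intro α hα
          have hα := Finset.mem_piAntidiag.1 hα
          refine Finset.mem_coe.2 (Fintype.mem_piFinset.2 fun z => Finset.mem_range.2 ?_)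
          have := Finset.single_le_sum (f := α) (fun _ _ => Nat.zero_le _) z.2
          exact Nat.lt_succ_of_le (this.trans_eq hα.1)
        · intro α hα β hβ h
          have hα := Finset.mem_piAntidiag.1 hα
          have hβ := Finset.mem_piAntidiag.1 hβ
          ext z
          by_cases hz : z ∈ C
          · exact congrFun h ⟨z, hz⟩
          · have h1 : β z = 0 := by by_contra h'; exact hz (hβ.2 z h')
            have h2 : α z = 0 := by by_contra h'; exact hz (hα.2 z h')
            rw [h1, h2]
    _ = _ := by simp

theorem IsSimplex.abs_ev_le_of_nodes {K : Finset (E d)} (hK : IsSimplex K) {p : ℕ} (hp : 1 ≤ p)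
    {q : Poly d} (hq : q.totalDegree ≤ p) {B : ℝ} (hB : ∀ z ∈ nodes p K, |ev q z| ≤ B)
    {x : E d} (hx : x ∈ hull K) : |ev q x| ≤ (p + 1) ^ (d + 1) * (p : ℝ) ^ p * B := by
  have hB0 : 0 ≤ B := by
    obtain ⟨z, hz⟩ := hK.nonempty
    have : z ∈ nodes p K := by
      classical
      refine mem_nodes.2 ⟨fun y => if y = z then p else 0, ⟨by simp [hz], fun y hy => ?_⟩, ?_⟩
      · by_cases h : y = z
        · rwa [h]
        · simp [h] at hy
      · have : (p : ℝ) ≠ 0 := by positivity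
        simp [node, ite_div, ite_smul, hz, this]
    exact (abs_nonneg _).trans (hB z this)
  rw [hK.ev_eq_sum_face hp (Finset.Subset.refl K) hq hx]
  refine (Finset.abs_sum_le_sum_abs _ _).trans ?_
  calc _ ≤ ∑ z ∈ nodes p K, B * (p : ℝ) ^ p := Finset.sum_le_sum fun z hz => by
        rw [abs_mul]
        exact mul_le_mul (hB z hz) (hK.abs_lagrange_le hp z hx) (abs_nonneg _) hB0
    _ = (nodes p K).card * (B * (p : ℝ) ^ p) := by rw [Finset.sum_const, nsmul_eq_mul]
    _ ≤ (p + 1) ^ (d + 1) * (B * (p : ℝ) ^ p) := by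
        gcongr
        have := card_nodes_le p K
        rw [hK.card] at this
        exact_mod_cast this
    _ = _ := by ring

end FEM

/-! ### Derivatives of polynomials and norm equivalences on the reference simplex. -/

namespace FEM

variable {d n : ℕ}

/-! ### Derivatives of polynomials -/

theorem hasFDerivAt_eval (P : MvPolynomial (Fin n) ℝ) (y : Fin n → ℝ) :
    HasFDerivAt (fun y => MvPolynomial.eval y P)
      (∑ i, MvPolynomial.eval y (MvPolynomial.pderiv i P) •
        (ContinuousLinearMap.proj i : (Fin n → ℝ) →L[ℝ] ℝ)) y := by
  classical
  induction P using MvPolynomial.induction_on with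
  | C a => simpa using hasFDerivAt_const a y
  | add P Q hP hQ =>
    have := hP.add hQ
    simp only [map_add, add_smul, Finset.sum_add_distrib]
    exact this
  | mul_X P j hP =>
    have hX : HasFDerivAt (fun y : Fin n → ℝ => y j)
      (ContinuousLinearMap.proj j : (Fin n → ℝ) →L[ℝ] ℝ) y :=
      (ContinuousLinearMap.proj j : (Fin n → ℝ) →L[ℝ] ℝ).hasFDerivAt
    have := hP.mul hX
    simp only [map_mul, MvPolynomial.eval_X]
    convert! this using 1
    ext v
    have h1 : ∀ i, MvPolynomial.eval y (MvPolynomial.pderiv i (P * MvPolynomial.X j)) =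
        MvPolynomial.eval y P * (if j = i then 1 else 0) +
          y j * MvPolynomial.eval y (MvPolynomial.pderiv i P) := fun i => by
      by_cases h : j = i <;> simp [Derivation.leibniz, h]
    simp only [h1]
    simp [add_mul, Finset.sum_add_distrib, Finset.mul_sum, mul_assoc]

theorem totalDegree_pderiv_le (i : Fin n) (P : MvPolynomial (Fin n) ℝ) :
    (MvPolynomial.pderiv i P).totalDegree ≤ P.totalDegree - 1 := by
  conv_lhs => rw [P.as_sum, map_sum]
  refine MvPolynomial.totalDegree_finsetSum_le fun s hs => ?_
  rw [MvPolynomial.pderiv_monomial]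
  by_cases h : s i = 0
  · simp [h]
  refine (MvPolynomial.totalDegree_monomial_le _ _).trans ?_
  have h1 : (s.sum fun _ => id) ≤ P.totalDegree := MvPolynomial.le_totalDegree hs
  have h2 : s = (s - Finsupp.single i 1) + Finsupp.single i 1 :=
    (Finsupp.sub_add_single_one_cancel h).symm
  have h3 : (s.sum fun _ => id) = ((s - Finsupp.single i 1).sum fun _ => id) + 1 := by
    conv_lhs => rw [h2]
    rw [Finsupp.sum_add_index' (fun _ => rfl) (fun _ _ _ => rfl)]
    simp
  omega

theorem eq_C_of_pderiv_eq_zero {P : MvPolynomial (Fin n) ℝ}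
    (h : ∀ i, MvPolynomial.pderiv i P = 0) : P = MvPolynomial.C (MvPolynomial.eval 0 P) := by
  refine MvPolynomial.funext fun y => ?_
  rw [MvPolynomial.eval_C]
  refine is_const_of_fderiv_eq_zero (𝕜 := ℝ) (f := fun y => MvPolynomial.eval y P)
    (fun y => (hasFDerivAt_eval P y).differentiableAt) (fun y => ?_) y 0
  rw [(hasFDerivAt_eval P y).fderiv]
  simp [h]

/-- The gradient of a polynomial. -/
def gradPoly (q : Poly d) (x : E d) : E d := WithLp.toLp 2 fun i => ev (MvPolynomial.pderiv i q) x

theorem continuous_gradPoly (q : Poly d) : Continuous (gradPoly q) := by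
  unfold gradPoly
  refine (PiLp.continuous_toLp 2 _).comp (continuous_pi fun i => continuous_ev _)

theorem hasFDerivAt_ev (q : Poly d) (x : E d) :
    HasFDerivAt (ev q) (innerSL ℝ (gradPoly q x)) x := by
  have h1 := hasFDerivAt_eval q (fun i => x i)
  have h2 : HasFDerivAt (fun x : E d => fun i => x i)
      (EuclideanSpace.equiv (Fin d) ℝ : E d →L[ℝ] (Fin d → ℝ)) x :=
    (EuclideanSpace.equiv (Fin d) ℝ : E d →L[ℝ] (Fin d → ℝ)).hasFDerivAt
  have h3 := h1.comp x h2
  refine h3.congr_fderiv ?_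
  ext v
  simp [gradPoly, ev, PiLp.inner_apply, mul_comm]

theorem fderiv_ev (q : Poly d) (x v : E d) :
    fderiv ℝ (ev q) x v = ∑ i, ev (MvPolynomial.pderiv i q) x * v i := by
  rw [(hasFDerivAt_ev q x).fderiv]
  simp [gradPoly, PiLp.inner_apply, mul_comm]

theorem contDiff_ev (q : Poly d) : ContDiff ℝ ∞ (ev q) := by
  unfold ev
  have h : ContDiff ℝ ∞ (fun x : E d => (fun i => x i : Fin d → ℝ)) := by fun_prop
  induction q using MvPolynomial.induction_on with
  | C a => simpa using contDiff_const
  | add P Q hP hQ => simpa using hP.add hQ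
  | mul_X P j hP =>
    simp only [map_mul, MvPolynomial.eval_X]
    exact hP.mul (by fun_prop)

/-! ### The reference simplex -/

/-- The reference simplex. -/
def refSimplex (n : ℕ) : Set (Fin n → ℝ) := {y | (∀ i, 0 ≤ y i) ∧ ∑ i, y i ≤ 1}

/-- The interior of the reference simplex. -/
def refInterior (n : ℕ) : Set (Fin n → ℝ) := {y | (∀ i, 0 < y i) ∧ ∑ i, y i < 1}

theorem isClosed_refSimplex : IsClosed (refSimplex n) := by
  unfold refSimplex
  simp only [Set.ofPred_and, Set.ofPred_forall]
  exact (isClosed_iInter fun i => isClosed_le continuous_const (continuous_apply i)).inter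
    (isClosed_le (by fun_prop) continuous_const)

theorem isOpen_refInterior : IsOpen (refInterior n) := by
  unfold refInterior
  simp only [Set.ofPred_and, Set.ofPred_forall]
  exact (isOpen_iInter_of_finite fun i => isOpen_lt continuous_const (continuous_apply i)).inter
    (isOpen_lt (by fun_prop) continuous_const)

theorem le_one_of_mem_refSimplex {y : Fin n → ℝ} (hy : y ∈ refSimplex n) (i : Fin n) : y i ≤ 1 :=
  (Finset.single_le_sum (f := y) (fun j _ => hy.1 j) (Finset.mem_univ i)).trans hy.2

theorem isCompact_refSimplex : IsCompact (refSimplex n) := by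
  refine (isCompact_univ_pi fun _ : Fin n => isCompact_Icc (a := (0 : ℝ)) (b := 1)).of_isClosed_subset
    isClosed_refSimplex fun y hy i _ => ⟨hy.1 i, le_one_of_mem_refSimplex hy i⟩

theorem refInterior_subset : refInterior n ⊆ refSimplex n :=
  fun _ hy => ⟨fun i => (hy.1 i).le, hy.2.le⟩

theorem exists_mem_refInterior : (fun _ => ((n : ℝ) + 1)⁻¹) ∈ refInterior n := by
  refine ⟨fun i => by positivity, ?_⟩
  simp only [Finset.sum_const, Finset.card_univ, Fintype.card_fin, nsmul_eq_mul]
  rw [← div_eq_mul_inv, div_lt_one (by positivity)]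
  linarith

theorem refSimplex_subset_closure : refSimplex n ⊆ closure (refInterior n) := by
  intro y hy
  let c : Fin n → ℝ := fun _ => ((n : ℝ) + 1)⁻¹
  have hc : c ∈ refInterior n := exists_mem_refInterior
  have hlim : Filter.Tendsto (fun t : ℝ => (1 - t) • y + t • c) (𝓝[>] 0) (𝓝 y) := by
    have : Filter.Tendsto (fun t : ℝ => (1 - t) • y + t • c) (𝓝 0) (𝓝 ((1 - (0:ℝ)) • y + (0:ℝ) • c)) :=
      Continuous.tendsto (by fun_prop) 0
    simp only [sub_zero, one_smul, zero_smul, add_zero] at this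
    exact this.mono_left nhdsWithin_le_nhds
  refine mem_closure_of_tendsto hlim ?_
  filter_upwards [Ioo_mem_nhdsGT (show (0:ℝ) < 1 by norm_num)] with t ht
  refine ⟨fun i => ?_, ?_⟩
  · have := mul_pos ht.1 (hc.1 i)
    have := mul_nonneg (sub_nonneg.2 ht.2.le) (hy.1 i)
    simp only [Pi.add_apply, Pi.smul_apply, smul_eq_mul]; linarith
  · simp only [Pi.add_apply, Pi.smul_apply, smul_eq_mul, Finset.sum_add_distrib, ← Finset.mul_sum]
    have := mul_lt_mul_of_pos_left hc.2 ht.1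
    have := mul_le_mul_of_nonneg_left hy.2 (sub_nonneg.2 ht.2.le)
    linarith

theorem integrableOn_refSimplex {f : (Fin n → ℝ) → ℝ} (hf : Continuous f) :
    IntegrableOn f (refSimplex n) := hf.continuousOn.integrableOn_compact isCompact_refSimplex

theorem eq_zero_of_integral_refSimplex {f : (Fin n → ℝ) → ℝ} (hf : Continuous f)
    (h0 : ∀ y ∈ refSimplex n, 0 ≤ f y) (hint : ∫ y in refSimplex n, f y = 0) :
    ∀ y ∈ refSimplex n, f y = 0 := by
  have h1 : f =ᵐ[volume.restrict (refSimplex n)] 0 := by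
    rw [setIntegral_eq_zero_iff_of_nonneg_ae] at hint
    · exact hint
    · exact (ae_restrict_iff' isClosed_refSimplex.measurableSet).2 (.of_forall h0)
    · exact integrableOn_refSimplex hf
  have h2 : f =ᵐ[volume.restrict (refInterior n)] fun _ => 0 :=
    ae_restrict_of_ae_restrict_of_subset refInterior_subset h1
  have h3 := Measure.eqOn_open_of_ae_eq h2 isOpen_refInterior hf.continuousOn continuousOn_const
  intro y hy
  exact (isClosed_singleton.preimage hf).closure_subset_iff.2 h3 (refSimplex_subset_closure hy)

theorem poly_eq_zero_of_refInterior {P : MvPolynomial (Fin n) ℝ}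
    (h : ∀ y ∈ refInterior n, MvPolynomial.eval y P = 0) : P = 0 := by
  have hV : refInterior n ∈ 𝓝 (fun _ : Fin n => ((n : ℝ) + 1)⁻¹) :=
    isOpen_refInterior.mem_nhds exists_mem_refInterior
  rw [nhds_pi, Filter.mem_pi'] at hV
  obtain ⟨I, t, ht, hsub⟩ := hV
  refine MvPolynomial.funext_set t (fun i => infinite_of_mem_nhds _ (ht i)) fun y hy => ?_
  rw [map_zero]
  exact h y (hsub fun i _ => hy i (Set.mem_univ i))

/-! ### Norm equivalences on the reference simplex -/

/-- The form turns the finite-dimensional space into an inner product space, on which every linear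
map is continuous. All constants depending only on dimension and degree originate here. -/
theorem exists_bound_of_posDef {W A : Type*} [AddCommGroup W] [Module ℝ W] [FiniteDimensional ℝ W]
    [NormedAddCommGroup A] [NormedSpace ℝ A] (b : W →ₗ[ℝ] W →ₗ[ℝ] ℝ)
    (hsymm : ∀ v w, b v w = b w v) (hnn : ∀ w, 0 ≤ b w w) (hpos : ∀ w, b w w = 0 → w = 0)
    (f : W →ₗ[ℝ] A) : ∃ C : ℝ, 0 ≤ C ∧ ∀ w, ‖f w‖ ^ 2 ≤ C * b w w := by
  let core : InnerProductSpace.Core ℝ W :=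
    { inner := fun v w => b v w
      conj_inner_symm := fun v w => by simpa using hsymm w v
      re_inner_nonneg := fun w => by simpa using hnn w
      add_left := fun u v w => by simp
      smul_left := fun u v c => by simp
      definite := fun w hw => hpos w hw }
  let _ : NormedAddCommGroup W := core.toNormedAddCommGroup
  let _ : InnerProductSpace ℝ W := InnerProductSpace.ofCore core.toCore
  let F : W →L[ℝ] A := LinearMap.toContinuousLinearMap f
  refine ⟨‖F‖ ^ 2, by positivity, fun w => ?_⟩
  have h1 : ‖w‖ ^ 2 = b w w := (real_inner_self_eq_norm_sq w).symm
  have h2 : ‖f w‖ ≤ ‖F‖ * ‖w‖ := F.le_opNorm w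
  calc ‖f w‖ ^ 2 ≤ (‖F‖ * ‖w‖) ^ 2 := by gcongr
    _ = _ := by rw [mul_pow, h1]

theorem continuous_eval_poly (P : MvPolynomial (Fin n) ℝ) :
    Continuous fun y => MvPolynomial.eval y P := MvPolynomial.continuous_eval P

instance : CompactSpace (refSimplex n) := isCompact_iff_compactSpace.1 isCompact_refSimplex

/-- Restriction of polynomials to the reference simplex. -/
def restrictRef (n : ℕ) : MvPolynomial (Fin n) ℝ →ₗ[ℝ] C(refSimplex n, ℝ) where
  toFun P := ⟨fun y => MvPolynomial.eval y.1 P, (continuous_eval_poly P).comp continuous_subtype_val⟩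
  map_add' P Q := by ext; simp
  map_smul' c P := by ext; simp [MvPolynomial.smul_eval]

theorem abs_eval_le_restrictRef (P : MvPolynomial (Fin n) ℝ) {y : Fin n → ℝ}
    (hy : y ∈ refSimplex n) : |MvPolynomial.eval y P| ≤ ‖restrictRef n P‖ :=
  (restrictRef n P).norm_coe_le_norm ⟨y, hy⟩

/-- The weighted `L²` form on polynomials over the reference simplex. -/
def refForm (n : ℕ) (w : (Fin n → ℝ) → ℝ) (hw : Continuous w) :
    MvPolynomial (Fin n) ℝ →ₗ[ℝ] MvPolynomial (Fin n) ℝ →ₗ[ℝ] ℝ :=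
  LinearMap.mk₂ ℝ (fun P Q => ∫ y in refSimplex n, MvPolynomial.eval y P * MvPolynomial.eval y Q * w y)
    (fun P P' Q => by
      rw [← integral_add]
      · simp [add_mul]
      all_goals
        exact integrableOn_refSimplex
          (((continuous_eval_poly _).mul (continuous_eval_poly _)).mul hw))
    (fun c P Q => by
      rw [smul_eq_mul, ← integral_const_mul]
      simp [MvPolynomial.smul_eval, mul_assoc])
    (fun P Q Q' => by
      rw [← integral_add]
      · simp [add_mul, mul_add]
      all_goals
        exact integrableOn_refSimplex
          (((continuous_eval_poly _).mul (continuous_eval_poly _)).mul hw))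
    (fun c P Q => by
      rw [smul_eq_mul, ← integral_const_mul]
      congr 1; ext y
      simp only [MvPolynomial.smul_eval]; ring)

theorem refForm_apply (w : (Fin n → ℝ) → ℝ) (hw : Continuous w) (P Q : MvPolynomial (Fin n) ℝ) :
    refForm n w hw P Q =
      ∫ y in refSimplex n, MvPolynomial.eval y P * MvPolynomial.eval y Q * w y := rfl

theorem refForm_symm (w : (Fin n → ℝ) → ℝ) (hw : Continuous w) (P Q : MvPolynomial (Fin n) ℝ) :
    refForm n w hw P Q = refForm n w hw Q P := by
  simp only [refForm_apply, mul_comm (MvPolynomial.eval _ P)]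

theorem refForm_nonneg (w : (Fin n → ℝ) → ℝ) (hw : Continuous w)
    (hw0 : ∀ y ∈ refSimplex n, 0 ≤ w y) (P : MvPolynomial (Fin n) ℝ) : 0 ≤ refForm n w hw P P :=
  setIntegral_nonneg isClosed_refSimplex.measurableSet fun y hy =>
    mul_nonneg (mul_self_nonneg _) (hw0 y hy)

theorem eq_zero_of_refForm (w : (Fin n → ℝ) → ℝ) (hw : Continuous w)
    (hw0 : ∀ y ∈ refSimplex n, 0 ≤ w y) (hw1 : ∀ y ∈ refInterior n, 0 < w y)
    {P : MvPolynomial (Fin n) ℝ} (h : refForm n w hw P P = 0) : P = 0 := by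
  refine poly_eq_zero_of_refInterior fun y hy => ?_
  have := eq_zero_of_integral_refSimplex
    (((continuous_eval_poly P).mul (continuous_eval_poly P)).mul hw)
    (fun y hy => mul_nonneg (mul_self_nonneg _) (hw0 y hy)) h y (refInterior_subset hy)
  simpa [(hw1 y hy).ne'] using this

/-- A weighted `L²` norm controls the values of a polynomial (composed with a linear map). -/
theorem exists_bound_refForm (p : ℕ) (w : (Fin n → ℝ) → ℝ) (hw : Continuous w)
    (hw0 : ∀ y ∈ refSimplex n, 0 ≤ w y) (hw1 : ∀ y ∈ refInterior n, 0 < w y)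
    (f : MvPolynomial (Fin n) ℝ →ₗ[ℝ] MvPolynomial (Fin n) ℝ) :
    ∃ C : ℝ, 0 ≤ C ∧ ∀ P : MvPolynomial (Fin n) ℝ, P.totalDegree ≤ p → ∀ y ∈ refSimplex n,
      (MvPolynomial.eval y (f P)) ^ 2 ≤
        C * ∫ y in refSimplex n, MvPolynomial.eval y P * MvPolynomial.eval y P * w y := by
  let W := MvPolynomial.restrictTotalDegree (Fin n) ℝ p
  obtain ⟨C, hC, h⟩ := exists_bound_of_posDef
    ((refForm n w hw).domRestrict₁₂ W W) (fun _ _ => refForm_symm w hw _ _)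
    (fun _ => refForm_nonneg w hw hw0 _)
    (fun P hP => Subtype.ext (eq_zero_of_refForm w hw hw0 hw1 hP))
    ((restrictRef n ∘ₗ f).domRestrict W)
  refine ⟨C, hC, fun P hP y hy => ?_⟩
  have h1 := h ⟨P, (MvPolynomial.mem_restrictTotalDegree _ _ _).2 hP⟩
  refine le_trans ?_ h1
  rw [← sq_abs]
  have := abs_eval_le_restrictRef (f P) hy
  gcongr
  exact this

/-- The oscillation of a polynomial is controlled by the `L²` norm of its gradient. -/
theorem exists_bound_osc (n p : ℕ) :
    ∃ C : ℝ, 0 ≤ C ∧ ∀ P : MvPolynomial (Fin n) ℝ, P.totalDegree ≤ p →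
      ∀ y ∈ refSimplex n, ∀ y' ∈ refSimplex n,
      (MvPolynomial.eval y P - MvPolynomial.eval y' P) ^ 2 ≤
        C * ∑ i, ∫ y in refSimplex n, (MvPolynomial.eval y (MvPolynomial.pderiv i P)) ^ 2 := by
  let ev0 : MvPolynomial (Fin n) ℝ →ₗ[ℝ] ℝ :=
    { toFun := fun P => MvPolynomial.eval 0 P
      map_add' := fun _ _ => by simp
      map_smul' := fun _ _ => by simp }
  -- Prescribing the value zero at the origin removes the constants, on which the gradient form
  -- degenerates.
  let W : Submodule ℝ (MvPolynomial (Fin n) ℝ) :=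
    MvPolynomial.restrictTotalDegree (Fin n) ℝ p ⊓ LinearMap.ker ev0
  have : FiniteDimensional ℝ W := Submodule.finiteDimensional_of_le inf_le_left
  have c1 : Continuous fun _ : Fin n → ℝ => (1 : ℝ) := continuous_const
  let D (i : Fin n) : MvPolynomial (Fin n) ℝ →ₗ[ℝ] MvPolynomial (Fin n) ℝ :=
    (MvPolynomial.pderiv i).toLinearMap
  let b : MvPolynomial (Fin n) ℝ →ₗ[ℝ] MvPolynomial (Fin n) ℝ →ₗ[ℝ] ℝ :=
    ∑ i, (refForm n _ c1).compl₁₂ (D i) (D i)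
  have hb : ∀ P Q, b P Q = ∑ i, refForm n _ c1 (MvPolynomial.pderiv i P) (MvPolynomial.pderiv i Q) :=
    fun P Q => by simp [b, D, LinearMap.sum_apply]
  have hnn : ∀ P, 0 ≤ refForm n _ c1 P P := refForm_nonneg _ c1 fun _ _ => zero_le_one
  obtain ⟨C, hC, h⟩ := exists_bound_of_posDef (b.domRestrict₁₂ W W)
    (fun P Q => by simp only [LinearMap.domRestrict₁₂_apply, hb, refForm_symm _ c1])
    (fun P => by
      simp only [LinearMap.domRestrict₁₂_apply, hb]
      exact Finset.sum_nonneg fun i _ => hnn _)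
    (fun P hP => by
      simp only [LinearMap.domRestrict₁₂_apply, hb] at hP
      rw [Finset.sum_eq_zero_iff_of_nonneg fun i _ => hnn _] at hP
      have := eq_C_of_pderiv_eq_zero (P := P.1) fun i =>
        eq_zero_of_refForm _ c1 (fun _ _ => zero_le_one) (fun _ _ => zero_lt_one)
          (hP i (Finset.mem_univ i))
      have h0 : MvPolynomial.eval 0 P.1 = 0 := P.2.2
      rw [h0, map_zero] at this
      exact Subtype.ext this)
    ((restrictRef n).domRestrict W)
  -- The `4` is the square of the `2` from bounding a difference of two values by twice the maximum
  -- norm.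
  refine ⟨4 * C, by positivity, fun P hP y hy y' hy' => ?_⟩
  let P0 := P - MvPolynomial.C (MvPolynomial.eval 0 P)
  have hP0 : P0 ∈ W := by
    refine ⟨(MvPolynomial.mem_restrictTotalDegree _ _ _).2
      ((MvPolynomial.totalDegree_sub _ _).trans (max_le hP (by simp))), ?_⟩
    simp [P0, ev0]
  have hd : ∀ i, MvPolynomial.pderiv i P0 = MvPolynomial.pderiv i P := fun i => by
    simp [P0]
  have h1 : ‖restrictRef n P0‖ ^ 2 ≤ C * b P0 P0 := h ⟨P0, hP0⟩
  have hbP : b P0 P0 =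
      ∑ i, ∫ y in refSimplex n, (MvPolynomial.eval y (MvPolynomial.pderiv i P)) ^ 2 := by
    rw [hb]
    simp only [hd, refForm_apply, mul_one, pow_two]
  rw [hbP] at h1
  have e1 := abs_eval_le_restrictRef P0 hy
  have e2 := abs_eval_le_restrictRef P0 hy'
  have e3 : MvPolynomial.eval y P - MvPolynomial.eval y' P =
    MvPolynomial.eval y P0 - MvPolynomial.eval y' P0 := by simp [P0]
  have e4 : |MvPolynomial.eval y P - MvPolynomial.eval y' P| ≤ 2 * ‖restrictRef n P0‖ := by
    rw [e3]
    exact (abs_sub _ _).trans (by linarith)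
  rw [← sq_abs]
  calc _ ≤ (2 * ‖restrictRef n P0‖) ^ 2 := by gcongr
    _ = 4 * ‖restrictRef n P0‖ ^ 2 := by ring
    _ ≤ _ := by rw [mul_assoc]; gcongr

end FEM

/-! ### Parametrization of simplices and faces, and the divergence theorem. -/

namespace FEM

variable {d n : ℕ}

/-! ### Parametrization of simplices -/

/-- The affine map from the reference simplex onto the simplex with vertices `z`. -/
def par (z : Fin (n + 1) → E d) (y : Fin n → ℝ) : E d := z 0 + ∑ i, y i • (z i.succ - z 0)

theorem continuous_par (z : Fin (n + 1) → E d) : Continuous (par z) := by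
  unfold par; fun_prop

theorem par_eq_sum (z : Fin (n + 1) → E d) (y : Fin n → ℝ) :
    par z y = ∑ i, (Fin.cons (1 - ∑ j, y j) y : Fin (n + 1) → ℝ) i • z i := by
  rw [Fin.sum_univ_succ, par]
  simp only [Fin.cons_zero, Fin.cons_succ, smul_sub, Finset.sum_sub_distrib, ← Finset.sum_smul]
  module

theorem par_mem {z : Fin (n + 1) → E d} {y : Fin n → ℝ} (hy : y ∈ refSimplex n) :
    par z y ∈ convexHull ℝ (Set.range z) := by
  rw [par_eq_sum]
  refine (convex_convexHull ℝ _).sum_mem (fun i _ => ?_) ?_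
    fun i _ => subset_convexHull ℝ _ (Set.mem_range_self i)
  · refine Fin.cases ?_ (fun j => ?_) i
    · simpa using hy.2
    · simpa using hy.1 j
  · rw [Fin.sum_univ_succ]; simp

theorem image_par (z : Fin (n + 1) → E d) :
    par z '' refSimplex n = convexHull ℝ (Set.range z) := by
  refine Set.Subset.antisymm ?_ ?_
  · rintro _ ⟨y, hy, rfl⟩; exact par_mem hy
  · intro x hx
    rw [convexHull_range_eq_exists_affineCombination] at hx
    obtain ⟨s, w, hw0, hw1, rfl⟩ := hx
    classical
    let v : Fin (n + 1) → ℝ := fun i => if i ∈ s then w i else 0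
    have hv0 : ∀ i, 0 ≤ v i := fun i => by
      by_cases h : i ∈ s <;> simp [v, h, hw0]
    have hv1 : ∑ i, v i = 1 := by simp [v, hw1]
    have hv2 : v 0 + ∑ i : Fin n, v i.succ = 1 := by rw [← Fin.sum_univ_succ, hv1]
    refine ⟨fun i => v i.succ, ⟨fun i => hv0 _, by linarith [hv0 0]⟩, ?_⟩
    rw [par_eq_sum, Finset.affineCombination_eq_linear_combination _ _ _ hw1]
    have : (Fin.cons (1 - ∑ j : Fin n, v j.succ) fun i => v i.succ : Fin (n + 1) → ℝ) = v := by
      ext i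
      refine Fin.cases ?_ (fun j => ?_) i
      · simp only [Fin.cons_zero]; linarith
      · simp
    rw [this]
    simp [v, ite_smul]

/-- The linear part of the parametrization. -/
def parLin (z : Fin (n + 1) → E d) : EuclideanSpace ℝ (Fin n) →ₗ[ℝ] E d where
  toFun y := ∑ i, y i • (z i.succ - z 0)
  map_add' x y := by simp [add_smul, Finset.sum_add_distrib]
  map_smul' c y := by simp [Finset.smul_sum, mul_smul]

theorem parLin_injective {z : Fin (n + 1) → E d} (hz : AffineIndependent ℝ z) :
    Function.Injective (parLin z) := by
  rw [← LinearMap.ker_eq_bot, LinearMap.ker_eq_bot']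
  intro y hy
  have h1 := (affineIndependent_iff_linearIndependent_vsub ℝ z 0).1 hz
  have h2 : LinearIndependent ℝ fun i : Fin n => z i.succ - z 0 := by
    have := h1.comp (fun i : Fin n => (⟨i.succ, Fin.succ_ne_zero i⟩ : {x : Fin (n + 1) // x ≠ 0}))
      (fun i j h => by simpa using h)
    exact this
  ext i
  exact Fintype.linearIndependent_iff.1 h2 (fun i => y i) hy i

theorem par_eq (z : Fin (n + 1) → E d) (y : Fin n → ℝ) :
    par z y = z 0 + parLin z (WithLp.toLp 2 y) := rfl

theorem measurableEmbedding_par {z : Fin (n + 1) → E d} (hz : AffineIndependent ℝ z) :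
    MeasurableEmbedding (par z) := by
  refine (continuous_par z).measurableEmbedding fun y y' h => ?_
  rw [par_eq, par_eq, add_right_inj] at h
  exact WithLp.toLp_injective 2 (parLin_injective hz h)

/-- The scaling factor is `normDet` of the linear part, positive by injectivity. Since `n ≤ d` is
arbitrary, elements and faces are covered at once. -/
theorem map_par {z : Fin (n + 1) → E d} (hz : AffineIndependent ℝ z) :
    ∃ c : ℝ, 0 < c ∧ (μHE[n] : Measure (E d)).restrict (Set.range (par z)) =
      ENNReal.ofReal c • (volume : Measure (Fin n → ℝ)).map (par z) := by
  have hpos : 0 < (parLin z).normDet :=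
    lt_of_le_of_ne (parLin z).normDet_nonneg (Ne.symm
      (((parLin z).normDet_ne_zero_tfae.out 1 0).1 (LinearMap.ker_eq_bot.2 (parLin_injective hz))))
  refine ⟨_, hpos, ?_⟩
  have hemb := measurableEmbedding_par hz
  ext s hs
  rw [Measure.restrict_apply hs, Measure.smul_apply, hemb.map_apply, smul_eq_mul,
    ← Set.image_preimage_eq_inter_range]
  have h1 : par z '' (par z ⁻¹' s) = (fun x => z 0 + x) '' (parLin z ''
      (WithLp.toLp 2 '' (par z ⁻¹' s))) := by
    rw [Set.image_image, Set.image_image]; rfl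
  have h2 : Isometry (fun x : E d => z 0 + x) := isometry_add_left (z 0)
  rw [h1, h2.euclideanHausdorffMeasure_image]
  have h3 := (parLin z).euclideanHausdorffMeasure_image_eq_normDet_mul_volume
    (WithLp.toLp 2 '' (par z ⁻¹' s))
  rw [finrank_euclideanSpace_fin] at h3
  rw [h3]
  congr 1
  have h4 := (PiLp.volume_preserving_toLp (Fin n)).measure_preimage_emb
    (MeasurableEquiv.toLp 2 (Fin n → ℝ)).measurableEmbedding (WithLp.toLp 2 '' (par z ⁻¹' s))
  rw [← h4, Set.preimage_image_eq _ (WithLp.toLp_injective 2)]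

/-- Integration over a simplex is integration over the reference simplex, up to a factor. -/
theorem integral_simplex {z : Fin (n + 1) → E d} (hz : AffineIndependent ℝ z) :
    ∃ c : ℝ, 0 < c ∧ ∀ f : E d → ℝ,
      ∫ x in convexHull ℝ (Set.range z), f x ∂(μHE[n] : Measure (E d)) =
        c * ∫ y in refSimplex n, f (par z y) := by
  obtain ⟨c, hc, h⟩ := map_par hz
  have hemb := measurableEmbedding_par hz
  refine ⟨c, hc, fun f => ?_⟩
  have h1 : (μHE[n] : Measure (E d)).restrict (convexHull ℝ (Set.range z)) =
      ENNReal.ofReal c • ((volume : Measure (Fin n → ℝ)).restrict (refSimplex n)).map (par z) := by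
    have hsub : convexHull ℝ (Set.range z) ⊆ Set.range (par z) := by
      rw [← image_par]; exact Set.image_subset_range _ _
    have hm : MeasurableSet (convexHull ℝ (Set.range z)) :=
      ((Set.finite_range z).isCompact_convexHull (𝕜 := ℝ)).measurableSet
    rw [← Set.inter_eq_left.2 hsub, ← Measure.restrict_restrict hm, h, Measure.restrict_smul,
      hemb.restrict_map, ← image_par, Set.preimage_image_eq _ hemb.injective]
  rw [h1, integral_smul_measure, hemb.integral_map, ENNReal.toReal_ofReal hc.le, smul_eq_mul]

/-! ### Enumerations of vertices -/

theorem exists_enum {C : Finset (E d)} (hC : AffineIndependent ℝ (fun z : C => (z : E d)))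
    (hcard : C.card = n + 1) : ∃ z : Fin (n + 1) → E d, AffineIndependent ℝ z ∧
      Set.range z = (C : Set (E d)) := by
  let e := (C.equivFinOfCardEq hcard).symm
  refine ⟨fun i => (e i : E d), hC.comp_embedding e.toEmbedding, ?_⟩
  ext x
  constructor
  · rintro ⟨i, rfl⟩; exact (e i).2
  · intro hx
    exact ⟨e.symm ⟨x, hx⟩, by simp⟩

/-- In such an enumeration the first coordinate direction of the reference simplex is mapped to the
edge `b - a`, which reduces `stokes` to `stokes_ref`. -/
theorem exists_enum_two {C : Finset (E d)} (hC : AffineIndependent ℝ (fun z : C => (z : E d)))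
    (hcard : C.card = n + 2) {a b : E d} (ha : a ∈ C) (hb : b ∈ C) (hab : a ≠ b) :
    ∃ z : Fin (n + 2) → E d, AffineIndependent ℝ z ∧ Set.range z = (C : Set (E d)) ∧
      z 0 = a ∧ z 1 = b := by
  let e0 := (C.equivFinOfCardEq hcard).symm
  obtain ⟨σ, h0, h1⟩ : ∃ σ : Equiv.Perm C, σ (e0 0) = ⟨a, ha⟩ ∧ σ (e0 1) = ⟨b, hb⟩ := by
    classical
    let σ1 := Equiv.swap (e0 0) ⟨a, ha⟩
    have hne : σ1 (e0 1) ≠ ⟨a, ha⟩ := by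
      intro h
      have : σ1 (e0 0) = σ1 (e0 1) := by rw [h]; simp [σ1]
      have := e0.injective (σ1.injective this)
      simp at this
    refine ⟨σ1.trans (Equiv.swap (σ1 (e0 1)) ⟨b, hb⟩), ?_, ?_⟩
    · have h1 : σ1 (e0 0) = ⟨a, ha⟩ := by simp [σ1]
      rw [Equiv.trans_apply, h1, Equiv.swap_apply_of_ne_of_ne hne.symm]
      exact fun h => hab (congrArg Subtype.val h)
    · simp
  let e := e0.trans σ
  refine ⟨fun i => (e i : E d), hC.comp_embedding e.toEmbedding, ?_, by simp [e, h0], by simp [e, h1]⟩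
  ext x
  constructor
  · rintro ⟨i, rfl⟩; exact (e i).2
  · intro hx
    exact ⟨e.symm ⟨x, hx⟩, by simp⟩

theorem affineIndependent_subset {C K : Finset (E d)} (h : C ⊆ K)
    (hK : AffineIndependent ℝ (fun z : K => (z : E d))) :
    AffineIndependent ℝ (fun z : C => (z : E d)) :=
  hK.comp_embedding ⟨fun z : C => (⟨z, h z.2⟩ : K), fun x y hxy => by
    exact Subtype.ext (congrArg (fun w : K => (w : E d)) hxy)⟩

/-- Integration over an element in terms of the reference simplex. -/
theorem integral_hull_eq {K : Finset (E d)} {z : Fin (d + 1) → E d} (hz : AffineIndependent ℝ z)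
    (hr : Set.range z = (K : Set (E d))) : ∃ c : ℝ, 0 < c ∧ ∀ f : E d → ℝ,
      ∫ x in hull K, f x = c * ∫ y in refSimplex d, f (par z y) := by
  obtain ⟨c, hc, h⟩ := integral_simplex hz
  refine ⟨c, hc, fun f => ?_⟩
  have := h f
  rw [EuclideanSpace.euclideanHausdorffMeasure_eq_volume, hr] at this
  exact this

theorem faceIntegral_eq {F : Finset (E (n + 1))} {z : Fin (n + 1) → E (n + 1)}
    (hz : AffineIndependent ℝ z)
    (hr : Set.range z = (F : Set (E (n + 1)))) : ∃ c : ℝ, 0 < c ∧ ∀ f : E (n + 1) → ℝ,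
      faceIntegral F f = c * ∫ y in refSimplex n, f (par z y) := by
  obtain ⟨c, hc, h⟩ := integral_simplex hz
  refine ⟨c, hc, fun f => ?_⟩
  have := h f
  rw [hr] at this
  exact this

/-! ### The divergence theorem on a simplex -/

/-- Fubini in the first coordinate and the fundamental theorem of calculus: each line in that
direction enters through the face where this coordinate is zero and leaves through the slanted face.
-/
theorem stokes_ref {f : (Fin (n + 1) → ℝ) → ℝ} (hf : ContDiff ℝ 1 f) :
    ∫ y in refSimplex (n + 1), fderiv ℝ f y (Pi.single 0 1) =
      ∫ y in refSimplex n, (f (Fin.cons (1 - ∑ i, y i) y) - f (Fin.cons 0 y)) := by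
  let g : (Fin (n + 1) → ℝ) → ℝ := fun y => fderiv ℝ f y (Pi.single 0 1)
  have hg : Continuous g := (hf.continuous_fderiv one_ne_zero).clm_apply continuous_const
  let φ := MeasurableEquiv.piFinSuccAbove (fun _ : Fin (n + 1) => ℝ) 0
  have hφ := (volume_preserving_piFinSuccAbove (fun _ : Fin (n + 1) => ℝ) 0).symm
  have hcons : ∀ q : ℝ × (Fin n → ℝ), φ.symm q = Fin.cons q.1 q.2 := fun q => by
    simp [φ, MeasurableEquiv.piFinSuccAbove]
    rfl
  have hmem : ∀ (t : ℝ) (y : Fin n → ℝ), (Fin.cons t y : Fin (n + 1) → ℝ) ∈ refSimplex (n + 1) ↔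
      y ∈ refSimplex n ∧ t ∈ Set.Icc 0 (1 - ∑ i, y i) := by
    intro t y
    simp only [refSimplex, Set.mem_ofPred_eq, Fin.forall_fin_succ, Fin.cons_zero, Fin.cons_succ,
      Fin.sum_univ_succ, Set.mem_Icc]
    constructor
    · rintro ⟨⟨h1, h2⟩, h3⟩; exact ⟨⟨h2, by linarith⟩, h1, by linarith⟩
    · rintro ⟨⟨h1, h2⟩, h3, h4⟩; exact ⟨⟨h3, h1⟩, by linarith⟩
  have hint : Integrable ((refSimplex (n + 1)).indicator g) := by
    rw [integrable_indicator_iff isClosed_refSimplex.measurableSet]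
    exact integrableOn_refSimplex hg
  have hint2 : Integrable (fun q : ℝ × (Fin n → ℝ) =>
      (refSimplex (n + 1)).indicator g (Fin.cons q.1 q.2)) (volume.prod volume) := by
    have := (hφ.integrable_comp_emb φ.symm.measurableEmbedding
      (g := (refSimplex (n + 1)).indicator g)).2 hint
    refine this.congr (.of_forall fun q => ?_)
    simp only [Function.comp, φ] at hcons ⊢
    rw [hcons]
  calc ∫ y in refSimplex (n + 1), g y = ∫ y, (refSimplex (n + 1)).indicator g y :=
        (integral_indicator isClosed_refSimplex.measurableSet).symm
    _ = ∫ q : ℝ × (Fin n → ℝ), (refSimplex (n + 1)).indicator g (Fin.cons q.1 q.2)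
          ∂(volume.prod volume) := by
        rw [← hφ.integral_comp φ.symm.measurableEmbedding]
        refine integral_congr_ae (.of_forall fun q => ?_)
        simp only [φ] at hcons ⊢
        rw [hcons]
    _ = ∫ y : Fin n → ℝ, ∫ t : ℝ, (refSimplex (n + 1)).indicator g (Fin.cons t y) :=
        integral_prod_symm _ hint2
    _ = ∫ y : Fin n → ℝ, (refSimplex n).indicator
          (fun y => f (Fin.cons (1 - ∑ i, y i) y) - f (Fin.cons 0 y)) y := by
        refine integral_congr_ae (.of_forall fun y => ?_)
        simp only
        by_cases hy : y ∈ refSimplex n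
        · rw [Set.indicator_of_mem hy]
          have h1 : (fun t : ℝ => (refSimplex (n + 1)).indicator g (Fin.cons t y)) =
              (Set.Icc 0 (1 - ∑ i, y i)).indicator fun t => g (Fin.cons t y) := by
            ext t
            simp only [Set.indicator, hmem, hy, true_and]
          have h0 : (0 : ℝ) ≤ 1 - ∑ i, y i := by linarith [hy.2]
          rw [h1, integral_indicator measurableSet_Icc, integral_Icc_eq_integral_Ioc,
            ← intervalIntegral.integral_of_le h0]
          have hlin : ∀ t : ℝ, HasDerivAt (fun t : ℝ => (Fin.cons t y : Fin (n + 1) → ℝ))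
              (Pi.single 0 1) t := by
            intro t
            rw [hasDerivAt_pi]
            refine Fin.cases ?_ fun j => ?_
            · simpa using hasDerivAt_id' t
            · simpa using hasDerivAt_const t (y j)
          have hcc : Continuous fun t : ℝ => (Fin.cons t y : Fin (n + 1) → ℝ) :=
            continuous_iff_continuousAt.2 fun t => (hlin t).continuousAt
          refine intervalIntegral.integral_eq_sub_of_hasDerivAt
            (f := fun t => f (Fin.cons t y)) (fun t _ => ?_)
            ((hg.comp hcc).intervalIntegrable _ _)
          exact (((hf.differentiable one_ne_zero) _).hasFDerivAt).comp_hasDerivAt t (hlin t)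
        · rw [Set.indicator_of_notMem hy]
          have h1 : ∀ t : ℝ, (refSimplex (n + 1)).indicator g (Fin.cons t y) = 0 := fun t => by
            rw [Set.indicator_of_notMem]
            rw [hmem]; exact fun h => hy h.1
          simp [h1]
    _ = _ := integral_indicator isClosed_refSimplex.measurableSet

theorem hasFDerivAt_par (z : Fin (n + 1) → E d) (y : Fin n → ℝ) :
    HasFDerivAt (par z) (∑ i, (ContinuousLinearMap.proj i : (Fin n → ℝ) →L[ℝ] ℝ).smulRight
      (z i.succ - z 0)) y := by
  unfold par
  refine HasFDerivAt.const_add _ (HasFDerivAt.fun_sum fun i _ => ?_)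
  exact ((ContinuousLinearMap.proj i : (Fin n → ℝ) →L[ℝ] ℝ).smulRight
      (z i.succ - z 0)).hasFDerivAt

theorem contDiff_par (z : Fin (n + 1) → E d) {k : WithTop ℕ∞} : ContDiff ℝ k (par z) := by
  unfold par
  fun_prop

/-- Here the face of entry turns out to be opposite to `z 1`; in `par_cons_one_sub` the slanted face
turns out to be opposite to `z 0`. This fixes the signs in `stokes`. -/
theorem par_cons_zero (z : Fin (n + 2) → E d) (y : Fin n → ℝ) :
    par z (Fin.cons 0 y) = par (z ∘ Fin.succAbove 1) y := by
  simp only [par, Fin.sum_univ_succ, Fin.cons_zero, Fin.cons_succ, zero_smul, zero_add,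
    Function.comp]
  rfl

theorem par_cons_one_sub (z : Fin (n + 2) → E d) (y : Fin n → ℝ) :
    par z (Fin.cons (1 - ∑ i, y i) y) = par (z ∘ Fin.succ) y := by
  simp only [par, Fin.sum_univ_succ, Fin.cons_zero, Fin.cons_succ, Function.comp, smul_sub,
    Finset.sum_sub_distrib, ← Finset.sum_smul]
  module

theorem range_comp_succAbove {α : Type*} {z : Fin (n + 2) → α} (hz : Function.Injective z)
    (i : Fin (n + 2)) : Set.range (z ∘ Fin.succAbove i) = Set.range z \ {z i} := by
  rw [Set.range_comp, Fin.range_succAbove, Set.image_compl_eq_range_sdiff_image hz,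
    Set.image_singleton]

/-- The divergence theorem on a simplex, in the direction of an edge. -/
theorem stokes {K : Finset (E (n + 1))} (hK : IsSimplex K) {a b : E (n + 1)} (ha : a ∈ K)
    (hb : b ∈ K) (hab : a ≠ b) : ∃ c₁ c₂ : ℝ, 0 < c₁ ∧ 0 < c₂ ∧ ∀ f : E (n + 1) → ℝ,
      ContDiff ℝ 1 f → ∫ x in hull K, fderiv ℝ f x (b - a) =
        c₁ * faceIntegral (open Classical in K.erase a) f -
          c₂ * faceIntegral (open Classical in K.erase b) f := by
  classical
  obtain ⟨z, hz, hr, h0, h1⟩ := exists_enum_two hK.indep hK.card ha hb hab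
  obtain ⟨J, hJ, hJf⟩ := integral_hull_eq hz hr
  have hza : Set.range (z ∘ Fin.succ) = ((K.erase a : Finset _) : Set (E (n + 1))) := by
    have := range_comp_succAbove hz.injective 0
    rw [hr, h0] at this
    rw [Finset.coe_erase, ← this]
    congr 1
  have hzb : Set.range (z ∘ Fin.succAbove 1) = ((K.erase b : Finset _) : Set (E (n + 1))) := by
    rw [range_comp_succAbove hz.injective 1, hr, h1, Finset.coe_erase]
  obtain ⟨ca, hca, ha'⟩ := faceIntegral_eq (hz.comp_embedding (Fin.succEmb (n + 1))) hza
  obtain ⟨cb, hcb, hb'⟩ := faceIntegral_eq (hz.comp_embedding (Fin.succAboveEmb 1)) hzb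
  -- Ratios of the volume factors of the element and of its two faces. Only their positivity is used
  -- later, so no normal vectors are needed.
  refine ⟨J / ca, J / cb, by positivity, by positivity, fun f hf => ?_⟩
  have hc : Continuous f := hf.continuous
  rw [ha', hb', hJf]
  have h2 : ∀ y, fderiv ℝ f (par z y) (b - a) = fderiv ℝ (f ∘ par z) y (Pi.single 0 1) := by
    intro y
    rw [(((hf.differentiable one_ne_zero) (par z y)).hasFDerivAt.comp y (hasFDerivAt_par z y)).fderiv]
    simp [Fin.sum_univ_succ, h0, h1]
  simp only [h2]
  rw [stokes_ref (hf.comp (contDiff_par z)), integral_sub]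
  · simp only [Function.comp_apply, par_cons_zero, par_cons_one_sub]
    field_simp
    rfl
  · simp only [Function.comp_apply, par_cons_one_sub]
    exact integrableOn_refSimplex (hc.comp (continuous_par _))
  · simp only [Function.comp_apply, par_cons_zero]
    exact integrableOn_refSimplex (hc.comp (continuous_par _))

end FEM

/-! ### Integrals over simplices, bubbles, weighted projections, scaling estimates, integration by
parts. -/

namespace FEM

variable {d n : ℕ}

/-! ### Pullback of polynomials to the reference simplex -/

/-- The pullback of a polynomial under the parametrization of a simplex. -/
def pull (z : Fin (n + 1) → E d) (q : Poly d) : MvPolynomial (Fin n) ℝ :=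
  MvPolynomial.bind₁ (fun i => MvPolynomial.C (z 0 i) +
    ∑ j, MvPolynomial.C (z j.succ i - z 0 i) * MvPolynomial.X j) q

theorem eval_pull (z : Fin (n + 1) → E d) (q : Poly d) (y : Fin n → ℝ) :
    MvPolynomial.eval y (pull z q) = ev q (par z y) := by
  unfold pull ev
  rw [← MvPolynomial.coe_aeval_eq_eval, ← MvPolynomial.coe_aeval_eq_eval, RingHom.coe_coe,
    MvPolynomial.aeval_bind₁]
  simp [par, mul_comm]

theorem totalDegree_pull_le (z : Fin (n + 1) → E d) (q : Poly d) :
    (pull z q).totalDegree ≤ q.totalDegree := by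
  unfold pull
  conv_lhs => rw [q.as_sum, map_sum]
  refine MvPolynomial.totalDegree_finsetSum_le fun s hs => ?_
  rw [MvPolynomial.bind₁_monomial]
  refine (MvPolynomial.totalDegree_mul _ _).trans ?_
  rw [MvPolynomial.totalDegree_C, zero_add]
  refine (MvPolynomial.totalDegree_finsetProd _ _).trans ?_
  refine le_trans (Finset.sum_le_sum fun i _ => ?_) (MvPolynomial.le_totalDegree hs)
  refine (MvPolynomial.totalDegree_pow _ _).trans ?_
  refine (Nat.mul_le_mul_left _ (?_ : _ ≤ 1)).trans (mul_one _).le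
  refine (MvPolynomial.totalDegree_add _ _).trans (max_le (by simp) ?_)
  refine MvPolynomial.totalDegree_finsetSum_le fun j _ => ?_
  refine (MvPolynomial.totalDegree_mul _ _).trans ?_
  rw [MvPolynomial.totalDegree_C, zero_add, MvPolynomial.totalDegree_X]

theorem eval_pderiv_pull (z : Fin (n + 1) → E d) (q : Poly d) (y : Fin n → ℝ) (j : Fin n) :
    MvPolynomial.eval y (MvPolynomial.pderiv j (pull z q)) =
      inner ℝ (gradPoly q (par z y)) (z j.succ - z 0) := by
  classical
  have h1 := (hasFDerivAt_ev q (par z y)).comp y (hasFDerivAt_par z y)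
  have h2 := hasFDerivAt_eval (pull z q) y
  have h3 : (fun y => MvPolynomial.eval y (pull z q)) = ev q ∘ par z :=
    funext fun y => eval_pull z q y
  rw [h3] at h2
  have h4 := congrArg (fun L : (Fin n → ℝ) →L[ℝ] ℝ => L (Pi.single j 1)) (h2.unique h1)
  simpa [Pi.single_apply] using h4

/-! ### Integrals over simplices -/

/-- The functional `I` is, up to a positive factor, integration over the `n`-simplex `C`. -/
def IsSimplexIntegral (I : (E d → ℝ) → ℝ) (C : Finset (E d)) (n : ℕ) : Prop :=
  ∃ z : Fin (n + 1) → E d, AffineIndependent ℝ z ∧ Set.range z = (C : Set (E d)) ∧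
    ∃ c : ℝ, 0 < c ∧ ∀ f, I f = c * ∫ y in refSimplex n, f (par z y)

theorem IsSimplex.isSimplexIntegral {K : Finset (E d)} (hK : IsSimplex K) :
    IsSimplexIntegral (fun f => ∫ x in hull K, f x) K d := by
  obtain ⟨z, hz, hr⟩ := exists_enum hK.indep hK.card
  exact ⟨z, hz, hr, integral_hull_eq hz hr⟩

theorem IsSimplex.isSimplexIntegral_face {K F : Finset (E d)} (hK : IsSimplex K) (hF : F ⊆ K)
    (hc : F.card = d) (hd : 1 ≤ d) : IsSimplexIntegral (faceIntegral F) F (d - 1) := by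
  obtain ⟨n, rfl⟩ : ∃ n, d = n + 1 := ⟨d - 1, by omega⟩
  obtain ⟨z, hz, hr⟩ := exists_enum (affineIndependent_subset hF hK.indep) hc
  exact ⟨z, hz, hr, faceIntegral_eq hz hr⟩

namespace IsSimplexIntegral

variable {I : (E d → ℝ) → ℝ} {C : Finset (E d)} (hI : IsSimplexIntegral I C n)
include hI

theorem add {f g : E d → ℝ} (hf : Continuous f) (hg : Continuous g) :
    I (fun x => f x + g x) = I f + I g := by
  obtain ⟨z, -, -, c, -, h⟩ := hI
  have := integral_add (integrableOn_refSimplex (hf.comp (continuous_par z)))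
    (integrableOn_refSimplex (hg.comp (continuous_par z)))
  simp only [Function.comp_apply] at this
  rw [h, h, h, this]
  ring

theorem sub {f g : E d → ℝ} (hf : Continuous f) (hg : Continuous g) :
    I (fun x => f x - g x) = I f - I g := by
  obtain ⟨z, -, -, c, -, h⟩ := hI
  have := integral_sub (integrableOn_refSimplex (hf.comp (continuous_par z)))
    (integrableOn_refSimplex (hg.comp (continuous_par z)))
  simp only [Function.comp_apply] at this
  rw [h, h, h, this]
  ring

theorem const_mul (a : ℝ) (f : E d → ℝ) : I (fun x => a * f x) = a * I f := by
  obtain ⟨z, -, -, c, -, h⟩ := hI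
  rw [h, h, integral_const_mul]
  ring

theorem congr {f g : E d → ℝ} (hfg : ∀ x ∈ hull C, f x = g x) : I f = I g := by
  obtain ⟨z, -, hr, c, -, h⟩ := hI
  rw [h, h]
  congr 1
  refine setIntegral_congr_fun isClosed_refSimplex.measurableSet fun y hy => hfg _ ?_
  rw [hull, ← hr]
  exact par_mem hy

theorem eq_zero {f : E d → ℝ} (hf : ∀ x ∈ hull C, f x = 0) : I f = 0 := by
  rw [hI.congr (g := fun _ => 0 * 0) (by simpa using hf), hI.const_mul, zero_mul]

theorem eq_zero_of_nonneg {f : E d → ℝ} (hf : Continuous f) (h0 : ∀ x ∈ hull C, 0 ≤ f x)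
    (hi : I f = 0) : ∀ x ∈ hull C, f x = 0 := by
  obtain ⟨z, -, hr, c, hc, h⟩ := hI
  have hh : hull C = par z '' refSimplex n := by rw [image_par, hr]; rfl
  rw [hh] at h0 ⊢
  rw [h, mul_eq_zero, or_iff_right hc.ne'] at hi
  rintro _ ⟨y, hy, rfl⟩
  exact eq_zero_of_integral_refSimplex (hf.comp (continuous_par z))
    (fun y hy => h0 _ ⟨y, hy, rfl⟩) hi y hy

theorem mono {f g : E d → ℝ} (hf : Continuous f) (hg : Continuous g)
    (hfg : ∀ x ∈ hull C, f x ≤ g x) : I f ≤ I g := by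
  obtain ⟨z, -, hr, c, hc, h⟩ := hI
  rw [h, h]
  refine mul_le_mul_of_nonneg_left (setIntegral_mono_on
    (integrableOn_refSimplex (hf.comp (continuous_par z)))
    (integrableOn_refSimplex (hg.comp (continuous_par z))) isClosed_refSimplex.measurableSet
    fun y hy => hfg _ ?_) hc.le
  rw [hull, ← hr]
  exact par_mem hy

theorem one_pos : 0 < I fun _ => 1 := by
  refine lt_of_le_of_ne ?_ fun h => ?_
  · have := hI.mono (f := fun _ => 0) (g := fun _ => 1) continuous_const continuous_const
      fun _ _ => zero_le_one
    rwa [hI.eq_zero (f := fun _ => 0) fun _ _ => rfl] at this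
  · obtain ⟨z, -, hr, -⟩ := id hI
    have hx : z 0 ∈ hull C := subset_convexHull ℝ _ (by rw [← hr]; exact Set.mem_range_self 0)
    exact one_ne_zero (hI.eq_zero_of_nonneg (f := fun _ => 1) continuous_const
      (fun _ _ => zero_le_one) h.symm _ hx)

/-- A function with vanishing mean is bounded by its oscillation. -/
theorem abs_le_of_mean_zero {f : E d → ℝ} (hf : Continuous f) (h0 : I f = 0) {x : E d} {B : ℝ}
    (hB : ∀ y ∈ hull C, |f x - f y| ≤ B) : |f x| ≤ B := by
  have hp := hI.one_pos
  have hc : ∀ a : ℝ, I (fun _ => a) = a * I (fun _ => 1) := fun a => by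
    rw [← hI.const_mul]; simp
  have h1 : I (fun y => f x - f y) = f x * I (fun _ => 1) := by
    rw [hI.sub continuous_const hf, h0, sub_zero, hc]
  have hcont : Continuous fun y => f x - f y := continuous_const.sub hf
  have h2 := hI.mono hcont (continuous_const (y := B)) fun y hy => (abs_le.1 (hB y hy)).2
  have h3 := hI.mono (continuous_const (y := -B)) hcont fun y hy => (abs_le.1 (hB y hy)).1
  rw [h1, hc B] at h2
  rw [h1, hc (-B)] at h3
  exact abs_le.2 ⟨le_of_mul_le_mul_right h3 hp, le_of_mul_le_mul_right h2 hp⟩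

end IsSimplexIntegral

/-! ### Bubbles -/

theorem ev_bubble (C K : Finset (E d)) (x : E d) : ev (bubble C K) x = ∏ z ∈ C, lam K z x := by
  simp [bubble, ev_prod, lam]

theorem lam_par {K C : Finset (E d)} (hK : IsSimplex K) (hC : C ⊆ K) {z : Fin (n + 1) → E d}
    (hz : AffineIndependent ℝ z) (hr : Set.range z = (C : Set (E d))) (i : Fin (n + 1))
    (y : Fin n → ℝ) :
    lam K (z i) (par z y) = (Fin.cons (1 - ∑ j, y j) y : Fin (n + 1) → ℝ) i := by
  classical
  rw [par_eq_sum, hK.lam_sum _ _ _ _ (by rw [Fin.sum_univ_succ]; simp), Finset.sum_eq_single i]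
  · rw [hK.lam_vertex (hC (by rw [← Finset.mem_coe, ← hr]; exact Set.mem_range_self i))]; simp
  · intro j _ hj
    rw [hK.lam_vertex (hC (by rw [← Finset.mem_coe, ← hr]; exact Set.mem_range_self j)),
      if_neg (hz.injective.ne hj), mul_zero]
  · exact fun h => absurd (Finset.mem_univ i) h

/-- The bubble function on the reference simplex. -/
def refBubble (n : ℕ) (y : Fin n → ℝ) : ℝ := (1 - ∑ i, y i) * ∏ i, y i

theorem continuous_refBubble : Continuous (refBubble n) := by unfold refBubble; fun_prop

theorem refBubble_nonneg (y : Fin n → ℝ) (hy : y ∈ refSimplex n) : 0 ≤ refBubble n y :=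
  mul_nonneg (sub_nonneg.2 hy.2) (Finset.prod_nonneg fun i _ => hy.1 i)

theorem refBubble_pos (y : Fin n → ℝ) (hy : y ∈ refInterior n) : 0 < refBubble n y :=
  mul_pos (sub_pos.2 hy.2) (Finset.prod_pos fun i _ => hy.1 i)

/-- The pulled-back bubble does not depend on the simplex. This is why the bounds for the weighted
projections are independent of the shape. -/
theorem ev_bubble_par {K C : Finset (E d)} (hK : IsSimplex K) (hC : C ⊆ K)
    {z : Fin (n + 1) → E d} (hz : AffineIndependent ℝ z) (hr : Set.range z = (C : Set (E d)))
    (y : Fin n → ℝ) : ev (bubble C K) (par z y) = refBubble n y := by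
  classical
  rw [ev_bubble]
  have hCi : C = Finset.univ.image z := by
    ext x
    rw [← Finset.mem_coe, ← hr]; simp
  conv_lhs => rw [hCi]
  rw [Finset.prod_image hz.injective.injOn]
  simp only [lam_par hK hC hz hr]
  rw [Fin.prod_univ_succ]
  simp [refBubble]

theorem IsSimplex.bubble_nonneg {K : Finset (E d)} (hK : IsSimplex K) (C : Finset (E d)) {x : E d}
    (hx : x ∈ hull K) : 0 ≤ ev (bubble C K) x := by
  rw [ev_bubble]; exact Finset.prod_nonneg fun z _ => hK.lam_nonneg hx z

theorem IsSimplex.bubble_le_one {K : Finset (E d)} (hK : IsSimplex K) (C : Finset (E d)) {x : E d}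
    (hx : x ∈ hull K) : ev (bubble C K) x ≤ 1 := by
  rw [ev_bubble]
  exact Finset.prod_le_one (fun z _ => hK.lam_nonneg hx z) fun z _ => hK.lam_le_one hx z

theorem IsSimplex.bubble_eq_zero {K C : Finset (E d)} (hK : IsSimplex K) (h : ¬ C ⊆ K) :
    bubble C K = 0 := by
  obtain ⟨z, hz, hzK⟩ := Finset.not_subset.1 h
  exact Finset.prod_eq_zero hz (hK.lagrange_eq_zero le_rfl (by rwa [nodes_one]))

theorem IsSimplex.bubble_eq_zero_on_face {K C F : Finset (E d)} (hK : IsSimplex K) (hF : F ⊆ K)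
    (h : ¬ C ⊆ F) {x : E d} (hx : x ∈ hull F) : ev (bubble C K) x = 0 := by
  obtain ⟨z, hz, hzF⟩ := Finset.not_subset.1 h
  rw [ev_bubble]
  refine Finset.prod_eq_zero hz ?_
  exact hK.lagrange_eq_zero_on_face le_rfl hF (by rwa [nodes_one]) hx

theorem IsSimplex.totalDegree_bubble {K : Finset (E d)} (hK : IsSimplex K) (C : Finset (E d)) :
    (bubble C K).totalDegree ≤ C.card := by
  refine (MvPolynomial.totalDegree_finsetProd _ _).trans ?_
  refine (Finset.sum_le_card_nsmul _ _ 1 fun z _ => ?_).trans (by simp)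
  exact hK.totalDegree_lagrange le_rfl z

/-! ### Weighted projections -/

/-- Definiteness is not assumed, because for integrals over a face the polynomials vanishing on that
face lie in the kernel of the form. The range of `b` is the annihilator of its kernel, so it is
enough that `l` vanishes there. -/
theorem exists_riesz {W : Type*} [AddCommGroup W] [Module ℝ W] [FiniteDimensional ℝ W]
    (b : W →ₗ[ℝ] W →ₗ[ℝ] ℝ) (hsymm : ∀ v w, b v w = b w v) (l : W →ₗ[ℝ] ℝ)
    (hl : ∀ w, b w w = 0 → l w = 0) : ∃ Q, ∀ w, b Q w = l w := by
  have h : l ∈ LinearMap.range (LinearMap.dualMap b) := by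
    rw [LinearMap.range_dualMap_eq_dualAnnihilator_ker, Submodule.mem_dualAnnihilator]
    intro w hw
    rw [LinearMap.mem_ker] at hw
    exact hl w (by rw [hw]; rfl)
  obtain ⟨φ, hφ⟩ := h
  refine ⟨(Module.evalEquiv ℝ W).symm φ, fun w => ?_⟩
  rw [hsymm, ← hφ]
  have : φ = Module.evalEquiv ℝ W ((Module.evalEquiv ℝ W).symm φ) := by simp
  conv_rhs => rw [this]
  rfl

namespace IsSimplexIntegral

variable {I : (E d → ℝ) → ℝ} {C K : Finset (E d)} (hI : IsSimplexIntegral I C n)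
  (hK : IsSimplex K) (hC : C ⊆ K)
include hI hK hC

theorem eq_zero_of_bubble {Q : Poly d}
    (h : I (fun x => ev Q x * ev Q x * ev (bubble C K) x) = 0) : ∀ x ∈ hull C, ev Q x = 0 := by
  obtain ⟨z, hz, hr, c, hc, hIf⟩ := hI
  have hh : hull C = par z '' refSimplex n := by rw [image_par, hr]; rfl
  rw [hIf, mul_eq_zero, or_iff_right hc.ne'] at h
  simp only [ev_bubble_par hK hC hz hr, ← eval_pull] at h
  have h0 : pull z Q = 0 := eq_zero_of_refForm _ continuous_refBubble refBubble_nonneg refBubble_pos h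
  rw [hh]
  rintro _ ⟨y, _, rfl⟩
  rw [← eval_pull, h0, map_zero]

/-- Supplies the witnesses for `QF` and `QK`. The degenerate directions of the weighted form are the
polynomials vanishing on `hull C`, and these are annihilated by the right-hand side. -/
theorem exists_projection (p : ℕ) (v : Poly d) : ∃ Q : Poly d, Q.totalDegree ≤ p ∧
    ∀ q : Poly d, q.totalDegree ≤ p →
      I (fun x => ev Q x * ev q x * ev (bubble C K) x) = I (fun x => ev v x * ev q x) := by
  let W := MvPolynomial.restrictTotalDegree (Fin d) ℝ p
  let b : W →ₗ[ℝ] W →ₗ[ℝ] ℝ := LinearMap.mk₂ ℝ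
    (fun Q q => I (fun x => ev Q.1 x * ev q.1 x * ev (bubble C K) x))
    (fun Q Q' q => by
      simp only [← ev_mul]
      exact (hI.congr fun x _ => by simp [add_mul]).trans
        (hI.add (continuous_ev _) (continuous_ev _)))
    (fun a Q q => by
      rw [smul_eq_mul, ← hI.const_mul]; simp [mul_assoc])
    (fun Q q q' => by
      simp only [← ev_mul]
      exact (hI.congr fun x _ => by simp [add_mul, mul_add]).trans
        (hI.add (continuous_ev _) (continuous_ev _)))
    (fun a Q q => by
      rw [smul_eq_mul, ← hI.const_mul]; simp [mul_assoc, mul_left_comm])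
  let l : W →ₗ[ℝ] ℝ :=
    { toFun := fun q => I (fun x => ev v x * ev q.1 x)
      map_add' := fun q q' => by
        simp only [← ev_mul]
        exact (hI.congr fun x _ => by simp [mul_add]).trans
          (hI.add (continuous_ev _) (continuous_ev _))
      map_smul' := fun a q => by
        rw [RingHom.id_apply, smul_eq_mul, ← hI.const_mul]; simp [mul_left_comm] }
  obtain ⟨Q, hQ⟩ := exists_riesz b
    (fun v w => hI.congr fun x _ => by ring) l
    (fun w hw => hI.eq_zero fun x hx => by rw [hI.eq_zero_of_bubble hK hC hw x hx, mul_zero])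
  exact ⟨Q.1, (MvPolynomial.mem_restrictTotalDegree _ _ _).1 Q.2, fun q hq =>
    hQ ⟨q, (MvPolynomial.mem_restrictTotalDegree _ _ _).2 hq⟩⟩

end IsSimplexIntegral

/-- Testing with `Q` itself bounds the squared maximum norm of `Q` by a multiple of the integral of
`v Q`, thus by a multiple of `B` times the maximum norm; one factor is cancelled. The volume factor
drops out of the defining relation. -/
theorem exists_projection_bound (n p : ℕ) : ∃ A : ℝ, 0 ≤ A ∧
    ∀ {d : ℕ} {I : (E d → ℝ) → ℝ} {C K : Finset (E d)}, IsSimplexIntegral I C n → IsSimplex K →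
      C ⊆ K → ∀ (Q v : Poly d) (B : ℝ), Q.totalDegree ≤ p → (∀ x ∈ hull C, |ev v x| ≤ B) →
      I (fun x => ev Q x * ev Q x * ev (bubble C K) x) = I (fun x => ev v x * ev Q x) →
      ∀ x ∈ hull C, |ev Q x| ≤ A * B := by
  obtain ⟨A, hA, h⟩ := exists_bound_refForm (n := n) p _ continuous_refBubble refBubble_nonneg
    refBubble_pos LinearMap.id
  refine ⟨A * (volume (refSimplex n)).toReal, by positivity, ?_⟩
  intro d I C K hI hK hC Q v B hQ hB hrel
  obtain ⟨z, hz, hr, c, hc, hIf⟩ := hI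
  have hh : hull C = par z '' refSimplex n := by rw [image_par, hr]; rfl
  rw [hh] at hB ⊢
  rw [hIf, hIf] at hrel
  replace hrel := mul_left_cancel₀ hc.ne' hrel
  simp only [ev_bubble_par hK hC hz hr, ← eval_pull] at hrel
  set P := pull z Q
  set S := ‖restrictRef n P‖
  have hP := h P ((totalDegree_pull_le z Q).trans hQ)
  have h1 : ∫ y in refSimplex n, MvPolynomial.eval y (pull z v) * MvPolynomial.eval y P ≤
      B * S * (volume (refSimplex n)).toReal := by
    have h2 : ∀ y ∈ refSimplex n,
        ‖MvPolynomial.eval y (pull z v) * MvPolynomial.eval y P‖ ≤ B * S := by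
      intro y hy
      rw [norm_mul, eval_pull]
      have hb := hB _ ⟨y, hy, rfl⟩
      exact mul_le_mul hb (abs_eval_le_restrictRef P hy) (norm_nonneg _) ((abs_nonneg _).trans hb)
    exact (le_abs_self _).trans
      (norm_setIntegral_le_of_norm_le_const isCompact_refSimplex.measure_lt_top h2)
  have hS2 : S ^ 2 ≤ A * (B * S * (volume (refSimplex n)).toReal) := by
    have h3 : S ≤ Real.sqrt (A * (B * S * (volume (refSimplex n)).toReal)) := by
      refine (ContinuousMap.norm_le _ (Real.sqrt_nonneg _)).2 fun y => ?_
      refine Real.le_sqrt_of_sq_le ?_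
      have h4 := hP y.1 y.2
      rw [hrel] at h4
      rw [Real.norm_eq_abs, sq_abs]
      exact h4.trans (mul_le_mul_of_nonneg_left h1 hA)
    calc S ^ 2 ≤ (Real.sqrt (A * (B * S * (volume (refSimplex n)).toReal))) ^ 2 := by
          gcongr
      _ = _ := by
          refine Real.sq_sqrt (mul_nonneg hA ?_)
          have : 0 ≤ B := (abs_nonneg _).trans
            (hB _ ⟨_, refInterior_subset exists_mem_refInterior, rfl⟩)
          positivity
  rintro _ ⟨y, hy, rfl⟩
  rw [← eval_pull]
  refine (abs_eval_le_restrictRef P hy).trans ?_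
  by_contra! hlt
  have hB0 : 0 ≤ B := (abs_nonneg _).trans
    (hB _ ⟨_, refInterior_subset exists_mem_refInterior, rfl⟩)
  have hSpos : 0 < S := lt_of_le_of_lt (by positivity) hlt
  nlinarith

/-! ### Oscillation and inverse estimates -/

/-- The partial derivatives of the pullback are inner products of the gradient with edge vectors,
whose length is at most the diameter. The volume factor occurs on both sides, so no shape regularity
is needed. -/
theorem exists_osc_bound (d p : ℕ) : ∃ A : ℝ, 0 ≤ A ∧ ∀ {K : Finset (E d)}, IsSimplex K →
    ∀ q : Poly d, q.totalDegree ≤ p → ∀ x ∈ hull K, ∀ x' ∈ hull K,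
      (ev q x - ev q x') ^ 2 * (volume (hull K)).toReal ≤
        A * Metric.diam (hull K) ^ 2 * ∫ x in hull K, ‖gradPoly q x‖ ^ 2 := by
  obtain ⟨A, hA, h⟩ := exists_bound_osc d p
  refine ⟨A * d * (volume (refSimplex d)).toReal, by positivity, ?_⟩
  intro K hK q hq
  obtain ⟨z, hz, hr⟩ := exists_enum hK.indep hK.card
  obtain ⟨c, hc, hIf⟩ := integral_hull_eq hz hr
  have hh : hull K = par z '' refSimplex d := by rw [image_par, hr]; rfl
  have hvol : (volume (hull K)).toReal = c * (volume (refSimplex d)).toReal := by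
    have := hIf fun _ => 1
    simpa [Measure.real] using this
  have hmem : ∀ i, z i ∈ hull K := fun i =>
    subset_convexHull ℝ _ (by rw [← hr]; exact Set.mem_range_self i)
  rw [hIf, hvol]
  set D := Metric.diam (hull K) with hD
  have key : ∀ x ∈ hull K, ∀ x' ∈ hull K,
      (ev q x - ev q x') ^ 2 ≤ A * (d * (D ^ 2 *
        ∫ y in refSimplex d, ‖gradPoly q (par z y)‖ ^ 2)) := by
    intro x hx x' hx'
    rw [hh] at hx hx'
    obtain ⟨y, hy, rfl⟩ := hx
    obtain ⟨y', hy', rfl⟩ := hx'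
    rw [← eval_pull, ← eval_pull]
    refine (h _ ((totalDegree_pull_le z q).trans hq) y hy y' hy').trans ?_
    refine mul_le_mul_of_nonneg_left ?_ hA
    have hcard : (d : ℝ) = ((Finset.univ : Finset (Fin d)).card : ℝ) := by simp
    rw [hcard, ← nsmul_eq_mul]
    refine Finset.sum_le_card_nsmul _ _ _ fun i _ => ?_
    rw [← integral_const_mul]
    refine setIntegral_mono_on (integrableOn_refSimplex ((continuous_eval_poly _).pow 2))
      (integrableOn_refSimplex
        (continuous_const.mul (((continuous_gradPoly q).comp (continuous_par z)).norm.pow 2)))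
      isClosed_refSimplex.measurableSet fun y hy => ?_
    rw [eval_pderiv_pull, ← sq_abs, mul_comm, ← mul_pow]
    have h1 : ‖z i.succ - z 0‖ ≤ D := by
      rw [← dist_eq_norm]
      exact Metric.dist_le_diam_of_mem (isCompact_hull K).isBounded (hmem _) (hmem _)
    have h2 := abs_real_inner_le_norm (gradPoly q (par z y)) (z i.succ - z 0)
    have h3 : ‖gradPoly q (par z y)‖ * ‖z i.succ - z 0‖ ≤ ‖gradPoly q (par z y)‖ * D := by gcongr
    have := h2.trans h3
    gcongr
  intro x hx x' hx'
  calc _ ≤ A * (d * (D ^ 2 * ∫ y in refSimplex d, ‖gradPoly q (par z y)‖ ^ 2)) *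
        (c * (volume (refSimplex d)).toReal) := by
        gcongr
        exact key x hx x' hx'
    _ = _ := by ring

/-- The derivatives of the pullback, that is, the inner products of the gradient with edges, are
bounded on the reference simplex. The diameter of the ball in the direction of the gradient joins
two points of `hull K`, so it is a combination of the edges `z i.succ - z 0` with coefficients of
modulus at most `1`; this bounds `r` times the length of the gradient. -/
theorem exists_inverse_bound (d p : ℕ) : ∃ A : ℝ, 0 ≤ A ∧ ∀ {K : Finset (E d)}, IsSimplex K →
    ∀ q : Poly d, q.totalDegree ≤ p → ∀ (B r : ℝ) (x₀ : E d), 0 < r →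
      Metric.closedBall x₀ r ⊆ hull K → (∀ x ∈ hull K, |ev q x| ≤ B) →
      r ^ 2 * ∫ x in hull K, ‖gradPoly q x‖ ^ 2 ≤ A * (volume (hull K)).toReal * B ^ 2 := by
  have c1 : Continuous fun _ : Fin d → ℝ => (1 : ℝ) := continuous_const
  have hex : ∃ A : ℝ, 0 ≤ A ∧ ∀ P : MvPolynomial (Fin d) ℝ, P.totalDegree ≤ p → ∀ B : ℝ,
      (∀ y ∈ refSimplex d, |MvPolynomial.eval y P| ≤ B) → ∀ y ∈ refSimplex d, ∀ i,
        |MvPolynomial.eval y (MvPolynomial.pderiv i P)| ≤ A * B := by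
    choose A hA h using fun i : Fin d => exists_bound_refForm (n := d) p _ c1
      (fun _ _ => zero_le_one) (fun _ _ => zero_lt_one) (MvPolynomial.pderiv i).toLinearMap
    refine ⟨Real.sqrt ((∑ i, A i) * (volume (refSimplex d)).toReal), Real.sqrt_nonneg _, ?_⟩
    intro P hP B hB y hy i
    have hB0 : 0 ≤ B := (abs_nonneg _).trans (hB y hy)
    rw [← Real.sqrt_sq hB0, ← Real.sqrt_mul' _ (sq_nonneg B)]
    refine Real.le_sqrt_of_sq_le ?_
    rw [sq_abs]
    refine (h i P hP y hy).trans ?_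
    have h1 : ∫ y in refSimplex d, MvPolynomial.eval y P * MvPolynomial.eval y P * 1 ≤
        B ^ 2 * (volume (refSimplex d)).toReal := by
      have hle : ∀ y ∈ refSimplex d,
          ‖MvPolynomial.eval y P * MvPolynomial.eval y P * 1‖ ≤ B ^ 2 := fun y hy => by
        rw [mul_one, norm_mul, ← pow_two]
        have := hB y hy
        gcongr
        exact this
      exact (le_abs_self _).trans (norm_setIntegral_le_of_norm_le_const
        isCompact_refSimplex.measure_lt_top hle)
    have h2 : A i ≤ ∑ i, A i := Finset.single_le_sum (fun j _ => hA j) (Finset.mem_univ i)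
    calc A i * _ ≤ A i * (B ^ 2 * (volume (refSimplex d)).toReal) :=
          mul_le_mul_of_nonneg_left h1 (hA i)
      _ ≤ (∑ i, A i) * (B ^ 2 * (volume (refSimplex d)).toReal) := by gcongr
      _ = _ := by ring
  obtain ⟨A, hA, h⟩ := hex
  refine ⟨(d * A) ^ 2, by positivity, ?_⟩
  intro K hK q hq B r x₀ hr0 hball hB
  obtain ⟨z, hz, hr⟩ := exists_enum hK.indep hK.card
  have hh : hull K = par z '' refSimplex d := by rw [image_par, hr]; rfl
  have hpt : ∀ x ∈ hull K, r * ‖gradPoly q x‖ ≤ d * A * B := by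
    intro x hx
    rw [hh] at hx
    obtain ⟨y, hy, rfl⟩ := hx
    set g := gradPoly q (par z y) with hg
    have hB0 : 0 ≤ B := (abs_nonneg _).trans (hB (par z y) (by rw [hh]; exact ⟨y, hy, rfl⟩))
    have hder := h (pull z q) ((totalDegree_pull_le z q).trans hq) B
      (fun y hy => by rw [eval_pull]; exact hB _ (by rw [hh]; exact ⟨y, hy, rfl⟩)) y hy
    by_cases hg0 : g = 0
    · rw [hg0, norm_zero, mul_zero]; positivity
    have hgn : 0 < ‖g‖ := norm_pos_iff.2 hg0
    let ν : E d := (r / ‖g‖) • g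
    have hν : ‖ν‖ = r := by
      rw [norm_smul, Real.norm_eq_abs, abs_of_pos (by positivity)]; field_simp
    have h1 : x₀ + ν ∈ hull K := hball (by simp [hν])
    have h2 : x₀ - ν ∈ hull K := hball (by simp [hν])
    rw [hh] at h1 h2
    obtain ⟨a, ha, ha'⟩ := h1
    obtain ⟨b, hb, hb'⟩ := h2
    have h3 : (2 : ℝ) • ν = ∑ i, (a i - b i) • (z i.succ - z 0) := by
      have : par z a - par z b = (2 : ℝ) • ν := by rw [ha', hb']; module
      rw [← this]
      simp only [par, sub_smul, Finset.sum_sub_distrib]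
      abel
    have h4 : inner ℝ g ((2 : ℝ) • ν) = 2 * (r * ‖g‖) := by
      simp only [ν, inner_smul_right, real_inner_self_eq_norm_sq]
      field_simp
    have h5 : inner ℝ g ((2 : ℝ) • ν) ≤ d * (A * B) := by
      rw [h3, inner_sum]
      have hcard : (d : ℝ) = ((Finset.univ : Finset (Fin d)).card : ℝ) := by simp
      rw [hcard, ← nsmul_eq_mul]
      refine Finset.sum_le_card_nsmul _ _ _ fun i _ => ?_
      rw [inner_smul_right, hg, ← eval_pderiv_pull]
      have e1 : |a i - b i| ≤ 1 := abs_le.2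
        ⟨by linarith [ha.1 i, le_one_of_mem_refSimplex hb i],
         by linarith [hb.1 i, le_one_of_mem_refSimplex ha i]⟩
      calc _ ≤ |a i - b i| * |MvPolynomial.eval y (MvPolynomial.pderiv i (pull z q))| := by
            rw [← abs_mul]; exact le_abs_self _
        _ ≤ 1 * (A * B) := mul_le_mul e1 (hder i) (abs_nonneg _) zero_le_one
        _ = _ := one_mul _
    nlinarith [mul_pos hr0 hgn]
  rw [← integral_const_mul]
  have hle : ∀ x ∈ hull K, ‖r ^ 2 * ‖gradPoly q x‖ ^ 2‖ ≤ (d * A) ^ 2 * B ^ 2 := by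
    intro x hx
    rw [Real.norm_eq_abs, abs_of_nonneg (by positivity), ← mul_pow, ← mul_pow]
    have := hpt x hx
    gcongr
  refine (le_abs_self _).trans ((norm_setIntegral_le_of_norm_le_const
    (isCompact_hull K).measure_lt_top hle).trans (le_of_eq ?_))
  rw [Measure.real]; ring

/-! ### Integration by parts -/

/-- If all face integrals of `g` vanish, so do the integrals of all its derivatives. -/
theorem IsSimplex.integral_fderiv_eq_zero {K : Finset (E d)} (hK : IsSimplex K) (hd : 1 ≤ d)
    {g : E d → ℝ} (hg : ContDiff ℝ 1 g)
    (h : ∀ F ⊆ K, F.card = d → faceIntegral F g = 0) (v : E d) :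
    ∫ x in hull K, fderiv ℝ g x v = 0 := by
  classical
  obtain ⟨n, rfl⟩ : ∃ n, d = n + 1 := ⟨d - 1, by omega⟩
  obtain ⟨a, ha⟩ := hK.nonempty
  have hedge : ∀ b ∈ K, ∫ x in hull K, fderiv ℝ g x (b - a) = 0 := by
    intro b hb
    by_cases hab : a = b
    · simp [hab]
    obtain ⟨c₁, c₂, -, -, hs⟩ := stokes hK ha hb hab
    rw [hs g hg, h _ (Finset.erase_subset _ _) (by rw [Finset.card_erase_of_mem ha, hK.card]; rfl),
      h _ (Finset.erase_subset _ _) (by rw [Finset.card_erase_of_mem hb, hK.card]; rfl)]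
    simp
  have hint : ∀ w, IntegrableOn (fun x => fderiv ℝ g x w) (hull K) := fun w =>
    ((hg.continuous_fderiv one_ne_zero).clm_apply continuous_const).continuousOn.integrableOn_compact
      (isCompact_hull K)
  -- The barycentric coordinates of `a + v` write any direction as a combination of edges issuing
  -- from `a`.
  have hv : v = ∑ b ∈ K, lam K b (a + v) • (b - a) := by
    simp only [smul_sub, Finset.sum_sub_distrib, ← Finset.sum_smul, hK.sum_lam, hK.sum_lam_smul]
    module
  rw [hv]
  simp only [map_sum, map_smul, smul_eq_mul]
  rw [integral_finsetSum _ fun b _ => (hint _).const_mul _]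
  refine Finset.sum_eq_zero fun b hb => ?_
  rw [integral_const_mul, hedge b hb, mul_zero]

/-- Overconsistency on an element: gradients are orthogonal to the gradients of polynomials of
degree `p` if enough moments on the element and on its faces vanish. -/
theorem IsSimplex.integral_grad_eq_zero {K : Finset (E d)} (hK : IsSimplex K) (hd : 1 ≤ d) {p : ℕ}
    {s w : Poly d} (hs : s.totalDegree ≤ p)
    (hel : ∀ r : Poly d, r.totalDegree ≤ p - 2 → ∫ x in hull K, ev w x * ev r x = 0)
    (hfa : ∀ F ⊆ K, F.card = d → ∀ q : Poly d, q.totalDegree ≤ p - 1 →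
      faceIntegral F (fun x => ev w x * ev q x) = 0) :
    ∫ x in hull K, inner ℝ (gradPoly s x) (gradPoly w x) = 0 := by
  have hint : ∀ q : Poly d, IntegrableOn (ev q) (hull K) := fun q =>
    (continuous_ev q).continuousOn.integrableOn_compact (isCompact_hull K)
  -- The identity ∇s·∇w = div(w∇s) − wΔs. The divergence is handled by face moments against ∂ᵢs of
  -- degree `p - 1`, the rest by element moments against second derivatives of degree `p - 2`.
  have h1 : ∀ x, inner ℝ (gradPoly s x) (gradPoly w x) =
      ∑ i, (ev (MvPolynomial.pderiv i (w * MvPolynomial.pderiv i s)) x -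
        ev (w * MvPolynomial.pderiv i (MvPolynomial.pderiv i s)) x) := by
    intro x
    simp only [PiLp.inner_apply, gradPoly]
    refine Finset.sum_congr rfl fun i _ => ?_
    simp [Derivation.leibniz]
    ring
  simp only [h1, ← ev_sub]
  rw [integral_finsetSum _ fun i _ => hint _]
  refine Finset.sum_eq_zero fun i _ => ?_
  simp only [ev_sub]
  rw [integral_sub (hint _) (hint _)]
  have hdeg := totalDegree_pderiv_le i s
  have h2 : ∫ x in hull K, ev (w * MvPolynomial.pderiv i (MvPolynomial.pderiv i s)) x = 0 := by
    simp only [ev_mul]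
    refine hel _ ?_
    have := totalDegree_pderiv_le i (MvPolynomial.pderiv i s)
    omega
  have h3 : ∫ x in hull K, ev (MvPolynomial.pderiv i (w * MvPolynomial.pderiv i s)) x = 0 := by
    have := hK.integral_fderiv_eq_zero hd
      ((contDiff_ev (w * MvPolynomial.pderiv i s)).of_le (by simp)) (fun F hF hc => by
        have := hfa F hF hc (MvPolynomial.pderiv i s) (by omega)
        simpa [← ev_mul] using this) (EuclideanSpace.single i 1)
    simpa [fderiv_ev, Pi.single_apply] using this
  rw [h2, h3, sub_zero]

end FEM

/-! ### Topology of meshes: sides of a face and chains of elements. -/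

namespace FEM

variable {d : ℕ}

/-! ### Topology of meshes -/

/-- Slits are excluded: moving from a boundary point a little against `e` leads strictly below the
graph, where a whole neighbourhood is disjoint from `Ω`. -/
theorem interior_closure_eq {Ω : Set (E d)} (ho : IsOpen Ω) (hL : HasLipschitzBoundary Ω) :
    interior (closure Ω) = Ω := by
  refine Set.Subset.antisymm (fun x hx => ?_) ho.subset_interior_closure
  by_contra hxΩ
  have hfr : x ∈ frontier Ω := by
    rw [ho.frontier_eq]; exact ⟨interior_subset hx, hxΩ⟩
  obtain ⟨e, he, L, g, hg, hev⟩ := hL x hfr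
  have hcont : Continuous fun y : E d => inner ℝ e y - g (y - inner ℝ e y • e) :=
    (by fun_prop : Continuous fun y : E d => inner ℝ e y).sub
      (hg.continuous.comp (by fun_prop))
  have hx0 : inner ℝ e x - g (x - inner ℝ e x • e) ≤ 0 := by
    have := hev.self_of_nhds
    simp only [hxΩ, false_iff, not_lt] at this
    linarith
  have hev2 : ∀ᶠ y in 𝓝 x, ∀ᶠ y' in 𝓝 y,
      (y' ∈ Ω ↔ g (y' - inner ℝ e y' • e) < inner ℝ e y') := eventually_eventually_nhds.2 hev
  have hlim : Filter.Tendsto (fun t : ℝ => x - t • e) (𝓝[>] 0) (𝓝 x) := by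
    have : Filter.Tendsto (fun t : ℝ => x - t • e) (𝓝 0) (𝓝 (x - (0 : ℝ) • e)) :=
      Continuous.tendsto (by fun_prop) 0
    rw [zero_smul, sub_zero] at this
    exact this.mono_left nhdsWithin_le_nhds
  have hint : ∀ᶠ y in 𝓝 x, y ∈ closure Ω := mem_interior_iff_mem_nhds.1 hx
  obtain ⟨t, ⟨h1, h2⟩, ht⟩ := ((hlim.eventually (hev2.and hint)).and self_mem_nhdsWithin).exists
  have ht : 0 < t := ht
  have hee : inner ℝ e e = (1 : ℝ) := by rw [real_inner_self_eq_norm_sq, he]; norm_num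
  have hneg : inner ℝ e (x - t • e) -
      g ((x - t • e) - inner ℝ e (x - t • e) • e) < 0 := by
    have e1 : inner ℝ e (x - t • e) = inner ℝ e x - t := by
      rw [inner_sub_right, inner_smul_right, hee, mul_one]
    have e2 : (x - t • e) - (inner ℝ e x - t) • e = x - inner ℝ e x • e := by module
    rw [e1, e2]; linarith
  have hev3 : ∀ᶠ y in 𝓝 (x - t • e), inner ℝ e y - g (y - inner ℝ e y • e) < 0 :=
    (isOpen_Iio.preimage hcont).mem_nhds hneg
  have hfreq := mem_closure_iff_frequently.1 h2
  obtain ⟨y, hy, hy1, hy2⟩ := (hfreq.and_eventually (h1.and hev3)).exists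
  have := hy1.1 hy
  linarith

namespace Mesh

variable {Ω : Set (E d)} (M : Mesh Ω)

theorem hull_subset_closure {K : Finset (E d)} (hK : K ∈ M.elems) : hull K ⊆ closure Ω := by
  rw [M.closure_eq]
  exact Set.subset_biUnion_of_mem (u := fun K => hull K) hK

theorem exists_mem_hull {x : E d} (hx : x ∈ closure Ω) : ∃ K ∈ M.elems, x ∈ hull K := by
  rw [M.closure_eq] at hx
  simpa using hx

theorem mem_hull_inter {K K' : Finset (E d)} (hK : K ∈ M.elems) (hK' : K' ∈ M.elems) {x : E d}
    (hx : x ∈ hull K) (hx' : x ∈ hull K') : x ∈ hull (open Classical in K ∩ K') := by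
  classical
  have := M.conforming K hK K' hK'
  rw [hull, Finset.coe_inter, ← this]
  exact ⟨hx, hx'⟩

/-- The point lies in the hull of the common vertices, where the coordinates of all other vertices
of `K` vanish. Conformity of the mesh is mostly used in this form. -/
theorem mem_of_lam_pos {K K' : Finset (E d)} (hK : K ∈ M.elems) (hK' : K' ∈ M.elems) {x z : E d}
    (hx : x ∈ hull K) (hx' : x ∈ hull K') (hz : 0 < lam K z x) : z ∈ K' := by
  classical
  have hs := M.isSimplex hK
  have hzK : z ∈ K := by
    by_contra h; rw [hs.lam_of_notMem h] at hz; exact lt_irrefl _ hz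
  by_contra h
  have := ((hs.mem_hull_face Finset.inter_subset_left).1 (M.mem_hull_inter hK hK' hx hx')).2 z hzK
    (fun h' => h (Finset.mem_inter.1 h').2)
  rw [this] at hz; exact lt_irrefl _ hz

theorem eq_of_mem_interior {K K' : Finset (E d)} (hK : K ∈ M.elems) (hK' : K' ∈ M.elems) {x : E d}
    (hx : x ∈ interior (hull K)) (hx' : x ∈ hull K') : K = K' := by
  have hs := M.isSimplex hK
  refine Finset.eq_of_subset_of_card_le (fun z hz => ?_)
    (by rw [hs.card, (M.isSimplex hK').card])
  exact M.mem_of_lam_pos hK hK' (interior_subset hx) hx' (hs.mem_interior.1 hx z hz)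

theorem mem_faces {F : Finset (E d)} : F ∈ M.faces ↔ ∃ K ∈ M.elems, F ⊆ K ∧ F.card = d := by
  classical
  simp [faces, Finset.mem_powersetCard]

theorem card_face {F : Finset (E d)} (hF : F ∈ M.faces) : F.card = d := by
  obtain ⟨K, -, -, h⟩ := M.mem_faces.1 hF
  exact h

theorem mem_bdFaces {F : Finset (E d)} : F ∈ M.bdFaces ↔ F ∈ M.faces ∧ hull F ⊆ frontier Ω := by
  classical
  simp [bdFaces]

theorem mem_intFaces {F : Finset (E d)} : F ∈ M.intFaces ↔ F ∈ M.faces ∧ ¬ hull F ⊆ frontier Ω := by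
  classical
  simp [intFaces]

end Mesh

/-! ### Local structure at a face -/

theorem IsSimplex.exists_insert {K F : Finset (E d)} (hK : IsSimplex K) (hF : F ⊆ K)
    (hc : F.card = d) : ∃ a, a ∉ F ∧ K = open Classical in insert a F := by
  classical
  obtain ⟨a, ha⟩ : ∃ a, K \ F = {a} := by
    rw [← Finset.card_eq_one, Finset.card_sdiff_of_subset hF, hK.card, hc]; omega
  have haF : a ∈ K \ F := by rw [ha]; exact Finset.mem_singleton_self a
  refine ⟨a, (Finset.mem_sdiff.1 haF).2, ?_⟩
  rw [← Finset.sdiff_union_of_subset hF, ha]; rfl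

/-- The point `x` lies in the relative interior of the face `F` of `K`. -/
def IsRelInt (K F : Finset (E d)) (x : E d) : Prop := x ∈ hull F ∧ ∀ z ∈ F, 0 < lam K z x

/-- Both coordinates are affine and vanish on the hyperplane of the face, so they are proportional;
evaluation at `a₁` gives the factor. -/
theorem IsSimplex.lam_proportional {K₁ K₂ F : Finset (E d)} (h₁ : IsSimplex K₁) (h₂ : IsSimplex K₂)
    {a₁ a₂ : E d} (ha₁ : a₁ ∉ F) (ha₂ : a₂ ∉ F) (e₁ : K₁ = open Classical in insert a₁ F)
    (e₂ : K₂ = open Classical in insert a₂ F) (y : E d) :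
    lam K₂ a₂ y = lam K₂ a₂ a₁ * lam K₁ a₁ y := by
  classical
  conv_lhs => rw [← h₁.sum_lam_smul y]
  rw [h₂.lam_sum _ _ _ _ (h₁.sum_lam y), e₁, Finset.sum_insert ha₁, ← e₁, mul_comm,
    Finset.sum_eq_zero, add_zero]
  intro z hz
  rw [h₂.lam_vertex (by rw [e₂]; exact Finset.mem_insert_of_mem hz),
    if_neg (ne_of_mem_of_not_mem hz ha₂), mul_zero]

/-- Near a point where the coordinates of the face vertices are positive they remain positive, so
only the sign of the remaining coordinate decides. -/
theorem IsSimplex.eventually_mem_hull {K F : Finset (E d)} (hK : IsSimplex K) {a : E d}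
    (e : K = open Classical in insert a F) {x : E d} (hx : ∀ z ∈ F, 0 < lam K z x) :
    ∀ᶠ y in 𝓝 x, 0 ≤ lam K a y → y ∈ hull K := by
  classical
  have h : ∀ᶠ y in 𝓝 x, ∀ z ∈ F, 0 < lam K z y :=
    (Filter.eventually_all_finset F).2 fun z hz =>
      (isOpen_Ioi.preimage (continuous_lam K z)).mem_nhds (hx z hz)
  filter_upwards [h] with y hy hya
  refine hK.mem_hull.2 fun z hz => ?_
  rw [e, Finset.mem_insert] at hz
  rcases hz with rfl | hz
  · exact hya
  · exact (hy z hz).le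

theorem IsSimplex.exists_relInt_near {K F : Finset (E d)} (hK : IsSimplex K) (hF : F ⊆ K)
    (hne : F.Nonempty) {x : E d} (hx : x ∈ hull F) {U : Set (E d)} (hU : U ∈ 𝓝 x) :
    ∃ y ∈ U, IsRelInt K F y := by
  classical
  let c : E d := ∑ z ∈ F, ((F.card : ℝ))⁻¹ • z
  have hcard : (0 : ℝ) < F.card := by exact_mod_cast hne.card_pos
  have hw : ∑ z ∈ F, ((F.card : ℝ))⁻¹ = 1 := by
    rw [Finset.sum_const, nsmul_eq_mul, mul_inv_cancel₀ hcard.ne']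
  have hc : c ∈ hull F := (convex_convexHull ℝ _).sum_mem (fun z _ => by positivity) hw
    fun z hz => subset_convexHull ℝ _ hz
  have hlamc : ∀ z ∈ F, 0 < lam K z c := by
    intro z hz
    rw [hK.lam_sum z F (fun _ => ((F.card : ℝ))⁻¹) (fun y => y) hw,
      Finset.sum_eq_single z (fun y hy hyz => by rw [hK.lam_vertex (hF hy), if_neg hyz, mul_zero])
      (fun h => absurd hz h), hK.lam_vertex (hF hz)]
    simp only [if_true]
    positivity
  have hlim : Filter.Tendsto (fun t : ℝ => (1 - t) • x + t • c) (𝓝[>] 0) (𝓝 x) := by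
    have : Filter.Tendsto (fun t : ℝ => (1 - t) • x + t • c) (𝓝 0)
        (𝓝 ((1 - (0:ℝ)) • x + (0:ℝ) • c)) := Continuous.tendsto (by fun_prop) 0
    simp only [sub_zero, one_smul, zero_smul, add_zero] at this
    exact this.mono_left nhdsWithin_le_nhds
  obtain ⟨t, htU, ht⟩ := ((hlim.eventually hU).and
    (Ioo_mem_nhdsGT (show (0:ℝ) < 1 by norm_num))).exists
  refine ⟨_, htU, ?_, fun z hz => ?_⟩
  · exact (convex_convexHull ℝ _) hx hc (sub_nonneg.2 ht.2.le) ht.1.le (by ring)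
  · rw [hK.lam_combo _ _ _ _ _ (by ring)]
    have h1 := mul_pos ht.1 (hlamc z hz)
    have h2 := mul_nonneg (sub_nonneg.2 ht.2.le)
      (hK.lam_nonneg ((hK.mem_hull_face hF).1 hx).1 z)
    linarith

theorem IsSimplex.subset_closure_interior {K : Finset (E d)} (hK : IsSimplex K) :
    hull K ⊆ closure (interior (hull K)) := by
  intro x hx
  rw [mem_closure_iff_nhds]
  intro U hU
  obtain ⟨y, hyU, hy⟩ := hK.exists_relInt_near (Finset.Subset.refl K) hK.nonempty hx hU
  exact ⟨y, hyU, hK.mem_interior.2 hy.2⟩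

namespace Mesh

variable {Ω : Set (E d)} (M : Mesh Ω)

theorem isRelInt_of_isRelInt {K K' F : Finset (E d)} (hK : K ∈ M.elems) (hK' : K' ∈ M.elems)
    (hF : F ⊆ K) (hF' : F ⊆ K') {x : E d} (hx : IsRelInt K F x) : IsRelInt K' F x := by
  refine ⟨hx.1, fun z hz => ?_⟩
  have := (M.isSimplex hK).lagrange_continuous le_rfl (M.isSimplex hK') hF hF' z hx.1
  have h2 := hx.2 z hz
  unfold lam at h2 ⊢
  rwa [← this]

theorem subset_of_isRelInt {K K' F : Finset (E d)} (hK : K ∈ M.elems) (hK' : K' ∈ M.elems)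
    (hF : F ⊆ K) {x : E d} (hx : IsRelInt K F x) (hx' : x ∈ hull K') : F ⊆ K' := fun z hz =>
  M.mem_of_lam_pos hK hK' (((M.isSimplex hK).mem_hull_face hF).1 hx.1).1 hx' (hx.2 z hz)

/-- Two different elements that share a face lie on opposite sides of it. -/
theorem union_mem_nhds {K₁ K₂ F : Finset (E d)} (hK₁ : K₁ ∈ M.elems)
    (hK₂ : K₂ ∈ M.elems) (hne : K₁ ≠ K₂) (hF₁ : F ⊆ K₁) (hF₂ : F ⊆ K₂) (hc : F.card = d) {x : E d}
    (hx : IsRelInt K₁ F x) : hull K₁ ∪ hull K₂ ∈ 𝓝 x := by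
  classical
  have h₁ := M.isSimplex hK₁
  have h₂ := M.isSimplex hK₂
  obtain ⟨a₁, ha₁, e₁⟩ := h₁.exists_insert hF₁ hc
  obtain ⟨a₂, ha₂, e₂⟩ := h₂.exists_insert hF₂ hc
  have hx₂ := M.isRelInt_of_isRelInt hK₁ hK₂ hF₁ hF₂ hx
  have hprop := h₁.lam_proportional h₂ ha₁ ha₂ e₁ e₂
  have hev₁ := h₁.eventually_mem_hull e₁ hx.2
  have hev₂ := h₂.eventually_mem_hull e₂ hx₂.2
  have ha₁K : a₁ ∈ K₁ := by rw [e₁]; exact Finset.mem_insert_self _ _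
  -- If both opposite vertices were on the same side, points slightly inside `K₁` near `x` would
  -- also lie in `K₂`, which forces the elements to coincide.
  have hneg : lam K₂ a₂ a₁ < 0 := by
    by_contra! hnn
    apply hne
    have hlim : Filter.Tendsto (fun t : ℝ => (1 - t) • x + t • a₁) (𝓝[>] 0) (𝓝 x) := by
      have : Filter.Tendsto (fun t : ℝ => (1 - t) • x + t • a₁) (𝓝 0)
          (𝓝 ((1 - (0:ℝ)) • x + (0:ℝ) • a₁)) := Continuous.tendsto (by fun_prop) 0
      simp only [sub_zero, one_smul, zero_smul, add_zero] at this
      exact this.mono_left nhdsWithin_le_nhds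
    obtain ⟨t, ht2, ht⟩ := ((hlim.eventually hev₂).and
      (Ioo_mem_nhdsGT (show (0:ℝ) < 1 by norm_num))).exists
    set y := (1 - t) • x + t • a₁
    have hy : y ∈ interior (hull K₁) := by
      refine h₁.mem_interior.2 fun z hz => ?_
      rw [h₁.lam_combo _ _ _ _ _ (by ring), h₁.lam_vertex ha₁K]
      rw [e₁, Finset.mem_insert] at hz
      rcases hz with rfl | hz
      · have := mul_nonneg (sub_nonneg.2 ht.2.le)
          (h₁.lam_nonneg ((h₁.mem_hull_face hF₁).1 hx.1).1 z)
        simp only [if_true]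
        linarith [ht.1]
      · have := mul_pos (sub_pos.2 ht.2) (hx.2 z hz)
        rw [if_neg (ne_of_mem_of_not_mem hz ha₁).symm]
        linarith
    refine M.eq_of_mem_interior hK₁ hK₂ hy (ht2 ?_)
    rw [hprop]
    exact mul_nonneg hnn (h₁.lam_nonneg (interior_subset hy) a₁)
  filter_upwards [hev₁, hev₂] with y hy₁ hy₂
  rcases le_total 0 (lam K₁ a₁ y) with h | h
  · exact Or.inl (hy₁ h)
  · refine Or.inr (hy₂ ?_)
    rw [hprop]
    exact mul_nonneg_of_nonpos_of_nonpos hneg.le h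

variable (hΩ : interior (closure Ω) = Ω)

include hΩ in
theorem interior_hull_subset {K : Finset (E d)} (hK : K ∈ M.elems) : interior (hull K) ⊆ Ω := by
  rw [← hΩ]; exact interior_mono (M.hull_subset_closure hK)

-- Two different elements at `F` would cover a neighbourhood of a relatively interior point, which
-- would then lie in the interior of the closure, hence in `Ω` and not on its boundary.
include hΩ in
theorem eq_of_bdFace (hd : 1 ≤ d) {K₁ K₂ F : Finset (E d)} (hK₁ : K₁ ∈ M.elems)
    (hK₂ : K₂ ∈ M.elems) (hF : F ∈ M.bdFaces) (hF₁ : F ⊆ K₁) (hF₂ : F ⊆ K₂) : K₁ = K₂ := by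
  by_contra hne
  rw [M.mem_bdFaces] at hF
  have hc := M.card_face hF.1
  have hFne : F.Nonempty := by rw [← Finset.card_pos]; omega
  obtain ⟨z, hz⟩ := hFne
  obtain ⟨x, -, hx⟩ := (M.isSimplex hK₁).exists_relInt_near hF₁ ⟨z, hz⟩
    (subset_convexHull ℝ _ hz) Filter.univ_mem
  have h := M.union_mem_nhds hK₁ hK₂ hne hF₁ hF₂ hc hx
  have h2 : x ∈ interior (closure Ω) := mem_interior_iff_mem_nhds.2
    (Filter.mem_of_superset h (Set.union_subset (M.hull_subset_closure hK₁)
      (M.hull_subset_closure hK₂)))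
  have h3 := hF.2 hx.1
  rw [hΩ] at h2
  have ho : IsOpen Ω := by rw [← hΩ]; exact isOpen_interior
  rw [ho.frontier_eq] at h3
  exact h3.2 h2

theorem eventually_mem_of_mem_hull (x : E d) :
    ∀ᶠ y in 𝓝 x, ∀ K ∈ M.elems, y ∈ hull K → x ∈ hull K := by
  rw [Filter.eventually_all_finset]
  intro K hK
  by_cases hx : x ∈ hull K
  · exact .of_forall fun _ _ => hx
  · filter_upwards [(isCompact_hull K).isClosed.isOpen_compl.mem_nhds hx] with y hy h
    exact absurd h hy

theorem eventually_mem_of_mem_face (x : E d) :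
    ∀ᶠ y in 𝓝 x, ∀ F ∈ M.faces, y ∈ hull F → x ∈ hull F := by
  rw [Filter.eventually_all_finset]
  intro K hK
  by_cases hx : x ∈ hull K
  · exact .of_forall fun _ _ => hx
  · filter_upwards [(isCompact_hull K).isClosed.isOpen_compl.mem_nhds hx] with y hy h
    exact absurd h hy

/-- From a relatively interior point of `F` in `Ω`, a small step away from the opposite vertex stays
in `Ω` and makes the coordinate of that vertex negative. It ends in an element other than `K₁`; for
a small step this element contains the starting point, and therefore `F`. -/
theorem exists_neighbour (ho : IsOpen Ω) {K₁ F : Finset (E d)} (hd : 1 ≤ d)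
    (hK₁ : K₁ ∈ M.elems) (hF : F ∈ M.intFaces) (hF₁ : F ⊆ K₁) :
    ∃ K₂ ∈ M.elems, K₁ ≠ K₂ ∧ F ⊆ K₂ := by
  classical
  rw [M.mem_intFaces] at hF
  have hc := M.card_face hF.1
  have hFne : F.Nonempty := by rw [← Finset.card_pos]; omega
  have h₁ := M.isSimplex hK₁
  obtain ⟨y, hyF, hyfr⟩ := Set.not_subset.1 hF.2
  have hyΩ : y ∈ Ω := by
    by_contra h
    refine hyfr ?_
    rw [ho.frontier_eq]
    exact ⟨M.hull_subset_closure hK₁ ((h₁.mem_hull_face hF₁).1 hyF).1, h⟩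
  obtain ⟨x, hxΩ, hx⟩ := h₁.exists_relInt_near hF₁ hFne hyF (ho.mem_nhds hyΩ)
  obtain ⟨a₁, ha₁, e₁⟩ := h₁.exists_insert hF₁ hc
  have ha₁K : a₁ ∈ K₁ := by rw [e₁]; exact Finset.mem_insert_self _ _
  have hlim : Filter.Tendsto (fun t : ℝ => x + (-t) • (a₁ - x)) (𝓝[>] 0) (𝓝 x) := by
    have : Filter.Tendsto (fun t : ℝ => x + (-t) • (a₁ - x)) (𝓝 0) (𝓝 (x + (-(0:ℝ)) • (a₁ - x))) :=
      Continuous.tendsto (by fun_prop) 0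
    simp only [neg_zero, zero_smul, add_zero] at this
    exact this.mono_left nhdsWithin_le_nhds
  obtain ⟨t, ⟨h1, h2⟩, ht⟩ := ((hlim.eventually ((ho.eventually_mem hxΩ).and
    (M.eventually_mem_of_mem_hull x))).and self_mem_nhdsWithin).exists
  have ht : 0 < t := ht
  obtain ⟨K₂, hK₂, hy₂⟩ := M.exists_mem_hull (subset_closure h1)
  refine ⟨K₂, hK₂, ?_, M.subset_of_isRelInt hK₁ hK₂ hF₁ hx (h2 K₂ hK₂ hy₂)⟩
  rintro rfl
  have h3 := h₁.lam_nonneg hy₂ a₁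
  rw [h₁.lam_add_smul_sub, h₁.lam_vertex ha₁K, if_pos rfl,
    ((h₁.mem_hull_face hF₁).1 hx.1).2 a₁ ha₁K ha₁] at h3
  linarith

/-! ### Chains of elements around a point -/

/-- The predicate `P` propagates through interior faces that contain `z`. -/
def Propagates (z : E d) (P : Finset (E d) → Prop) : Prop :=
  ∀ K ∈ M.elems, ∀ K' ∈ M.elems, ∀ F ∈ M.intFaces, F ⊆ K → F ⊆ K' → z ∈ hull F → P K → P K'

/-- At most `d` points span a set of dimension at most `d - 1`. Hence the cone over a (d−2)-face is
a null set. -/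
theorem affineSpan_insert_ne_top {G : Finset (E d)} (hG : G.card + 1 ≤ d) (x : E d) :
    affineSpan ℝ ((open Classical in insert x G : Finset (E d)) : Set (E d)) ≠ ⊤ := by
  classical
  intro h
  have h1 : vectorSpan ℝ ((insert x G : Finset (E d)) : Set (E d)) = ⊤ := by
    rw [← direction_affineSpan, h, AffineSubspace.direction_top]
  have hpos : 0 < (insert x G).card := by simp
  have h2 := finrank_vectorSpan_image_finset_le ℝ (fun y : E d => y) (insert x G)
    (n := (insert x G).card - 1) (by omega)
  have h3 := Finset.card_insert_le x G
  rw [Finset.coe_image, Set.image_id'] at h2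
  rw [h1, finrank_top, finrank_euclideanSpace_fin] at h2
  omega

/-- A face-connected cluster of elements around `z` that does not see the boundary at `z` covers a
neighbourhood of `z`. -/
theorem cluster_mem_nhds (ho : IsOpen Ω) (hd : 1 ≤ d) {z : E d} {P : Finset (E d) → Prop}
    (hP : M.Propagates z P) {K₀ : Finset (E d)} (hK₀ : K₀ ∈ M.elems) (hz : z ∈ hull K₀)
    (hPK₀ : P K₀) (hbd : ∀ K ∈ M.elems, P K → ∀ F ∈ M.bdFaces, F ⊆ K → z ∉ hull F) :
    {x | ∃ K ∈ M.elems, P K ∧ x ∈ hull K} ∈ 𝓝 z := by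
  classical
  -- The ball is so small that only elements and faces containing `z` meet it.
  obtain ⟨ε, hε, hball⟩ := Metric.eventually_nhds_iff_ball.1
    ((M.eventually_mem_of_mem_hull z).and (M.eventually_mem_of_mem_face z))
  set U := Metric.ball z ε
  set A : Set (E d) := {x | ∃ K ∈ M.elems, P K ∧ x ∈ hull K} with hA
  have hAc : IsClosed A := by
    have : A = ⋃ K ∈ M.elems.filter P, hull K := by
      ext x; simp [hA, and_assoc]
    rw [this]
    exact isClosed_biUnion_finset fun K _ => (isCompact_hull K).isClosed
  obtain ⟨x₀, hx₀, hx₀U⟩ : ∃ x₀ ∈ interior (hull K₀), x₀ ∈ U := by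
    have := mem_closure_iff_nhds.1 ((M.isSimplex hK₀).subset_closure_interior hz) U
      (Metric.ball_mem_nhds z hε)
    obtain ⟨x, h1, h2⟩ := this
    exact ⟨x, h2, h1⟩
  -- Affine hulls of `x₀` with the (d−2)-faces. A segment from `x₀` to a point outside this null set
  -- avoids all (d−2)-faces.
  set N : Set (E d) := ⋃ K ∈ M.elems, ⋃ G ∈ K.powersetCard (d - 1),
    (affineSpan ℝ ((insert x₀ G : Finset (E d)) : Set (E d)) : Set (E d)) with hN
  have hN0 : volume N = 0 := by
    rw [hN]
    refine (measure_biUnion_null_iff M.elems.countable_toSet).2 fun K _ => ?_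
    refine (measure_biUnion_null_iff (Finset.countable_toSet _)).2 fun G hG => ?_
    refine Measure.addHaar_affineSubspace _ _ (affineSpan_insert_ne_top ?_ x₀)
    have := (Finset.mem_powersetCard.1 hG).2
    omega
  -- Away from the (d−2)-faces a point of `A` is interior to an element or relatively interior to a
  -- face. That face contains `z` and is not a boundary face, so `P` passes to the element on its
  -- other side.
  have hloc : ∀ x ∈ U, ∀ K ∈ M.elems, P K → x ∈ hull K →
      (∀ G ⊆ K, G.card = d - 1 → x ∉ hull G) → A ∈ 𝓝 x := by
    intro x hxU K hK hPK hxK hG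
    have hs := M.isSimplex hK
    by_cases hint : ∀ w ∈ K, 0 < lam K w x
    · exact Filter.mem_of_superset (mem_interior_iff_mem_nhds.1 (hs.mem_interior.2 hint))
        fun y hy => ⟨K, hK, hPK, hy⟩
    push Not at hint
    obtain ⟨a, ha, ha0⟩ := hint
    have ha0 : lam K a x = 0 := le_antisymm ha0 (hs.lam_nonneg hxK a)
    set F := K.erase a with hFdef
    have hFK : F ⊆ K := Finset.erase_subset _ _
    have hFc : F.card = d := by rw [hFdef, Finset.card_erase_of_mem ha, hs.card]; rfl
    have hxF : x ∈ hull F := (hs.mem_hull_face hFK).2 ⟨hxK, fun w hw hwF => by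
      have : w = a := by
        by_contra h; exact hwF (Finset.mem_erase.2 ⟨h, hw⟩)
      rw [this, ha0]⟩
    have hrel : IsRelInt K F x := by
      refine ⟨hxF, fun w hw => lt_of_le_of_ne (hs.lam_nonneg hxK w) fun h0 => ?_⟩
      have hwK := hFK hw
      refine hG (F.erase w) ((Finset.erase_subset _ _).trans hFK)
        (by rw [Finset.card_erase_of_mem hw, hFc]) ?_
      refine (hs.mem_hull_face ((Finset.erase_subset _ _).trans hFK)).2 ⟨hxK, fun u hu huG => ?_⟩
      by_cases h1 : u = w
      · rw [h1, ← h0]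
      by_cases h2 : u = a
      · rw [h2, ha0]
      exact absurd (Finset.mem_erase.2 ⟨h1, Finset.mem_erase.2 ⟨h2, hu⟩⟩) huG
    have hFf : F ∈ M.faces := M.mem_faces.2 ⟨K, hK, hFK, hFc⟩
    have hzF : z ∈ hull F := (hball x hxU).2 F hFf hxF
    have hFi : F ∈ M.intFaces := by
      by_contra h
      rw [M.mem_intFaces] at h
      have : F ∈ M.bdFaces := M.mem_bdFaces.2 ⟨hFf, by
        by_contra h'; exact h ⟨hFf, h'⟩⟩
      exact hbd K hK hPK F this hFK hzF
    obtain ⟨K₂, hK₂, hne, hF₂⟩ := M.exists_neighbour ho hd hK hFi hFK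
    have hP₂ := hP K hK K₂ hK₂ F hFi hFK hF₂ hzF hPK
    refine Filter.mem_of_superset (M.union_mem_nhds hK hK₂ hne hFK hF₂ hFc hrel) ?_
    rintro y (hy | hy)
    · exact ⟨K, hK, hPK, hy⟩
    · exact ⟨K₂, hK₂, hP₂, hy⟩
  -- Continuity induction along the segment from `x₀` to `y`: its part in `A` is closed, and open to
  -- the right by `hloc`.
  have hgood : ∀ y ∈ U, y ∉ N → y ∈ A := by
    intro y hyU hyN
    let γ : ℝ → E d := fun t => (1 - t) • x₀ + t • y
    have hγc : Continuous γ := by fun_prop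
    have hsub : Set.Icc (0:ℝ) 1 ⊆ γ ⁻¹' A := by
      refine IsClosed.Icc_subset_of_forall_mem_nhdsWithin
        ((hAc.preimage hγc).inter isClosed_Icc) ?_ ?_
      · exact ⟨K₀, hK₀, hPK₀, by simpa [γ] using interior_subset hx₀⟩
      · rintro t ⟨⟨K, hK, hPK, hxK⟩, ht0, ht1⟩
        refine mem_nhdsWithin_of_mem_nhds (hγc.continuousAt ?_)
        refine hloc (γ t) ?_ K hK hPK hxK ?_
        · exact (convex_ball z ε) hx₀U hyU (by linarith) ht0 (by ring)
        · intro G hGK hGc hxG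
          rcases ht0.eq_or_lt with rfl | ht0
          · have hx0 : γ 0 = x₀ := by simp [γ]
            rw [hx0] at hxK hxG
            have hKK := M.eq_of_mem_interior hK₀ hK hx₀ hxK
            subst hKK
            have hs := M.isSimplex hK₀
            obtain ⟨w, hw, hwG⟩ : ∃ w ∈ K₀, w ∉ G := by
              by_contra! h
              have := Finset.card_le_card h
              rw [hs.card, hGc] at this; omega
            have h1 := hs.mem_interior.1 hx₀ w hw
            rw [((hs.mem_hull_face hGK).1 hxG).2 w hw hwG] at h1
            exact lt_irrefl _ h1
          · apply hyN
            simp only [hN, Set.mem_iUnion]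
            refine ⟨K, hK, G, Finset.mem_powersetCard.2 ⟨hGK, hGc⟩, ?_⟩
            set Q := affineSpan ℝ ((insert x₀ G : Finset (E d)) : Set (E d))
            have h1 : x₀ ∈ Q := subset_affineSpan ℝ _ (by simp)
            have h2 : γ t ∈ Q := by
              have h3 : hull G ⊆ (affineSpan ℝ (G : Set (E d)) : Set (E d)) :=
                convexHull_subset_affineSpan _
              refine affineSpan_mono ℝ ?_ (h3 hxG)
              simp
            have h4 : y = AffineMap.lineMap x₀ (γ t) t⁻¹ := by
              rw [AffineMap.lineMap_apply_module]
              simp only [γ, smul_add, smul_smul]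
              rw [inv_mul_cancel₀ ht0.ne', ← add_assoc, ← add_smul]
              have : 1 - t⁻¹ + t⁻¹ * (1 - t) = 0 := by field_simp; ring
              rw [this]; simp
            rw [h4]
            exact AffineMap.lineMap_mem _ h1 h2
    have := hsub (Set.right_mem_Icc.2 zero_le_one)
    simpa [γ] using this
  refine Filter.mem_of_superset (Metric.ball_mem_nhds z hε) fun y hyU => ?_
  by_contra hyA
  -- What is left of the ball is open and contained in a null set, hence empty.
  have hV : IsOpen (U ∩ Aᶜ) := Metric.isOpen_ball.inter hAc.isOpen_compl
  have hVN : U ∩ Aᶜ ⊆ N := fun x hx => by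
    by_contra h; exact hx.2 (hgood x hx.1 h)
  have h1 := hV.measure_pos volume ⟨y, hyU, hyA⟩
  exact absurd (measure_mono_null hVN hN0) h1.ne'

/-- No boundary face contains a point of `Ω`, so the cluster of elements with `P` is a neighbourhood
of `z` and meets the interior of `K'`. -/
theorem propagate_interior (ho : IsOpen Ω) (hd : 1 ≤ d) {z : E d} (hzΩ : z ∈ Ω)
    {P : Finset (E d) → Prop} (hP : M.Propagates z P) {K K' : Finset (E d)} (hK : K ∈ M.elems)
    (hK' : K' ∈ M.elems) (hz : z ∈ hull K) (hz' : z ∈ hull K') (hPK : P K) : P K' := by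
  have h := M.cluster_mem_nhds ho hd hP hK hz hPK fun K _ _ F hF _ hzF => by
    have := (M.mem_bdFaces.1 hF).2 hzF
    rw [ho.frontier_eq] at this
    exact this.2 hzΩ
  obtain ⟨x, ⟨K₁, hK₁, hP₁, hx₁⟩, hx⟩ :=
    mem_closure_iff_nhds.1 ((M.isSimplex hK').subset_closure_interior hz') _ h
  rwa [M.eq_of_mem_interior hK' hK₁ hx hx₁]

-- Otherwise the cluster would be a neighbourhood of `z` inside the closure of `Ω`, and `z` would
-- belong to `Ω`.
include hΩ in
theorem propagate_boundary (ho : IsOpen Ω) (hd : 1 ≤ d) {z : E d} (hzΩ : z ∉ Ω)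
    {P : Finset (E d) → Prop} (hP : M.Propagates z P) {K : Finset (E d)} (hK : K ∈ M.elems)
    (hz : z ∈ hull K) (hPK : P K) :
    ∃ K' ∈ M.elems, P K' ∧ ∃ F ∈ M.bdFaces, F ⊆ K' ∧ z ∈ hull F := by
  by_contra! hcon
  have h := M.cluster_mem_nhds ho hd hP hK hz hPK fun K hK hPK F hF hFK =>
    hcon K hK hPK F hF hFK
  apply hzΩ
  rw [← hΩ]
  refine mem_interior_iff_mem_nhds.2 (Filter.mem_of_superset h ?_)
  rintro x ⟨K', hK', -, hx⟩
  exact M.hull_subset_closure hK' hx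

/-- If no boundary face were reached, the union of the elements with `P` would be compact, open and
nonempty, hence the whole space, which is not compact. -/
theorem propagate_global (ho : IsOpen Ω) (hd : 1 ≤ d) {P : Finset (E d) → Prop}
    (hP : ∀ z, M.Propagates z P) {K : Finset (E d)} (hK : K ∈ M.elems) (hPK : P K) :
    ∃ K' ∈ M.elems, P K' ∧ ∃ F ∈ M.bdFaces, F ⊆ K' := by
  classical
  by_contra! hcon
  set A : Set (E d) := {x | ∃ K ∈ M.elems, P K ∧ x ∈ hull K} with hA
  have hAc : IsCompact A := by
    have : A = ⋃ K ∈ M.elems.filter P, hull K := by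
      ext x; simp [hA, and_assoc]
    rw [this]
    exact (M.elems.filter P).isCompact_biUnion fun K _ => isCompact_hull K
  have hAo : IsOpen A := by
    rw [isOpen_iff_mem_nhds]
    rintro x ⟨K', hK', hPK', hx⟩
    exact M.cluster_mem_nhds ho hd (hP x) hK' hx hPK' fun K hK hPK F hF hFK =>
      absurd hFK (hcon K hK hPK F hF)
  obtain ⟨a, ha⟩ := (M.isSimplex hK).nonempty
  have hne : A.Nonempty := ⟨a, K, hK, hPK, subset_convexHull ℝ _ ha⟩
  have huniv : A = Set.univ := IsClopen.eq_univ ⟨hAc.isClosed, hAo⟩ hne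
  rw [huniv] at hAc
  have : Nontrivial (E d) := by
    have : Nonempty (Fin d) := ⟨⟨0, by omega⟩⟩
    infer_instance
  exact noncompact_univ (E d) hAc

end Mesh

end FEM

/-! ### Weak gradients and piecewise gradients. -/

namespace FEM

variable {d : ℕ}

/-! ### Weak gradients -/

theorem inner_gradient (φ : E d → ℝ) (x e : E d) :
    inner ℝ (gradient φ x) e = fderiv ℝ φ x e := by
  rw [gradient, InnerProductSpace.toDual_symm_apply]

theorem inner_gradient_right (φ : E d → ℝ) (x e : E d) :
    inner ℝ e (gradient φ x) = fderiv ℝ φ x e := by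
  rw [real_inner_comm, inner_gradient]

theorem continuous_gradient {φ : E d → ℝ} (hφ : ContDiff ℝ ∞ φ) : Continuous (gradient φ) :=
  (InnerProductSpace.toDual ℝ (E d)).symm.continuous.comp (hφ.continuous_fderiv (by simp))

theorem gradient_eq_zero_of_notMem {φ : E d → ℝ} {x : E d} (hx : x ∉ tsupport φ) :
    gradient φ x = 0 := by
  have : fderiv ℝ φ x = 0 := by
    by_contra h
    exact hx (support_fderiv_subset ℝ h)
  rw [gradient, this, map_zero]

theorem hasCompactSupport_gradient {φ : E d → ℝ} (hφ : HasCompactSupport φ) :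
    HasCompactSupport (gradient φ) :=
  HasCompactSupport.intro hφ fun _ hx => gradient_eq_zero_of_notMem hx

/-- Integration by parts on the whole space. -/
theorem integral_mul_fderiv_eq_neg {φ ψ : E d → ℝ} (hφ : ContDiff ℝ 1 φ) (hψ : ContDiff ℝ 1 ψ)
    (hs : HasCompactSupport ψ) (e : E d) :
    ∫ x, φ x * fderiv ℝ ψ x e = - ∫ x, ψ x * fderiv ℝ φ x e := by
  have hc : ∀ {f : E d → ℝ}, ContDiff ℝ 1 f → Continuous fun x => fderiv ℝ f x e :=
    fun hf => (hf.continuous_fderiv one_ne_zero).clm_apply continuous_const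
  have h := integral_mul_fderiv_eq_neg_fderiv_mul_of_integrable (μ := (volume : Measure (E d)))
    (f := φ) (g := ψ) (v := e)
    (((hc hφ).mul hψ.continuous).integrable_of_hasCompactSupport hs.mul_left)
    ((hφ.continuous.mul (hc hψ)).integrable_of_hasCompactSupport (hs.fderiv_apply ℝ e).mul_left)
    ((hφ.continuous.mul hψ.continuous).integrable_of_hasCompactSupport hs.mul_left)
    (fun x _ => hφ.differentiable one_ne_zero x) (fun x _ => hψ.differentiable one_ne_zero x)
  rw [h]
  simp only [mul_comm]

theorem integrable_smul_of_hasCompactSupport {F : Type*} [NormedAddCommGroup F] [NormedSpace ℝ F]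
    {μ : Measure (E d)} {φ : E d → ℝ} {g : E d → F} (hφ : Continuous φ) (hs : HasCompactSupport φ)
    (hg : Integrable g μ) : Integrable (fun x => φ x • g x) μ := by
  obtain ⟨B, hB⟩ := hs.exists_bound_of_continuous hφ
  exact hg.bdd_smul B hφ.aestronglyMeasurable (Filter.Eventually.of_forall hB)

theorem integrable_smul_gradient {μ : Measure (E d)} {φ : E d → ℝ} {w : E d → ℝ}
    (hφ : ContDiff ℝ ∞ φ) (hs : HasCompactSupport φ) (hw : Integrable w μ) :
    Integrable (fun x => w x • gradient φ x) μ := by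
  obtain ⟨B, hB⟩ := (hasCompactSupport_gradient hs).exists_bound_of_continuous
    (continuous_gradient hφ)
  exact hw.smul_bdd B (continuous_gradient hφ).aestronglyMeasurable
    (Filter.Eventually.of_forall hB)

/-- The vector identity that defines weak gradients, in coordinate-free scalar form. -/
theorem integral_smul_gradient_eq_iff {μ : Measure (E d)} {φ : E d → ℝ} {w : E d → ℝ}
    {g : E d → E d} (hφ : ContDiff ℝ ∞ φ) (hs : HasCompactSupport φ) (hw : Integrable w μ)
    (hg : Integrable g μ) :
    ∫ x, w x • gradient φ x ∂μ = - ∫ x, φ x • g x ∂μ ↔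
      ∀ e : E d, ∫ x, w x * fderiv ℝ φ x e ∂μ = - ∫ x, φ x * inner ℝ (g x) e ∂μ := by
  have h1 : ∀ e : E d, ∫ x, w x * fderiv ℝ φ x e ∂μ
      = inner ℝ e (∫ x, w x • gradient φ x ∂μ) := fun e => by
    rw [← integral_inner (integrable_smul_gradient hφ hs hw)]
    simp only [inner_smul_right, inner_gradient_right]
  have h2 : ∀ e : E d, ∫ x, φ x * inner ℝ (g x) e ∂μ = inner ℝ e (∫ x, φ x • g x ∂μ) :=
    fun e => by
    rw [← integral_inner (integrable_smul_of_hasCompactSupport hφ.continuous hs hg)]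
    simp only [inner_smul_right, real_inner_comm]
  simp only [h1, h2, ← inner_neg_right]
  exact ⟨fun h e => by rw [h], fun h => ext_inner_left ℝ h⟩

theorem integrable_of_L2 {Ω : Set (E d)} (hb : Bornology.IsBounded Ω) {F : Type*}
    [NormedAddCommGroup F] (w : Lp F 2 (volume.restrict Ω)) : IntegrableOn w Ω := by
  have : IsFiniteMeasure (volume.restrict Ω) := ⟨by
    rw [Measure.restrict_apply_univ]
    exact hb.measure_lt_top⟩
  exact (Lp.memLp w).integrable one_le_two

/-- A function in `H^1_0(Ω)`, extended by zero, has a weak gradient on the whole space. -/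
theorem exists_gradient_of_mem_H10 {Ω : Set (E d)} {w : L2 Ω} (hw : w ∈ H10 Ω) :
    ∃ g : L2Vec Ω, ∀ ψ : E d → ℝ, ContDiff ℝ ∞ ψ → HasCompactSupport ψ → ∀ e : E d,
      ∫ x in Ω, w x * fderiv ℝ ψ x e = - ∫ x in Ω, ψ x * inner ℝ (g x) e := by
  obtain ⟨⟨w', g⟩, hD, rfl⟩ := hw
  refine ⟨g, fun ψ hψ hs e => ?_⟩
  have hm1 : MemLp (fun x => fderiv ℝ ψ x e) 2 (volume.restrict Ω) :=
    (((hψ.continuous_fderiv (by simp)).clm_apply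
      continuous_const).memLp_of_hasCompactSupport (hs.fderiv_apply ℝ e))
  have hm2 : MemLp (fun x => ψ x • e) 2 (volume.restrict Ω) :=
    (hψ.continuous.smul continuous_const).memLp_of_hasCompactSupport hs.smul_right
  let f : L2 Ω × L2Vec Ω →L[ℝ] ℝ :=
    (innerSL ℝ (hm1.toLp)).comp (ContinuousLinearMap.fst ℝ _ _) +
      (innerSL ℝ (hm2.toLp)).comp (ContinuousLinearMap.snd ℝ _ _)
  have hf : ∀ (w : L2 Ω) (g : L2Vec Ω), f (w, g) = (∫ x in Ω, w x * fderiv ℝ ψ x e) +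
      ∫ x in Ω, ψ x * inner ℝ (g x) e := fun w g => by
    change inner ℝ hm1.toLp w + inner ℝ hm2.toLp g = _
    rw [L2.inner_def, L2.inner_def]
    congr 1
    · refine integral_congr_ae ?_
      filter_upwards [hm1.coeFn_toLp] with x hx
      simp [hx]
    · refine integral_congr_ae ?_
      filter_upwards [hm2.coeFn_toLp] with x hx
      simp only [hx]
      rw [real_inner_smul_left, real_inner_comm]
  -- The identity says that the continuous functional `f` vanishes. It does so on pairs `(φ, ∇φ)` of
  -- test functions, where no support condition on `ψ` is needed, and thus on the closure of their
  -- span.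
  have key : (w', g) ∈ LinearMap.ker f.toLinearMap := by
    refine Submodule.topologicalClosure_minimal _ (Submodule.span_le.2 ?_) f.isClosed_ker hD
    rintro ⟨u, k⟩ ⟨φ, ⟨hφ, hφs, hφΩ⟩, hu, hk⟩
    change f (u, k) = 0
    rw [hf]
    have e1 : ∫ x in Ω, u x * fderiv ℝ ψ x e = ∫ x, φ x * fderiv ℝ ψ x e := by
      rw [← setIntegral_eq_integral_of_forall_compl_eq_zero (s := Ω)
        (f := fun x => φ x * fderiv ℝ ψ x e)]
      · refine integral_congr_ae ?_
        filter_upwards [hu] with x hx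
        rw [hx]
      · intro x hx
        rw [image_eq_zero_of_notMem_tsupport fun h => hx (hφΩ h), zero_mul]
    have e2 : ∫ x in Ω, ψ x * inner ℝ (k x) e = ∫ x, ψ x * fderiv ℝ φ x e := by
      rw [← setIntegral_eq_integral_of_forall_compl_eq_zero (s := Ω)
        (f := fun x => ψ x * fderiv ℝ φ x e)]
      · refine integral_congr_ae ?_
        filter_upwards [hk] with x hx
        rw [hx, inner_gradient]
      · intro x hx
        rw [← inner_gradient, gradient_eq_zero_of_notMem fun h => hx (hφΩ h), inner_zero_left,
          mul_zero]
    rw [e1, e2, integral_mul_fderiv_eq_neg (hφ.of_le (by simp)) (hψ.of_le (by simp)) hs]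
    simp
  have := hf w' g
  rw [show f (w', g) = 0 from key] at this
  simpa using eq_neg_of_add_eq_zero_left this.symm

theorem hasWeakGradientOn_ev (U : Set (E d)) (q : Poly d) :
    HasWeakGradientOn U (ev q) (gradPoly q) := by
  rintro φ ⟨hφ, hs, hsU⟩
  have h0 : ∀ x ∉ U, ev q x • gradient φ x = 0 := fun x hx => by
    rw [gradient_eq_zero_of_notMem fun h => hx (hsU h), smul_zero]
  have h1 : ∀ x ∉ U, φ x • gradPoly q x = 0 := fun x hx => by
    rw [image_eq_zero_of_notMem_tsupport fun h => hx (hsU h), zero_smul]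
  rw [setIntegral_eq_integral_of_forall_compl_eq_zero h0,
    setIntegral_eq_integral_of_forall_compl_eq_zero h1]
  refine ext_inner_left ℝ fun e => ?_
  rw [inner_neg_right, ← integral_inner, ← integral_inner]
  · have := integral_mul_fderiv_eq_neg ((contDiff_ev q).of_le (by simp)) (hφ.of_le (by simp)) hs e
    simp only [(hasFDerivAt_ev q _).fderiv, innerSL_apply_apply, real_inner_comm e] at this
    simpa only [inner_smul_right, inner_gradient_right] using this
  · exact (hφ.continuous.smul (continuous_gradPoly q)).integrable_of_hasCompactSupport
      hs.smul_right
  · exact ((continuous_ev q).smul (continuous_gradient hφ)).integrable_of_hasCompactSupport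
      (hasCompactSupport_gradient hs).smul_left

theorem HasWeakGradientOn.congr {U : Set (E d)} {w w' : E d → ℝ} {g g' : E d → E d}
    (h : HasWeakGradientOn U w g) (hw : w =ᵐ[volume.restrict U] w')
    (hg : g =ᵐ[volume.restrict U] g') : HasWeakGradientOn U w' g' := by
  intro φ hφ
  have e1 : ∫ x in U, w x • gradient φ x = ∫ x in U, w' x • gradient φ x :=
    integral_congr_ae (by filter_upwards [hw] with x hx; rw [hx])
  have e2 : ∫ x in U, φ x • g x = ∫ x in U, φ x • g' x :=
    integral_congr_ae (by filter_upwards [hg] with x hx; rw [hx])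
  rw [← e1, ← e2, h φ hφ]

theorem HasWeakGradientOn.add {U : Set (E d)} {w w' : E d → ℝ} {g g' : E d → E d}
    (h : HasWeakGradientOn U w g) (h' : HasWeakGradientOn U w' g')
    (hw : IntegrableOn w U) (hw' : IntegrableOn w' U) (hg : IntegrableOn g U)
    (hg' : IntegrableOn g' U) :
    HasWeakGradientOn U (fun x => w x + w' x) (fun x => g x + g' x) := by
  intro φ hφ
  simp only [add_smul, smul_add]
  rw [integral_add (integrable_smul_gradient hφ.1 hφ.2.1 hw)
      (integrable_smul_gradient hφ.1 hφ.2.1 hw'),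
    integral_add (integrable_smul_of_hasCompactSupport hφ.1.continuous hφ.2.1 hg)
      (integrable_smul_of_hasCompactSupport hφ.1.continuous hφ.2.1 hg'), h φ hφ, h' φ hφ,
    neg_add]

theorem HasWeakGradientOn.const_smul {U : Set (E d)} {w : E d → ℝ} {g : E d → E d}
    (h : HasWeakGradientOn U w g) (c : ℝ) :
    HasWeakGradientOn U (fun x => c * w x) (fun x => c • g x) := by
  intro φ hφ
  simp only [mul_smul, smul_comm _ c]
  rw [integral_smul, integral_smul, h φ hφ, smul_neg]

theorem HasWeakGradientOn.ae_eq {U : Set (E d)} (hU : IsOpen U) {w : E d → ℝ} {g g' : E d → E d}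
    (h : HasWeakGradientOn U w g) (h' : HasWeakGradientOn U w g')
    (hg : IntegrableOn g U) (hg' : IntegrableOn g' U) : g =ᵐ[volume.restrict U] g' := by
  have := hU.ae_eq_zero_of_integral_contDiff_smul_eq_zero (μ := volume)
    (f := fun x => g x - g' x) ((hg.sub hg').locallyIntegrableOn) fun φ hφ hs hsU => by
      rw [← setIntegral_eq_integral_of_forall_compl_eq_zero (s := U)]
      · simp only [smul_sub]
        rw [integral_sub (integrable_smul_of_hasCompactSupport hφ.continuous hs hg)
          (integrable_smul_of_hasCompactSupport hφ.continuous hs hg')]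
        have h1 := h φ ⟨hφ, hs, hsU⟩
        rw [h' φ ⟨hφ, hs, hsU⟩] at h1
        rw [neg_inj.1 h1, sub_self]
      · intro x hx
        rw [image_eq_zero_of_notMem_tsupport fun h => hx (hsU h), zero_smul]
  rw [Filter.EventuallyEq, ae_restrict_iff' hU.measurableSet]
  filter_upwards [this] with x hx hxU
  exact sub_eq_zero.1 (hx hxU)

/-- A function with vanishing weak gradient on a convex open set is constant. -/
theorem HasWeakGradientOn.ae_const {U : Set (E d)} (hU : IsOpen U) (hc : Convex ℝ U)
    {w : E d → ℝ} (hw : IntegrableOn w U) (h : HasWeakGradientOn U w 0) :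
    ∃ c : ℝ, w =ᵐ[volume.restrict U] fun _ => c := by
  let f : E d → ℝ := U.indicator w
  have hf : Integrable f := (integrable_indicator_iff hU.measurableSet).2 hw
  let φ : ℕ → ContDiffBump (0 : E d) := fun n =>
    ⟨1 / ((n : ℝ) + 1) / 2, 1 / ((n : ℝ) + 1), by positivity, half_lt_self (by positivity)⟩
  have hφ0 : Filter.Tendsto (fun n => (φ n).rOut) Filter.atTop (𝓝 0) :=
    tendsto_one_div_add_atTop_nhds_zero_nat
  have hlim := ContDiffBump.ae_convolution_tendsto_right_of_locallyIntegrable (μ := volume)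
    (K := 2) (g := f) hφ0 (Filter.Eventually.of_forall fun n => by simp [φ]; linarith)
    hf.locallyIntegrable
  -- The derivative of the mollification at `x` is, up to sign, the integral of `w` against a
  -- derivative of a translated mollifier, which is a test function in `U`.
  have hder : ∀ n x, Metric.closedBall x (φ n).rOut ⊆ U →
      HasFDerivAt (convolution ((φ n).normed volume) f (ContinuousLinearMap.lsmul ℝ ℝ) volume)
        (0 : E d →L[ℝ] ℝ) x := by
    intro n x hx
    have hcs := (φ n).hasCompactSupport_normed (μ := volume)
    have hcd : ContDiff ℝ ∞ ((φ n).normed volume) := (φ n).contDiff_normed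
    have h1 := hcs.hasFDerivAt_convolution_left
      (ContinuousLinearMap.lsmul ℝ ℝ) (hcd.of_le (by simp)) hf.locallyIntegrable x
    refine h1.congr_fderiv (ContinuousLinearMap.ext fun e => ?_)
    have hint := ((hcs.fderiv ℝ).convolutionExists_left
      (ContinuousLinearMap.precompL (E d)
        (ContinuousLinearMap.lsmul ℝ ℝ : ℝ →L[ℝ] ℝ →L[ℝ] ℝ))
      (hcd.continuous_fderiv (by simp)) hf.locallyIntegrable x).integrable_swap
    rw [convolution_eq_swap, ContinuousLinearMap.integral_apply hint]
    symm
    have htest : IsTest U fun y => (φ n).normed volume (x - y) := by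
      refine ⟨hcd.comp (contDiff_const.sub contDiff_id),
        hcs.comp_homeomorph (Homeomorph.subLeft x), ?_⟩
      refine subset_trans (closure_minimal (fun y hy => ?_) Metric.isClosed_closedBall) hx
      have : x - y ∈ Function.support ((φ n).normed volume) := hy
      rw [ContDiffBump.support_normed_eq, Metric.mem_ball, dist_zero_right] at this
      rw [Metric.mem_closedBall, dist_comm, dist_eq_norm]
      exact this.le
    have h2 := (integral_smul_gradient_eq_iff htest.1 htest.2.1 hw
      (integrable_zero _ _ _)).1 (h _ htest) e
    simp only [Pi.zero_apply, inner_zero_left, mul_zero, integral_zero, neg_zero] at h2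
    rw [← integral_indicator hU.measurableSet] at h2
    rw [zero_apply, ← neg_eq_zero.2 h2, ← integral_neg]
    refine integral_congr_ae (Filter.Eventually.of_forall fun y => ?_)
    have hd : fderiv ℝ (fun y => (φ n).normed volume (x - y)) y e
        = - fderiv ℝ ((φ n).normed volume) (x - y) e := by
      have hc := (hcd.differentiable (by simp) (x - y)).hasFDerivAt.comp y
        ((hasFDerivAt_const x y).sub (hasFDerivAt_id y))
      rw [HasFDerivAt.fderiv (f := fun y => (φ n).normed volume (x - y)) hc]
      simp
    by_cases hy : y ∈ U
    · simp [f, hy, hd, ContinuousLinearMap.precompL_apply, mul_comm]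
    · simp [f, hy]
  -- The segment between two points is compact in the convex set `U`, so mollifications with a small
  -- radius are constant along it.
  have hconst : ∀ x ∈ U, ∀ y ∈ U, ∀ᶠ n in Filter.atTop,
      convolution ((φ n).normed volume) f (ContinuousLinearMap.lsmul ℝ ℝ) volume x =
      convolution ((φ n).normed volume) f (ContinuousLinearMap.lsmul ℝ ℝ) volume y := by
    intro x hx y hy
    have hseg : IsCompact (segment ℝ x y) := by
      rw [← convexHull_pair]
      exact (Set.toFinite {x, y}).isCompact_convexHull (𝕜 := ℝ)
    obtain ⟨δ, hδ, hδU⟩ := hseg.exists_cthickening_subset_open hU (hc.segment_subset hx hy)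
    filter_upwards [hφ0.eventually (gt_mem_nhds hδ)] with n hn
    have := (convex_segment (𝕜 := ℝ) x y).norm_image_sub_le_of_norm_hasFDerivWithin_le (C := 0)
      (f' := fun _ => 0) (fun z hz => (hder n z fun t ht => hδU
        (Metric.mem_cthickening_of_dist_le t z δ _ hz
          ((Metric.mem_closedBall.1 ht).trans hn.le))).hasFDerivWithinAt)
      (fun _ _ => by simp) (right_mem_segment ℝ x y) (left_mem_segment ℝ x y)
    rw [zero_mul, norm_le_zero_iff, sub_eq_zero] at this
    exact this
  rcases U.eq_empty_or_nonempty with rfl | hne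
  · exact ⟨0, by simp [Filter.EventuallyEq]⟩
  have hpos : volume U ≠ 0 := (hU.measure_pos _ hne).ne'
  have hex : ∃ y ∈ U, Filter.Tendsto (fun n => convolution ((φ n).normed volume) f
      (ContinuousLinearMap.lsmul ℝ ℝ) volume y) Filter.atTop (𝓝 (f y)) := by
    by_contra hcon
    push Not at hcon
    refine hpos (measure_mono_null (fun y hy => ?_) hlim)
    exact hcon y hy
  obtain ⟨y, hyU, hy⟩ := hex
  refine ⟨f y, ?_⟩
  rw [Filter.EventuallyEq, ae_restrict_iff' hU.measurableSet]
  filter_upwards [hlim] with x hx hxU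
  have : f x = f y := tendsto_nhds_unique hx
    (hy.congr' (by filter_upwards [hconst x hxU y hyU] with n hn using hn.symm))
  rw [← this]
  simp [f, hxU]

/-! ### Piecewise polynomials and their piecewise gradients -/

/-- A bounded open set that is the interior of its closure. -/
structure IsRegularDomain (Ω : Set (E d)) : Prop where
  isOpen : IsOpen Ω
  isBounded : Bornology.IsBounded Ω
  interior_closure : interior (closure Ω) = Ω

theorem convex_hull' (K : Finset (E d)) : Convex ℝ (hull K) := convex_convexHull ℝ _

theorem hull_ae_eq (K : Finset (E d)) : (interior (hull K) : Set (E d)) =ᵐ[volume] hull K := by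
  refine Filter.EventuallyLE.antisymm interior_subset.eventuallyLE ?_
  refine ae_le_set.2 (measure_mono_null ?_ ((convex_hull' K).addHaar_frontier volume))
  exact fun x hx => ⟨subset_closure hx.1, hx.2⟩

theorem setIntegral_hull {F : Type*} [NormedAddCommGroup F] [NormedSpace ℝ F]
    (K : Finset (E d)) (f : E d → F) : ∫ x in hull K, f x = ∫ x in interior (hull K), f x :=
  setIntegral_congr_set (hull_ae_eq K).symm

theorem integrableOn_hull {F : Type*} [NormedAddCommGroup F] (K : Finset (E d)) {f : E d → F}
    (hf : Continuous f) : IntegrableOn f (interior (hull K)) :=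
  (hf.continuousOn.integrableOn_compact (isCompact_hull K)).mono_set interior_subset

theorem eq_of_ev_ae_eq {U : Set (E d)} (hU : IsOpen U) (hne : U.Nonempty) {q r : Poly d}
    (h : ev q =ᵐ[volume.restrict U] ev r) : q = r := by
  refine eq_of_ev_eq_on_open hU hne ?_
  exact Measure.eqOn_open_of_ae_eq h hU (continuous_ev q).continuousOn (continuous_ev r).continuousOn

namespace Mesh

variable {Ω : Set (E d)} (M : Mesh Ω)

theorem ae_mem_interior : ∀ᵐ x ∂volume.restrict Ω, ∃ K ∈ M.elems, x ∈ interior (hull K) := by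
  have h : ∀ᵐ x ∂volume, ∀ K ∈ M.elems, x ∈ hull K → x ∈ interior (hull K) := by
    rw [Filter.eventually_all_finset]
    intro K _
    filter_upwards [hull_ae_eq K] with x hx hxK
    exact hx.mpr hxK
  rcases M.elems.eq_empty_or_nonempty with he | _
  · have : Ω = ∅ := by
      refine Set.subset_empty_iff.1 (subset_closure.trans ?_)
      rw [M.closure_eq, he]
      simp
    simp [this]
  have hΩ : ∀ᵐ x ∂volume.restrict Ω, x ∈ closure Ω :=
    ae_mono (Measure.restrict_mono_set _ subset_closure)
      (ae_restrict_mem isClosed_closure.measurableSet)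
  filter_upwards [ae_restrict_of_ae h, hΩ] with x hx hxΩ
  obtain ⟨K, hK, hxK⟩ := M.exists_mem_hull hxΩ
  exact ⟨K, hK, hx K hK hxK⟩

variable {M}

theorem inter_hull_ae_eq (hΩ : IsRegularDomain Ω) {K : Finset (E d)} (hK : K ∈ M.elems) :
    (Ω ∩ hull K : Set (E d)) =ᵐ[volume] interior (hull K) := by
  refine Filter.EventuallyLE.antisymm ?_ ?_
  · exact (Set.inter_subset_right.eventuallyLE).trans (hull_ae_eq K).symm.le
  · exact Set.subset_inter (M.interior_hull_subset hΩ.interior_closure hK)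
      interior_subset |>.eventuallyLE

theorem isPiece_iff (hΩ : IsRegularDomain Ω) {K : Finset (E d)} (hK : K ∈ M.elems) {s : L2 Ω}
    {q : Poly d} : IsPiece s K q ↔ (s : E d → ℝ) =ᵐ[volume.restrict (interior (hull K))] ev q := by
  rw [IsPiece, Measure.restrict_congr_set (inter_hull_ae_eq hΩ hK)]

theorem ae_restrict_interior (hΩ : IsRegularDomain Ω) {K : Finset (E d)} (hK : K ∈ M.elems)
    {P : E d → Prop} (h : ∀ᵐ x ∂volume.restrict Ω, P x) :
    ∀ᵐ x ∂volume.restrict (interior (hull K)), P x :=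
  ae_restrict_of_ae_restrict_of_subset (M.interior_hull_subset hΩ.interior_closure hK) h

variable (M) in
theorem ae_of_ae_interior {P : E d → Prop}
    (h : ∀ K ∈ M.elems, ∀ᵐ x ∂volume.restrict (interior (hull K)), P x) :
    ∀ᵐ x ∂volume.restrict Ω, P x := by
  have h' : ∀ᵐ x ∂volume.restrict Ω, ∀ K ∈ M.elems, x ∈ interior (hull K) → P x := by
    rw [Filter.eventually_all_finset]
    exact fun K hK => ae_restrict_of_ae
      ((ae_restrict_iff' isOpen_interior.measurableSet).1 (h K hK))
  filter_upwards [h', M.ae_mem_interior] with x hx ⟨K, hK, hxK⟩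
  exact hx K hK hxK

theorem IsPiece.unique (hΩ : IsRegularDomain Ω) {K : Finset (E d)} (hK : K ∈ M.elems) {s : L2 Ω}
    {q r : Poly d} (hq : IsPiece s K q) (hr : IsPiece s K r) : q = r :=
  eq_of_ev_ae_eq isOpen_interior (M.isSimplex hK).interior_nonempty
    (((isPiece_iff hΩ hK).1 hq).symm.trans ((isPiece_iff hΩ hK).1 hr))

theorem IsPiece.piece_eq (hΩ : IsRegularDomain Ω) {K : Finset (E d)} (hK : K ∈ M.elems)
    {s : L2 Ω} {q : Poly d} (hq : IsPiece s K q) : piece s K = q :=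
  IsPiece.unique hΩ hK (Classical.epsilon_spec (p := fun q => IsPiece s K q) ⟨q, hq⟩) hq

theorem isPiece_piece {p : ℕ} {s : L2 Ω} (hs : s ∈ M.polySpace p) {K : Finset (E d)}
    (hK : K ∈ M.elems) : IsPiece s K (piece s K) := by
  obtain ⟨q, _, hq⟩ := hs K hK
  exact Classical.epsilon_spec (p := fun q => IsPiece s K q) ⟨q, hq⟩

theorem totalDegree_piece (hΩ : IsRegularDomain Ω) {p : ℕ} {s : L2 Ω} (hs : s ∈ M.polySpace p)
    {K : Finset (E d)} (hK : K ∈ M.elems) : (piece s K).totalDegree ≤ p := by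
  obtain ⟨q, h, hq⟩ := hs K hK
  rwa [hq.piece_eq hΩ hK]

theorem IsPiece.add (hΩ : IsRegularDomain Ω) {K : Finset (E d)} (hK : K ∈ M.elems) {s t : L2 Ω}
    {q r : Poly d} (hq : IsPiece s K q) (hr : IsPiece t K r) : IsPiece (s + t) K (q + r) := by
  rw [isPiece_iff hΩ hK] at *
  filter_upwards [hq, hr, ae_restrict_interior hΩ hK (Lp.coeFn_add s t)] with x h1 h2 h3
  rw [h3, Pi.add_apply, h1, h2, ev_add]

theorem IsPiece.smul (hΩ : IsRegularDomain Ω) {K : Finset (E d)} (hK : K ∈ M.elems) {s : L2 Ω}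
    {q : Poly d} (hq : IsPiece s K q) (c : ℝ) : IsPiece (c • s) K (c • q) := by
  rw [isPiece_iff hΩ hK] at *
  filter_upwards [hq, ae_restrict_interior hΩ hK (Lp.coeFn_smul c s)] with x h1 h3
  rw [h3, Pi.smul_apply, h1, ev_smul, smul_eq_mul]

theorem ext_of_isPiece (hΩ : IsRegularDomain Ω) {s t : L2 Ω} {v : Finset (E d) → Poly d}
    (hs : ∀ K ∈ M.elems, IsPiece s K (v K)) (ht : ∀ K ∈ M.elems, IsPiece t K (v K)) : s = t := by
  refine Lp.ext (M.ae_of_ae_interior fun K hK => ?_)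
  filter_upwards [(isPiece_iff hΩ hK).1 (hs K hK), (isPiece_iff hΩ hK).1 (ht K hK)] with x h1 h2
  rw [h1, h2]

theorem glue_eq {F : Type*} [AddCommMonoid F] (v : Finset (E d) → E d → F)
    {K : Finset (E d)} (hK : K ∈ M.elems) {x : E d} (hx : x ∈ interior (hull K)) :
    ∑ K ∈ M.elems, (interior (hull K)).indicator (v K) x = v K x := by
  rw [Finset.sum_eq_single_of_mem K hK, Set.indicator_of_mem hx]
  intro K' hK' hne
  refine Set.indicator_of_notMem (fun h => hne ?_) _
  exact (M.eq_of_mem_interior hK hK' hx (interior_subset h)).symm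

theorem isPiece_glue (hΩ : IsRegularDomain Ω) (v : Finset (E d) → Poly d) {K : Finset (E d)}
    (hK : K ∈ M.elems) : IsPiece (M.memLp_glue v).toLp K (v K) := by
  rw [isPiece_iff hΩ hK]
  filter_upwards [ae_restrict_interior hΩ hK (M.memLp_glue v).coeFn_toLp,
    ae_restrict_mem isOpen_interior.measurableSet] with x hx hxK
  rw [hx]
  exact glue_eq (fun K => ev (v K)) hK hxK

variable (M) in
/-- The piecewise gradient of the piecewise polynomial with the given pieces. -/
def glueGrad (v : Finset (E d) → Poly d) : E d → E d :=
  fun x => ∑ K ∈ M.elems, (interior (hull K)).indicator (gradPoly (v K)) x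

variable (M) in
theorem memLp_glueGrad (v : Finset (E d) → Poly d) :
    MemLp (M.glueGrad v) 2 (volume.restrict Ω) := by
  refine memLp_finsetSum _ fun K _ => ?_
  rw [memLp_indicator_iff_restrict isOpen_interior.measurableSet]
  obtain ⟨C, hC⟩ := (isCompact_hull K).exists_bound_of_continuousOn
    (continuous_gradPoly (v K)).continuousOn
  have : IsFiniteMeasure ((volume.restrict Ω).restrict (interior (hull K))) :=
    ⟨by
      rw [Measure.restrict_apply_univ]
      exact (Measure.restrict_apply_le Ω _).trans_lt
        ((measure_mono interior_subset).trans_lt (isCompact_hull K).measure_lt_top)⟩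
  refine MemLp.of_bound (continuous_gradPoly (v K)).aestronglyMeasurable C ?_
  refine (ae_restrict_iff' isOpen_interior.measurableSet).2 (Filter.Eventually.of_forall ?_)
  exact fun x hx => hC x (interior_subset hx)

theorem integrableOn_interior (hΩ : IsRegularDomain Ω) {K : Finset (E d)} (hK : K ∈ M.elems)
    {F : Type*} [NormedAddCommGroup F] (w : Lp F 2 (volume.restrict Ω)) :
    IntegrableOn w (interior (hull K)) :=
  (integrable_of_L2 hΩ.isBounded w).mono_set (M.interior_hull_subset hΩ.interior_closure hK)

theorem isBrokenGrad_of_isPiece (hΩ : IsRegularDomain Ω) {s : L2 Ω} {v : Finset (E d) → Poly d}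
    (hs : ∀ K ∈ M.elems, IsPiece s K (v K)) : M.IsBrokenGrad s (M.memLp_glueGrad v).toLp := by
  intro K hK
  refine (hasWeakGradientOn_ev (interior (hull K)) (v K)).congr
    ((isPiece_iff hΩ hK).1 (hs K hK)).symm ?_
  filter_upwards [ae_restrict_interior hΩ hK (M.memLp_glueGrad v).coeFn_toLp,
    ae_restrict_mem isOpen_interior.measurableSet] with x hx hxK
  rw [hx]
  exact (glue_eq (fun K => gradPoly (v K)) hK hxK).symm

theorem IsBrokenGrad.unique (hΩ : IsRegularDomain Ω) {w : L2 Ω} {g g' : L2Vec Ω}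
    (h : M.IsBrokenGrad w g) (h' : M.IsBrokenGrad w g') : g = g' :=
  Lp.ext (M.ae_of_ae_interior fun K hK => (h K hK).ae_eq isOpen_interior (h' K hK)
    (integrableOn_interior hΩ hK g) (integrableOn_interior hΩ hK g'))

/-- Uniqueness identifies the `Classical.epsilon` in `grad` with any piecewise gradient at hand. -/
theorem IsBrokenGrad.grad_eq (hΩ : IsRegularDomain Ω) {w : L2 Ω} {g : L2Vec Ω}
    (h : M.IsBrokenGrad w g) : M.grad w = g :=
  IsBrokenGrad.unique hΩ (Classical.epsilon_spec (p := fun g => M.IsBrokenGrad w g) ⟨g, h⟩) h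

theorem isBrokenGrad_grad {w : L2 Ω} (h : w ∈ M.H1) : M.IsBrokenGrad w (M.grad w) :=
  Classical.epsilon_spec (p := fun g => M.IsBrokenGrad w g) h

theorem IsBrokenGrad.add (hΩ : IsRegularDomain Ω) {w w' : L2 Ω} {g g' : L2Vec Ω}
    (h : M.IsBrokenGrad w g) (h' : M.IsBrokenGrad w' g') :
    M.IsBrokenGrad (w + w') (g + g') := by
  intro K hK
  refine ((h K hK).add (h' K hK) (integrableOn_interior hΩ hK w) (integrableOn_interior hΩ hK w')
    (integrableOn_interior hΩ hK g) (integrableOn_interior hΩ hK g')).congr ?_ ?_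
  · filter_upwards [ae_restrict_interior hΩ hK (Lp.coeFn_add w w')] with x hx
    rw [hx, Pi.add_apply]
  · filter_upwards [ae_restrict_interior hΩ hK (Lp.coeFn_add g g')] with x hx
    rw [hx, Pi.add_apply]

theorem IsBrokenGrad.smul (hΩ : IsRegularDomain Ω) {w : L2 Ω} {g : L2Vec Ω}
    (h : M.IsBrokenGrad w g) (c : ℝ) : M.IsBrokenGrad (c • w) (c • g) := by
  intro K hK
  refine ((h K hK).const_smul c).congr ?_ ?_
  · filter_upwards [ae_restrict_interior hΩ hK (Lp.coeFn_smul c w)] with x hx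
    rw [hx, Pi.smul_apply, smul_eq_mul]
  · filter_upwards [ae_restrict_interior hΩ hK (Lp.coeFn_smul c g)] with x hx
    rw [hx, Pi.smul_apply]

/-- Integrals over `Ω` are sums of integrals over the elements. -/
theorem integral_eq_sum (hΩ : IsRegularDomain Ω) {F : Type*} [NormedAddCommGroup F]
    [NormedSpace ℝ F] {f : E d → F} (hf : IntegrableOn f Ω) :
    ∫ x in Ω, f x = ∑ K ∈ M.elems, ∫ x in interior (hull K), f x := by
  have hU : (Ω : Set (E d)) =ᵐ[volume] ⋃ K ∈ M.elems, interior (hull K) := by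
    refine Filter.EventuallyLE.antisymm ?_ ?_
    · have := (ae_restrict_iff' hΩ.isOpen.measurableSet).1 M.ae_mem_interior
      filter_upwards [this] with x hx hxΩ
      obtain ⟨K, hK, h⟩ := hx hxΩ
      exact Set.mem_biUnion (x := K) hK h
    · have : (⋃ K ∈ M.elems, interior (hull K)) ⊆ Ω :=
        Set.iUnion₂_subset fun K hK => M.interior_hull_subset hΩ.interior_closure hK
      exact this.eventuallyLE
  rw [setIntegral_congr_set hU, integral_biUnion_finset _ fun K _ =>
    isOpen_interior.measurableSet]
  · intro K hK K' hK' hne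
    refine Set.disjoint_left.2 fun x hx hx' => hne ?_
    exact M.eq_of_mem_interior hK hK' hx (interior_subset hx')
  · exact fun K hK => hf.mono_set (M.interior_hull_subset hΩ.interior_closure hK)

theorem aM_eq_inner (w w' : L2 Ω) : M.aM w w' = inner ℝ (M.grad w) (M.grad w') :=
  (L2.inner_def _ _).symm

theorem aM_eq_sum (hΩ : IsRegularDomain Ω) {s t : L2 Ω} {v r : Finset (E d) → Poly d}
    (hs : ∀ K ∈ M.elems, IsPiece s K (v K)) (ht : ∀ K ∈ M.elems, IsPiece t K (r K)) :
    M.aM s t = ∑ K ∈ M.elems, ∫ x in hull K, inner ℝ (gradPoly (v K) x) (gradPoly (r K) x) := by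
  have hi : IntegrableOn (fun x => inner ℝ (M.grad s x) (M.grad t x)) Ω :=
    L2.integrable_inner (𝕜 := ℝ) (M.grad s) (M.grad t)
  rw [aM, integral_eq_sum hΩ hi]
  refine Finset.sum_congr rfl fun K hK => ?_
  rw [setIntegral_hull]
  refine integral_congr_ae ?_
  rw [(isBrokenGrad_of_isPiece hΩ hs).grad_eq hΩ, (isBrokenGrad_of_isPiece hΩ ht).grad_eq hΩ]
  filter_upwards [ae_restrict_interior hΩ hK (M.memLp_glueGrad v).coeFn_toLp,
    ae_restrict_interior hΩ hK (M.memLp_glueGrad r).coeFn_toLp,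
    ae_restrict_mem isOpen_interior.measurableSet] with x h1 h2 hxK
  rw [h1, h2]
  simp only [glueGrad]
  rw [glue_eq (fun K => gradPoly (v K)) hK hxK, glue_eq (fun K => gradPoly (r K)) hK hxK]

/-- A function with vanishing piecewise gradient is piecewise constant. -/
theorem exists_const_of_grad_eq_zero (hΩ : IsRegularDomain Ω) {w : L2 Ω}
    (h : M.IsBrokenGrad w 0) {K : Finset (E d)} (hK : K ∈ M.elems) :
    ∃ c : ℝ, IsPiece w K (MvPolynomial.C c) := by
  have h0 : HasWeakGradientOn (interior (hull K)) w 0 :=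
    (h K hK).congr Filter.EventuallyEq.rfl
      (ae_restrict_interior hΩ hK (Lp.coeFn_zero (E d) 2 (volume.restrict Ω)))
  obtain ⟨c, hc⟩ := h0.ae_const isOpen_interior (convex_hull' K).interior
    (integrableOn_interior hΩ hK w)
  refine ⟨c, (isPiece_iff hΩ hK).2 ?_⟩
  filter_upwards [hc] with x hx
  rw [hx, ev_C]

end Mesh

end FEM

/-! ### Piecewise polynomials in H^1_0: necessary and sufficient conditions. -/

namespace FEM

variable {d : ℕ}

/-! ### Traces of piecewise polynomials in `H^1_0` -/

theorem integral_fderiv_eq_zero_of_hasCompactSupport {f : E d → ℝ} (hf : ContDiff ℝ 1 f)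
    (hs : HasCompactSupport f) (e : E d) : ∫ x, fderiv ℝ f x e = 0 := by
  simpa using integral_mul_fderiv_eq_neg (contDiff_const (c := (1 : ℝ))) hf hs e

theorem fderiv_ev_mul (q : Poly d) {ψ : E d → ℝ} (hψ : ContDiff ℝ ∞ ψ) (x e : E d) :
    fderiv ℝ (fun y => ev q y * ψ y) x e = ev q x * fderiv ℝ ψ x e +
      ψ x * inner ℝ (gradPoly q x) e := by
  rw [HasFDerivAt.fderiv (f := fun y => ev q y * ψ y)
    ((hasFDerivAt_ev q x).mul (hψ.differentiable (by simp) x).hasFDerivAt)]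
  simp only [add_apply, smul_apply, innerSL_apply_apply, smul_eq_mul]

/-- A polynomial whose product with every test function near a point of a face satisfies the
divergence identity of functions vanishing on the face is zero at that point. -/
theorem IsSimplex.ev_eq_zero_of_integral_fderiv {K F : Finset (E d)} (hK : IsSimplex K)
    (hd : 1 ≤ d) (hF : F ⊆ K) (hc : F.card = d) {x : E d} (hx : IsRelInt K F x) {U : Set (E d)}
    (hU : U ∈ 𝓝 x) {j : Poly d}
    (h : ∀ ψ : E d → ℝ, ContDiff ℝ ∞ ψ → HasCompactSupport ψ → tsupport ψ ⊆ U → ∀ e,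
      ∫ y in hull K, fderiv ℝ (fun y => ev j y * ψ y) y e = 0) : ev j x = 0 := by
  classical
  obtain ⟨n, rfl⟩ : ∃ n, d = n + 1 := ⟨d - 1, by omega⟩
  obtain ⟨a, ha, rfl⟩ : ∃ a ∈ K, F = K.erase a := by
    have h1 : (K \ F).card = 1 := by
      rw [Finset.card_sdiff_of_subset hF, hK.card, hc]; omega
    obtain ⟨a, ha⟩ := Finset.card_eq_one.1 h1
    refine ⟨a, (Finset.mem_sdiff.1 (ha ▸ Finset.mem_singleton_self a)).1, ?_⟩
    rw [Finset.erase_eq, ← ha, Finset.sdiff_sdiff_eq_self hF]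
  obtain ⟨b, hb⟩ : (K.erase a).Nonempty := by
    rw [← Finset.card_pos, hc]; omega
  obtain ⟨hba, hbK⟩ := Finset.mem_erase.1 hb
  -- The cutoff is supported where the coordinate of `b` is positive, so in `stokes` the face
  -- opposite to `b` does not contribute.
  have hU' : U ∩ {y | 0 < lam K b y} ∈ 𝓝 x :=
    Filter.inter_mem hU ((isOpen_lt continuous_const (continuous_lam K b)).mem_nhds (hx.2 b hb))
  obtain ⟨ψ, hψU, hψs, hψ, hψr, hψx⟩ := exists_contDiff_tsupport_subset (n := ⊤) hU'
  have hψ' : ContDiff ℝ ∞ ψ := hψ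
  have hψ0 : ∀ y, 0 ≤ ψ y := fun y => (hψr ⟨y, rfl⟩).1
  have hjψ : ContDiff ℝ ∞ fun y => ev j y * ψ y := (contDiff_ev j).mul hψ'
  have hf : ContDiff ℝ ∞ fun y => ev j y * (ev j y * ψ y) := (contDiff_ev j).mul hjψ
  obtain ⟨c₁, c₂, hc₁, _, hst⟩ := stokes hK ha hbK (Ne.symm hba)
  have h1 := hst _ (hf.of_le (by simp))
  -- The hypothesis is applied to `j ψ` instead of `ψ`. What remains on the face is the integral of
  -- the nonnegative function `j² ψ`.
  rw [h _ hjψ hψs.mul_left (subset_trans (tsupport_mul_subset_right ..)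
    (hψU.trans Set.inter_subset_left))] at h1
  have hIa := hK.isSimplexIntegral_face hF hc hd
  have hIb := hK.isSimplexIntegral_face (K.erase_subset b)
    (by rw [Finset.card_erase_of_mem hbK, hK.card]; omega) hd
  have h2 : faceIntegral (K.erase b) (fun y => ev j y * (ev j y * ψ y)) = 0 := by
    refine hIb.eq_zero fun y hy => ?_
    have hy0 : lam K b y = 0 := ((hK.mem_hull_face (K.erase_subset b)).1 hy).2 b hbK (by simp)
    have : ψ y = 0 := image_eq_zero_of_notMem_tsupport fun hyt => by
      have := (hψU hyt).2
      simp only [Set.mem_ofPred_eq, hy0, lt_irrefl] at this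
    simp [this]
  rw [h2, mul_zero, sub_zero, eq_comm, mul_eq_zero, or_iff_right hc₁.ne'] at h1
  have h3 := hIa.eq_zero_of_nonneg hf.continuous (fun y _ => by
    have : ev j y * (ev j y * ψ y) = ev j y ^ 2 * ψ y := by ring
    rw [this]
    exact mul_nonneg (sq_nonneg _) (hψ0 y)) h1 x hx.1
  simpa [hψx] using h3

/-- A polynomial that vanishes at the relative interior of a face vanishes on the face. -/
theorem IsSimplex.eq_zero_of_relInt {K F : Finset (E d)} (hK : IsSimplex K) (hF : F ⊆ K)
    (hne : F.Nonempty) {f : E d → ℝ} (hf : Continuous f) (h : ∀ x, IsRelInt K F x → f x = 0) :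
    ∀ x ∈ hull F, f x = 0 := by
  intro x hx
  by_contra hne0
  obtain ⟨y, hy, hyr⟩ := hK.exists_relInt_near hF hne hx (hf.continuousAt.eventually_ne hne0)
  exact hy (h y hyr)

namespace Mesh

variable {Ω : Set (E d)} {M : Mesh Ω}

theorem isBrokenGrad_of_forall (hΩ : IsRegularDomain Ω) {w : L2 Ω} {g : L2Vec Ω}
    (hg : ∀ ψ : E d → ℝ, ContDiff ℝ ∞ ψ → HasCompactSupport ψ → ∀ e : E d,
      ∫ x in Ω, w x * fderiv ℝ ψ x e = - ∫ x in Ω, ψ x * inner ℝ (g x) e) :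
    M.IsBrokenGrad w g := by
  intro K hK φ hφ
  rw [integral_smul_gradient_eq_iff hφ.1 hφ.2.1 (integrableOn_interior hΩ hK w)
    (integrableOn_interior hΩ hK g)]
  intro e
  have hsub := M.interior_hull_subset hΩ.interior_closure hK
  rw [← setIntegral_eq_of_subset_of_forall_sdiff_eq_zero hΩ.isOpen.measurableSet hsub,
    ← setIntegral_eq_of_subset_of_forall_sdiff_eq_zero hΩ.isOpen.measurableSet hsub]
  · exact hg φ hφ.1 hφ.2.1 e
  · intro x hx
    rw [image_eq_zero_of_notMem_tsupport fun h => hx.2 (hφ.2.2 h), zero_mul]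
  · intro x hx
    rw [← inner_gradient, gradient_eq_zero_of_notMem fun h => hx.2 (hφ.2.2 h), inner_zero_left,
      mul_zero]

theorem exists_isBrokenGrad_of_mem_H10 (hΩ : IsRegularDomain Ω) {w : L2 Ω} (hw : w ∈ H10 Ω) :
    ∃ g, M.IsBrokenGrad w g :=
  (exists_gradient_of_mem_H10 hw).imp fun _ hg => isBrokenGrad_of_forall hΩ hg

theorem mem_H1_of_mem_sup (hΩ : IsRegularDomain Ω) {p : ℕ} {S : Submodule ℝ (L2 Ω)}
    (hS : S ≤ M.polySpace p) {w : L2 Ω} (hw : w ∈ H10 Ω ⊔ S) : w ∈ M.H1 := by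
  obtain ⟨v, hv, s, hs, rfl⟩ := Submodule.mem_sup.1 hw
  obtain ⟨g, hg⟩ := exists_isBrokenGrad_of_mem_H10 (M := M) hΩ hv
  exact ⟨_, hg.add hΩ (isBrokenGrad_of_isPiece hΩ fun K hK => isPiece_piece (hS hs) hK)⟩

/-- The weak gradient on the whole space of the extension by zero agrees with the piecewise
gradient. Since `ψ` need not vanish on the boundary of `Ω` or of an element, the identity carries
the information on traces and jumps. -/
theorem sum_integral_fderiv_eq_zero (hΩ : IsRegularDomain Ω) {v : L2 Ω} (hv : v ∈ H10 Ω)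
    {q : Finset (E d) → Poly d} (hq : ∀ K ∈ M.elems, IsPiece v K (q K)) {ψ : E d → ℝ}
    (hψ : ContDiff ℝ ∞ ψ) (hs : HasCompactSupport ψ) (e : E d) :
    ∑ K ∈ M.elems, ∫ x in hull K, fderiv ℝ (fun y => ev (q K) y * ψ y) x e = 0 := by
  obtain ⟨g, hg⟩ := exists_gradient_of_mem_H10 hv
  have hg' := (isBrokenGrad_of_isPiece hΩ hq).unique hΩ (isBrokenGrad_of_forall hΩ hg)
  have hc : Continuous fun x => fderiv ℝ ψ x e :=
    (hψ.continuous_fderiv (by simp)).clm_apply continuous_const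
  have hi1 : IntegrableOn (fun x => v x * fderiv ℝ ψ x e) Ω := by
    have := integrable_smul_of_hasCompactSupport hc (hs.fderiv_apply ℝ e)
      (integrable_of_L2 hΩ.isBounded v)
    exact this.congr (Filter.Eventually.of_forall fun x => mul_comm _ _)
  have hi2 : IntegrableOn (fun x => ψ x * inner ℝ (g x) e) Ω :=
    integrable_smul_of_hasCompactSupport hψ.continuous hs
      ((integrable_of_L2 hΩ.isBounded g).inner_const e)
  have h0 : ∫ x in Ω, (v x * fderiv ℝ ψ x e + ψ x * inner ℝ (g x) e) = 0 := by
    rw [integral_add hi1 hi2, hg ψ hψ hs e, neg_add_cancel]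
  rw [integral_eq_sum (M := M) hΩ (f := fun x => v x * fderiv ℝ ψ x e + ψ x * inner ℝ (g x) e)
    (hi1.add hi2)] at h0
  rw [← h0]
  refine Finset.sum_congr rfl fun K hK => ?_
  rw [setIntegral_hull]
  refine integral_congr_ae ?_
  filter_upwards [(isPiece_iff hΩ hK).1 (hq K hK),
    ae_restrict_interior hΩ hK (M.memLp_glueGrad q).coeFn_toLp,
    ae_restrict_mem isOpen_interior.measurableSet] with x h1 h2 h3
  rw [fderiv_ev_mul _ hψ, h1, ← hg', h2, glueGrad, glue_eq (fun K => gradPoly (q K)) hK h3]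

theorem integral_hull_eq_zero_of_tsupport {K : Finset (E d)} {U : Set (E d)} {q : Poly d}
    {ψ : E d → ℝ} (hψ : ContDiff ℝ ∞ ψ) (hU : tsupport ψ ⊆ U) (h : ∀ y ∈ U, y ∉ hull K) (e : E d) :
    ∫ x in hull K, fderiv ℝ (fun y => ev q y * ψ y) x e = 0 := by
  refine setIntegral_eq_zero_of_forall_eq_zero fun x hx => ?_
  have hxψ : x ∉ tsupport ψ := fun hxt => h x (hU hxt) hx
  rw [fderiv_ev_mul _ hψ, image_eq_zero_of_notMem_tsupport hxψ, ← inner_gradient,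
    gradient_eq_zero_of_notMem hxψ]
  simp

/-- Near a relatively interior point of a boundary face only `K` meets the support of `ψ`, so the
sum over the elements has a single term. -/
theorem ev_eq_zero_of_mem_bdFace (hΩ : IsRegularDomain Ω) (hd : 1 ≤ d) {v : L2 Ω}
    (hv : v ∈ H10 Ω) {q : Finset (E d) → Poly d} (hq : ∀ K ∈ M.elems, IsPiece v K (q K))
    {K F : Finset (E d)} (hK : K ∈ M.elems) (hF : F ∈ M.bdFaces) (hFK : F ⊆ K) :
    ∀ x ∈ hull F, ev (q K) x = 0 := by
  have hc : F.card = d := M.card_face (M.mem_bdFaces.1 hF).1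
  refine (M.isSimplex hK).eq_zero_of_relInt hFK (Finset.card_pos.1 (by omega))
    (continuous_ev _) fun x hx => ?_
  refine (M.isSimplex hK).ev_eq_zero_of_integral_fderiv hd hFK hc hx
    (M.eventually_mem_of_mem_hull x) fun ψ hψ hs hU e => ?_
  rw [← sum_integral_fderiv_eq_zero hΩ hv hq hψ hs e]
  symm
  refine Finset.sum_eq_single_of_mem K hK fun K' hK' hne => ?_
  refine integral_hull_eq_zero_of_tsupport hψ hU (fun y hy hyK' => hne ?_) e
  exact M.eq_of_bdFace hΩ.interior_closure hd hK' hK hF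
    (M.subset_of_isRelInt hK hK' hFK hx (hy K' hK' hyK')) hFK

theorem ev_eq_of_mem_intFace (hΩ : IsRegularDomain Ω) (hd : 1 ≤ d) {v : L2 Ω}
    (hv : v ∈ H10 Ω) {q : Finset (E d) → Poly d} (hq : ∀ K ∈ M.elems, IsPiece v K (q K))
    {K₁ K₂ F : Finset (E d)} (hK₁ : K₁ ∈ M.elems) (hK₂ : K₂ ∈ M.elems) (hne : K₁ ≠ K₂)
    (hF₁ : F ⊆ K₁) (hF₂ : F ⊆ K₂) (hc : F.card = d) :
    ∀ x ∈ hull F, ev (q K₁) x = ev (q K₂) x := by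
  have hs₁ := M.isSimplex hK₁
  suffices h : ∀ x ∈ hull F, ev (q K₁ - q K₂) x = 0 by
    intro x hx
    simpa [sub_eq_zero] using h x hx
  refine hs₁.eq_zero_of_relInt hF₁ (Finset.card_pos.1 (by omega)) (continuous_ev _) fun x hx => ?_
  obtain ⟨U, hUs, hUo, hxU⟩ := mem_nhds_iff.1 (M.union_mem_nhds hK₁ hK₂ hne hF₁ hF₂ hc hx)
  refine hs₁.ev_eq_zero_of_integral_fderiv hd hF₁ hc hx (hUo.mem_nhds hxU) fun ψ hψ hs hU e => ?_
  have h1 : (∫ x in hull K₁, fderiv ℝ (fun y => ev (q K₁) y * ψ y) x e) +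
      ∫ x in hull K₂, fderiv ℝ (fun y => ev (q K₂) y * ψ y) x e = 0 := by
    classical
    rw [← sum_integral_fderiv_eq_zero hΩ hv hq hψ hs e,
      ← Finset.sum_subset (s₁ := {K₁, K₂}) (Finset.insert_subset hK₁
        (Finset.singleton_subset_iff.2 hK₂)), Finset.sum_pair hne]
    intro K' hK' hn
    refine integral_hull_eq_zero_of_tsupport hψ hU (fun y hy hyK' => hn ?_) e
    obtain ⟨y', hy'U, hy'⟩ := mem_closure_iff.1
      ((M.isSimplex hK').subset_closure_interior hyK') U hUo hy
    rcases hUs hy'U with h | h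
    · simp [M.eq_of_mem_interior hK' hK₁ hy' h]
    · simp [M.eq_of_mem_interior hK' hK₂ hy' h]
  have hcd : ∀ r : Poly d, ContDiff ℝ 1 fun y => ev r y * ψ y := fun r =>
    ((contDiff_ev r).mul hψ).of_le (by simp)
  have hint : ∀ (r : Poly d) (K : Finset (E d)),
      IntegrableOn (fun x => fderiv ℝ (fun y => ev r y * ψ y) x e) (interior (hull K)) := fun r K =>
    integrableOn_hull K (((hcd r).continuous_fderiv one_ne_zero).clm_apply continuous_const)
  -- The polynomial of `K₂` is smooth across the face and satisfies the same identity. Subtraction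
  -- cancels the integral over `K₂` and leaves the difference of the pieces on `K₁`.
  have h2 : (∫ x in hull K₁, fderiv ℝ (fun y => ev (q K₂) y * ψ y) x e) +
      ∫ x in hull K₂, fderiv ℝ (fun y => ev (q K₂) y * ψ y) x e = 0 := by
    rw [setIntegral_hull, setIntegral_hull, ← setIntegral_union _
      isOpen_interior.measurableSet (hint _ _) (hint _ _)]
    · rw [← integral_fderiv_eq_zero_of_hasCompactSupport (hcd (q K₂)) hs.mul_left e,
        setIntegral_congr_set ((hull_ae_eq K₁).union (hull_ae_eq K₂))]
      refine setIntegral_eq_integral_of_forall_compl_eq_zero fun y hy => ?_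
      have hyψ : y ∉ tsupport ψ := fun hyt => hy (hUs (hU hyt))
      rw [fderiv_ev_mul _ hψ, image_eq_zero_of_notMem_tsupport hyψ, ← inner_gradient,
        gradient_eq_zero_of_notMem hyψ]
      simp
    · exact Set.disjoint_left.2 fun y hy hy' =>
        hne (M.eq_of_mem_interior hK₁ hK₂ hy (interior_subset hy'))
  have h3 := sub_eq_zero.2 (h1.trans h2.symm)
  rw [add_sub_add_right_eq_sub, setIntegral_hull, setIntegral_hull,
    ← integral_sub (hint _ _) (hint _ _)] at h3
  rw [setIntegral_hull, ← h3]
  refine integral_congr_ae (Filter.Eventually.of_forall fun y => ?_)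
  simp only [fderiv_ev_mul _ hψ]
  have : gradPoly (q K₁ - q K₂) y = gradPoly (q K₁) y - gradPoly (q K₂) y := by
    ext i
    simp [gradPoly]
  rw [this, ev_sub, inner_sub_left]
  ring

end Mesh

/-! ### Lipschitz functions in `H^1_0` -/

/-- A closed subspace of a product of Hilbert spaces contains `(w, g)` for some `g`, if it contains
`(u n, g n)` with `u n → w` and bounded `g n`. -/
theorem exists_mem_of_tendsto_fst {H₁ H₂ : Type*} [NormedAddCommGroup H₁] [InnerProductSpace ℝ H₁]
    [NormedAddCommGroup H₂] [InnerProductSpace ℝ H₂] [CompleteSpace H₂]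
    {D : Submodule ℝ (H₁ × H₂)} (hD : IsClosed (D : Set (H₁ × H₂))) {u : ℕ → H₁} {g : ℕ → H₂}
    (hmem : ∀ n, (u n, g n) ∈ D) {w : H₁} (hu : Filter.Tendsto u Filter.atTop (𝓝 w)) {B : ℝ}
    (hB : ∀ n, ‖g n‖ ≤ B) : ∃ k : H₂, (w, k) ∈ D := by
  -- Weak-star compactness of a dual ball: along an ultrafilter the bounded sequence `g n` has a
  -- weak limit `k`.
  let f : ℕ → WeakDual ℝ H₂ := fun n => StrongDual.toWeakDual (innerSL ℝ (g n))
  obtain ⟨l, -, hl⟩ := (WeakDual.isCompact_closedBall (𝕜 := ℝ) (E := H₂) 0 B).ultrafilter_le_nhds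
    ((Filter.hyperfilter ℕ).map f) (by
      rw [Filter.le_principal_iff, Ultrafilter.coe_map, Filter.mem_map]
      refine Filter.Eventually.of_forall fun n => ?_
      rw [Set.mem_preimage, mem_closedBall_zero_iff]
      exact (innerSL_apply_norm ℝ (g n)).trans_le (hB n))
  let k : H₂ := (InnerProductSpace.toDual ℝ H₂).symm (WeakDual.toStrongDual l)
  have hk : ∀ y, Filter.Tendsto (fun n => inner ℝ (g n) y) (Filter.hyperfilter ℕ : Filter ℕ)
      (𝓝 (inner ℝ k y)) := by
    intro y
    have h1 : Filter.Tendsto f (Filter.hyperfilter ℕ : Filter ℕ) (𝓝 l) := hl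
    have h2 := ((WeakDual.eval_continuous y).tendsto l).comp h1
    have h3 : inner ℝ k y = l y := InnerProductSpace.toDual_symm_apply
    rw [h3]
    exact h2
  refine ⟨k, ?_⟩
  -- A closed subspace is weakly closed: a functional separating `(w, k)` from it would vanish on
  -- the subspace, hence also at the weak limit.
  by_contra hn
  obtain ⟨φ, c, h1, h2⟩ := geometric_hahn_banach_closed_point D.convex hD hn
  have hc : 0 < c := by simpa using h1 0 D.zero_mem
  have hφ : ∀ a ∈ D, φ a = 0 := by
    intro a ha
    by_contra h0
    have := h1 ((c / φ a) • a) (D.smul_mem _ ha)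
    rw [map_smul, smul_eq_mul, div_mul_cancel₀ _ h0] at this
    exact lt_irrefl _ this
  let y : H₂ := (InnerProductSpace.toDual ℝ H₂).symm (φ.comp (ContinuousLinearMap.inr ℝ H₁ H₂))
  have hsplit : ∀ (a : H₁) (b : H₂), φ (a, b) = φ (a, 0) + inner ℝ b y := by
    intro a b
    have hb : inner ℝ b y = φ (0, b) := by
      rw [real_inner_comm]
      exact InnerProductSpace.toDual_symm_apply
    rw [hb, ← map_add]
    simp
  have hle : (Filter.hyperfilter ℕ : Filter ℕ) ≤ Filter.atTop := by
    rw [← Nat.cofinite_eq_atTop]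
    exact Filter.hyperfilter_le_cofinite
  have hlim : Filter.Tendsto (fun n => φ (u n, g n)) (Filter.hyperfilter ℕ : Filter ℕ)
      (𝓝 (φ (w, k))) := by
    have hcont : Continuous fun a : H₁ => φ (a, 0) := by fun_prop
    have := ((hcont.tendsto w).comp (hu.mono_left hle)).add (hk y)
    rw [hsplit w k]
    exact this.congr fun n => (hsplit (u n) (g n)).symm
  simp only [hφ _ (hmem _)] at hlim
  have := tendsto_nhds_unique hlim tendsto_const_nhds
  linarith

/-- Mollification of a compactly supported Lipschitz function. -/
theorem exists_test_near {Ω : Set (E d)} (ho : IsOpen Ω) {w : E d → ℝ} {L : ℝ≥0}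
    (hw : LipschitzWith L w) (hs : HasCompactSupport w) (hsΩ : tsupport w ⊆ Ω) {ε : ℝ}
    (hε : 0 < ε) : ∃ φ, IsTest Ω φ ∧ (∀ x, |φ x - w x| ≤ ε) ∧ ∀ x, ‖gradient φ x‖ ≤ L := by
  obtain ⟨δ₀, hδ₀, hδΩ⟩ := hs.isCompact.exists_cthickening_subset_open ho hsΩ
  have hL : (0 : ℝ) < L + 1 := by positivity
  let δ : ℝ := min δ₀ (ε / (L + 1))
  have hδ : 0 < δ := lt_min hδ₀ (by positivity)
  let η : ContDiffBump (0 : E d) := ⟨δ / 2, δ, by positivity, half_lt_self hδ⟩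
  let φ := convolution (η.normed volume) w (ContinuousLinearMap.lsmul ℝ ℝ) volume
  have hli : LocallyIntegrable w := hw.continuous.locallyIntegrable
  have hcs := η.hasCompactSupport_normed (μ := volume)
  have hsupp : tsupport φ ⊆ Metric.cthickening δ (tsupport w) := by
    refine closure_minimal (fun x hx => ?_) Metric.isClosed_cthickening
    obtain ⟨a, ha, b, hb, rfl⟩ := support_convolution_subset _ hx
    rw [ContDiffBump.support_normed_eq, Metric.mem_ball, dist_zero_right] at ha
    refine Metric.mem_cthickening_of_dist_le _ b _ _ (subset_closure hb) ?_
    simpa [dist_eq_norm] using ha.le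
  have hdiv : ∀ x, φ x = ∫ t, η.normed volume t * w (x - t) := fun x => rfl
  have hint : ∀ x, Integrable fun t => η.normed volume t * w (x - t) := fun x =>
    (η.continuous_normed.mul (hw.continuous.comp (continuous_const.sub
      continuous_id))).integrable_of_hasCompactSupport hcs.mul_right
  refine ⟨φ, ⟨?_, ?_, ?_⟩, ?_, ?_⟩
  · exact hcs.contDiff_convolution_left (n := ⊤) _ η.contDiff_normed hli
  · exact hs.isCompact.cthickening.of_isClosed_subset (isClosed_tsupport _) hsupp
  · exact hsupp.trans ((Metric.cthickening_mono (min_le_left _ _) _).trans hδΩ)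
  · intro x
    refine ContDiffBump.dist_normed_convolution_le (φ := η)
      hw.continuous.aestronglyMeasurable fun y hy => ?_
    refine (hw.dist_le_mul y x).trans ?_
    have h1 : dist y x ≤ ε / (L + 1) := (Metric.mem_ball.1 hy).le.trans (min_le_right _ _)
    calc (L : ℝ) * dist y x ≤ (L + 1) * (ε / (L + 1)) := by gcongr; linarith
      _ = ε := mul_div_cancel₀ _ hL.ne'
  · have hlip : LipschitzWith L φ := by
      refine LipschitzWith.of_dist_le_mul fun x y => ?_
      rw [Real.dist_eq, hdiv, hdiv, ← integral_sub (hint x) (hint y)]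
      have h1 : ∀ t, ‖η.normed volume t * w (x - t) - η.normed volume t * w (y - t)‖
          ≤ η.normed volume t * (L * dist x y) := fun t => by
        rw [← mul_sub, norm_mul, Real.norm_of_nonneg (η.nonneg_normed t)]
        refine mul_le_mul_of_nonneg_left ?_ (η.nonneg_normed t)
        have := hw.dist_le_mul (x - t) (y - t)
        rwa [dist_sub_right, Real.dist_eq] at this
      have h2 := norm_integral_le_of_norm_le
        ((η.continuous_normed.integrable_of_hasCompactSupport hcs (μ := volume)).mul_const
          (L * dist x y))
        (Filter.Eventually.of_forall h1)
      rwa [integral_mul_const, η.integral_normed, one_mul] at h2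
    intro x
    rw [gradient, LinearIsometryEquiv.norm_map]
    exact norm_fderiv_le_of_lipschitz ℝ hlip

/-- Lipschitz functions vanishing outside `Ω` are in `H^1_0(Ω)`. -/
theorem mem_H10_of_lipschitz {Ω : Set (E d)} (ho : IsOpen Ω) (hb : Bornology.IsBounded Ω)
    {w : E d → ℝ} {L : ℝ≥0} (hw : LipschitzWith L w) (h0 : ∀ x ∉ Ω, w x = 0) {u : L2 Ω}
    (hu : (u : E d → ℝ) =ᵐ[volume.restrict Ω] w) : u ∈ H10 Ω := by
  have hfin : IsFiniteMeasure (volume.restrict Ω) := ⟨by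
    rw [Measure.restrict_apply_univ]
    exact hb.measure_lt_top⟩
  have key : ∀ n : ℕ, ∃ φ, IsTest Ω φ ∧ (∀ x, |φ x - w x| ≤ 2 * (1 / ((n : ℝ) + 1))) ∧
      ∀ x, ‖gradient φ x‖ ≤ (L + L : ℝ≥0) := by
    intro n
    set ε : ℝ := 1 / ((n : ℝ) + 1) with hεdef
    have hε : 0 < ε := by positivity
    -- Subtracting the truncation to `[-ε, ε]` moves the support into `{ε ≤ |w|}`, thus away from
    -- the boundary. The Lipschitz constant `L + L` does not depend on `ε`, so the gradients of the
    -- approximations stay bounded.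
    let wε : E d → ℝ := fun x => w x - max (-ε) (min ε (w x))
    have hlip : LipschitzWith (L + L) wε := hw.sub ((hw.const_min ε).const_max (-ε))
    have hclose : ∀ x, |wε x - w x| ≤ ε := fun x => by
      simp only [wε, sub_sub_cancel_left, abs_neg]
      exact abs_le.2 ⟨le_max_left _ _, max_le (by linarith) (min_le_left _ _)⟩
    have hsub : tsupport wε ⊆ {x | ε ≤ |w x|} := by
      refine closure_minimal (fun x hx => ?_) (isClosed_le continuous_const hw.continuous.abs)
      by_contra hlt
      rw [Set.mem_ofPred_eq, not_le, abs_lt] at hlt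
      refine hx ?_
      simp only [wε]
      rw [min_eq_right hlt.2.le, max_eq_right hlt.1.le, sub_self]
    have hsΩ : tsupport wε ⊆ Ω := fun x hx => by
      by_contra hn
      have := hsub hx
      rw [Set.mem_ofPred_eq, h0 x hn, abs_zero] at this
      linarith
    have hcs : HasCompactSupport wε :=
      Metric.isCompact_of_isClosed_isBounded (isClosed_tsupport _) (hb.subset hsΩ)
    obtain ⟨φ, h1, h2, h3⟩ := exists_test_near ho hlip hcs hsΩ hε
    refine ⟨φ, h1, fun x => ?_, h3⟩
    calc |φ x - w x| ≤ |φ x - wε x| + |wε x - w x| := abs_sub_le _ _ _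
      _ ≤ 2 * ε := by linarith [h2 x, hclose x]
  choose φ hφ hφw hφg using key
  have hm1 : ∀ n, MemLp (φ n) 2 (volume.restrict Ω) := fun n =>
    (hφ n).1.continuous.memLp_of_hasCompactSupport (hφ n).2.1
  have hm2 : ∀ n, MemLp (gradient (φ n)) 2 (volume.restrict Ω) := fun n =>
    (continuous_gradient (hφ n).1).memLp_of_hasCompactSupport
      (hasCompactSupport_gradient (hφ n).2.1)
  have hlim : Filter.Tendsto (fun n => (hm1 n).toLp) Filter.atTop (𝓝 u) := by
    rw [tendsto_iff_norm_sub_tendsto_zero]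
    set c : ℝ := measureUnivNNReal (volume.restrict Ω) ^ (2 : ENNReal).toReal⁻¹
    have hz : Filter.Tendsto (fun n : ℕ => c * (2 * (1 / ((n : ℝ) + 1)))) Filter.atTop (𝓝 0) := by
      simpa using (tendsto_one_div_add_atTop_nhds_zero_nat.const_mul 2).const_mul c
    refine squeeze_zero (fun _ => norm_nonneg _) (fun n => ?_) hz
    refine Lp.norm_le_of_ae_bound (by positivity) ?_
    filter_upwards [Lp.coeFn_sub (hm1 n).toLp u, (hm1 n).coeFn_toLp, hu] with x e1 e2 e3
    rw [e1, Pi.sub_apply, e2, e3]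
    exact hφw n x
  have hbd : ∀ n, ‖(hm2 n).toLp‖ ≤ measureUnivNNReal (volume.restrict Ω) ^
      (2 : ENNReal).toReal⁻¹ * ((L + L : ℝ≥0) : ℝ) := fun n => by
    refine Lp.norm_le_of_ae_bound (by positivity) ?_
    filter_upwards [(hm2 n).coeFn_toLp] with x hx
    rw [hx]
    exact hφg n x
  obtain ⟨k, hk⟩ := exists_mem_of_tendsto_fst
    (D := (Submodule.span ℝ {w : L2 Ω × L2Vec Ω | ∃ φ : E d → ℝ, IsTest Ω φ ∧
      (w.1 : E d → ℝ) =ᵐ[volume.restrict Ω] φ ∧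
      (w.2 : E d → E d) =ᵐ[volume.restrict Ω] gradient φ}).topologicalClosure)
    (Submodule.isClosed_topologicalClosure _) (fun n => Submodule.le_topologicalClosure _
      (Submodule.subset_span ⟨φ n, hφ n, (hm1 n).coeFn_toLp, (hm2 n).coeFn_toLp⟩)) hlim hbd
  exact ⟨_, hk, rfl⟩

/-- Continuity induction on `[0, 1]`: local bounds at every point, with the same constant but no
uniform radius, add up along the interval. -/
theorem abs_sub_le_of_forall_eventually {f : ℝ → ℝ} {L : ℝ}
    (h : ∀ t, ∀ᶠ s in 𝓝 t, |f s - f t| ≤ L * |s - t|) : |f 1 - f 0| ≤ L := by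
  have hcont : Continuous f := by
    refine continuous_iff_continuousAt.2 fun t => ?_
    rw [ContinuousAt, tendsto_iff_norm_sub_tendsto_zero]
    have h1 : Filter.Tendsto (fun s => L * |s - t|) (𝓝 t) (𝓝 0) := by
      have : Continuous fun s => L * |s - t| := by fun_prop
      simpa using this.tendsto t
    exact squeeze_zero' (Filter.Eventually.of_forall fun _ => norm_nonneg _) (h t) h1
  have hcl : IsClosed {t : ℝ | |f t - f 0| ≤ L * t} :=
    isClosed_le (by fun_prop) (by fun_prop)
  have := IsClosed.Icc_subset_of_forall_mem_nhdsWithin (a := (0 : ℝ)) (b := 1)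
    (hcl.inter isClosed_Icc) (by simp) (fun t ht => by
      filter_upwards [nhdsWithin_le_nhds (h t), self_mem_nhdsWithin] with s hs hst
      have h1 : |f t - f 0| ≤ L * t := ht.1
      rw [Set.mem_Ioi] at hst
      rw [abs_of_pos (sub_pos.2 hst)] at hs
      calc |f s - f 0| ≤ |f s - f t| + |f t - f 0| := abs_sub_le _ _ _
        _ ≤ L * s := by linarith) (Set.right_mem_Icc.2 zero_le_one)
  simpa using this

theorem lipschitzWith_of_forall_eventually {w : E d → ℝ} {L : ℝ≥0}
    (h : ∀ x, ∀ᶠ y in 𝓝 x, |w y - w x| ≤ L * dist y x) : LipschitzWith L w := by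
  refine LipschitzWith.of_dist_le_mul fun y x => ?_
  have := abs_sub_le_of_forall_eventually (f := fun t : ℝ => w (x + t • (y - x)))
    (L := L * dist y x) fun t => by
      have hc : Continuous fun t : ℝ => x + t • (y - x) := by fun_prop
      filter_upwards [(hc.tendsto t).eventually (h _)] with s hs
      refine hs.trans_eq ?_
      rw [dist_add_left, dist_eq_norm, ← sub_smul, norm_smul, Real.norm_eq_abs, dist_eq_norm]
      ring
  simpa [Real.dist_eq] using this

theorem exists_lipschitz_bound (K : Finset (E d)) (q : Poly d) :
    ∃ L : ℝ≥0, ∀ x ∈ hull K, ∀ y ∈ hull K, |ev q y - ev q x| ≤ L * dist y x := by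
  obtain ⟨B, hB⟩ := (isCompact_hull K).exists_bound_of_continuousOn
    (continuous_gradPoly q).continuousOn
  refine ⟨B.toNNReal, fun x hx y hy => ?_⟩
  have := (convex_hull' K).norm_image_sub_le_of_norm_hasFDerivWithin_le
    (fun z _ => (hasFDerivAt_ev q z).hasFDerivWithinAt)
    (fun z hz => ((innerSL_apply_norm ℝ _).trans_le (hB z hz)).trans (Real.le_coe_toNNReal B)) hx hy
  rwa [dist_eq_norm]

namespace Mesh

variable {Ω : Set (E d)} {M : Mesh Ω}

/-- The pieces fit together to a continuous function on `closure Ω` that vanishes on the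
boundary. -/
structure IsConforming (M : Mesh Ω) (v : Finset (E d) → Poly d) : Prop where
  eq : ∀ K ∈ M.elems, ∀ K' ∈ M.elems, ∀ x ∈ hull K, x ∈ hull K' → ev (v K) x = ev (v K') x
  zero : ∀ K ∈ M.elems, ∀ x ∈ hull K, x ∈ frontier Ω → ev (v K) x = 0

/-- The extension by zero is Lipschitz. An element containing a point `y` close to `x` also contains
`x`, so the bound of that element applies; the sum of all element constants dominates each of them.
-/
theorem IsConforming.glue_mem_H10 (hΩ : IsRegularDomain Ω) {v : Finset (E d) → Poly d}
    (hv : M.IsConforming v) : (M.memLp_glue v).toLp ∈ H10 Ω := by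
  classical
  choose L hL using fun K => exists_lipschitz_bound K (v K)
  let w : E d → ℝ := fun x => if h : ∃ K ∈ M.elems, x ∈ hull K then ev (v h.choose) x else 0
  have hw : ∀ K ∈ M.elems, ∀ x ∈ hull K, w x = ev (v K) x := by
    intro K hK x hx
    have h : ∃ K ∈ M.elems, x ∈ hull K := ⟨K, hK, hx⟩
    simp only [w, dif_pos h]
    exact hv.eq _ h.choose_spec.1 K hK x h.choose_spec.2 hx
  have hw0 : ∀ x ∉ Ω, w x = 0 := by
    intro x hx
    by_cases h : ∃ K ∈ M.elems, x ∈ hull K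
    · obtain ⟨K, hK, hxK⟩ := h
      rw [hw K hK x hxK]
      refine hv.zero K hK x hxK ?_
      rw [hΩ.isOpen.frontier_eq]
      exact ⟨M.hull_subset_closure hK hxK, hx⟩
    · simp only [w, dif_neg h]
  refine mem_H10_of_lipschitz hΩ.isOpen hΩ.isBounded (w := w) (L := ∑ K ∈ M.elems, L K)
    (lipschitzWith_of_forall_eventually fun x => ?_) hw0 ?_
  · have hnn : ∀ y, 0 ≤ ((∑ K ∈ M.elems, L K : ℝ≥0) : ℝ) * dist y x := fun y => by positivity
    by_cases hx : x ∈ Ω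
    · filter_upwards [M.eventually_mem_of_mem_hull x, hΩ.isOpen.mem_nhds hx] with y hy hyΩ
      obtain ⟨K, hK, hyK⟩ := M.exists_mem_hull (subset_closure hyΩ)
      have hxK := hy K hK hyK
      rw [hw K hK y hyK, hw K hK x hxK]
      refine (hL K x hxK y hyK).trans ?_
      gcongr
      exact Finset.single_le_sum (f := L) (fun _ _ => zero_le) hK
    · filter_upwards [M.eventually_mem_of_mem_hull x] with y hy
      by_cases hyΩ : y ∈ Ω
      · obtain ⟨K, hK, hyK⟩ := M.exists_mem_hull (subset_closure hyΩ)
        have hxK := hy K hK hyK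
        rw [hw K hK y hyK, hw K hK x hxK]
        refine (hL K x hxK y hyK).trans ?_
        gcongr
        exact Finset.single_le_sum (f := L) (fun _ _ => zero_le) hK
      · rw [hw0 x hx, hw0 y hyΩ, sub_self, abs_zero]
        exact hnn y
  · refine M.ae_of_ae_interior fun K hK => ?_
    filter_upwards [(isPiece_iff hΩ hK).1 (isPiece_glue hΩ v hK),
      ae_restrict_mem isOpen_interior.measurableSet] with x hx hxK
    rw [hx, hw K hK x (interior_subset hxK)]

/-- Continuity across interior faces and vanishing on boundary faces suffice. -/
theorem isConforming_of_faces (hΩ : IsRegularDomain Ω) (hd : 1 ≤ d) {v : Finset (E d) → Poly d}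
    (hi : ∀ K ∈ M.elems, ∀ K' ∈ M.elems, K ≠ K' → ∀ F ∈ M.intFaces, F ⊆ K → F ⊆ K' →
      ∀ x ∈ hull F, ev (v K) x = ev (v K') x)
    (hb : ∀ K ∈ M.elems, ∀ F ∈ M.bdFaces, F ⊆ K → ∀ x ∈ hull F, ev (v K) x = 0) :
    M.IsConforming v := by
  -- Having the value `c` at `z` is a property that passes through interior faces, so the chain
  -- lemmas carry it to all elements at an interior point, or to a boundary face.
  have hP : ∀ (c : ℝ) (z : E d), M.Propagates z fun K => ev (v K) z = c := by
    intro c z K hK K' hK' F hF hFK hFK' hz hc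
    by_cases hne : K = K'
    · rwa [← hne]
    · rwa [← hi K hK K' hK' hne F hF hFK hFK' z hz]
  have hzero : ∀ K ∈ M.elems, ∀ x ∈ hull K, x ∉ Ω → ev (v K) x = 0 := by
    intro K hK x hx hxΩ
    obtain ⟨K', hK', hc, F, hF, hFK', hxF⟩ := M.propagate_boundary hΩ.interior_closure hΩ.isOpen
      hd hxΩ (hP (ev (v K) x) x) hK hx rfl
    rw [← hc, hb K' hK' F hF hFK' x hxF]
  refine ⟨fun K hK K' hK' x hx hx' => ?_, fun K hK x hx hxf => hzero K hK x hx ?_⟩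
  · by_cases hxΩ : x ∈ Ω
    · exact (M.propagate_interior hΩ.isOpen hd hxΩ (hP (ev (v K) x) x) hK hK' hx hx' rfl).symm
    · rw [hzero K hK x hx hxΩ, hzero K' hK' x hx' hxΩ]
  · rw [hΩ.isOpen.frontier_eq] at hxf
    exact hxf.2

/-- A piecewise polynomial in `H^1_0` is continuous and vanishes on the boundary. -/
theorem isConforming_of_mem_H10 (hΩ : IsRegularDomain Ω) (hd : 1 ≤ d) {v : L2 Ω}
    (hv : v ∈ H10 Ω) {q : Finset (E d) → Poly d} (hq : ∀ K ∈ M.elems, IsPiece v K (q K)) :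
    M.IsConforming q :=
  isConforming_of_faces hΩ hd
    (fun _ hK _ hK' hne _ hF hFK hFK' => ev_eq_of_mem_intFace hΩ hd hv hq hK hK' hne hFK hFK'
      (M.card_face (M.mem_intFaces.1 hF).1))
    (fun _ hK _ hF hFK => ev_eq_zero_of_mem_bdFace hΩ hd hv hq hK hF hFK)

end Mesh

end FEM

/-! ### Algebra of the smoothing operator: conformity, linearity, invariance, moments. -/

namespace FEM

variable {d : ℕ}

namespace IsSimplexIntegral

variable {n : ℕ} {I : (E d → ℝ) → ℝ} {C K : Finset (E d)} (hI : IsSimplexIntegral I C n)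
include hI

theorem ev_mul_add (v w q : Poly d) : I (fun x => ev (v + w) x * ev q x) =
    I (fun x => ev v x * ev q x) + I (fun x => ev w x * ev q x) := by
  simp only [← ev_mul, add_mul]
  exact (hI.congr fun x _ => ev_add _ _ x).trans (hI.add (continuous_ev _) (continuous_ev _))

theorem ev_mul_sub (v w q : Poly d) : I (fun x => ev (v - w) x * ev q x) =
    I (fun x => ev v x * ev q x) - I (fun x => ev w x * ev q x) := by
  simp only [← ev_mul, sub_mul]
  exact (hI.congr fun x _ => ev_sub _ _ x).trans (hI.sub (continuous_ev _) (continuous_ev _))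

theorem ev_mul_smul (a : ℝ) (v q : Poly d) : I (fun x => ev (a • v) x * ev q x) =
    a * I (fun x => ev v x * ev q x) := by
  rw [← hI.const_mul]
  exact hI.congr fun x _ => by rw [ev_smul, mul_assoc]

/-- The weighted projection is unique on the simplex, and depends linearly on the function. -/
theorem projection_combo (hK : IsSimplex K) (hC : C ⊆ K) {p : ℕ} {u v w Q R T : Poly d} {a b : ℝ}
    (hQd : Q.totalDegree ≤ p) (hRd : R.totalDegree ≤ p) (hTd : T.totalDegree ≤ p)
    (hQ : ∀ q : Poly d, q.totalDegree ≤ p →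
      I (fun x => ev Q x * ev q x * ev (bubble C K) x) = I (fun x => ev u x * ev q x))
    (hR : ∀ q : Poly d, q.totalDegree ≤ p →
      I (fun x => ev R x * ev q x * ev (bubble C K) x) = I (fun x => ev v x * ev q x))
    (hT : ∀ q : Poly d, q.totalDegree ≤ p →
      I (fun x => ev T x * ev q x * ev (bubble C K) x) = I (fun x => ev w x * ev q x))
    (hu : u = a • v + b • w) : ∀ x ∈ hull C, ev Q x = a * ev R x + b * ev T x := by
  set D := Q - (a • R + b • T) with hD
  have hDd : D.totalDegree ≤ p := by
    refine (MvPolynomial.totalDegree_sub _ _).trans (max_le hQd ?_)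
    refine (MvPolynomial.totalDegree_add _ _).trans (max_le ?_ ?_)
    · exact (MvPolynomial.totalDegree_smul_le _ _).trans hRd
    · exact (MvPolynomial.totalDegree_smul_le _ _).trans hTd
  -- The defect `D` of linearity is an admissible test function, and the three defining relations
  -- tested with it give weighted norm zero.
  have key : I (fun x => ev D x * ev D x * ev (bubble C K) x) = 0 := by
    have h1 : ∀ P : Poly d, I (fun x => ev P x * ev D x * ev (bubble C K) x)
        = I (fun x => ev P x * ev (D * bubble C K) x) := fun P =>
      hI.congr fun x _ => by rw [ev_mul, mul_assoc]
    have hQ' := hQ D hDd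
    have hR' := hR D hDd
    have hT' := hT D hDd
    rw [h1] at hQ' hR' hT' ⊢
    conv_lhs => enter [1, x, 1]; rw [hD]
    rw [hI.ev_mul_sub, hI.ev_mul_add, hI.ev_mul_smul, hI.ev_mul_smul, hQ', hR', hT', hu,
      hI.ev_mul_add, hI.ev_mul_smul, hI.ev_mul_smul, sub_self]
  intro x hx
  have := hI.eq_zero_of_bubble hK hC key x hx
  simp only [hD, ev_sub, ev_add, ev_smul] at this
  linarith

end IsSimplexIntegral

namespace Mesh

variable {Ω : Set (E d)} {M : Mesh Ω}

theorem face_integral (hd : 1 ≤ d) {K F : Finset (E d)} (hK : K ∈ M.elems) (hF : F ∈ M.faces)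
    (hFK : F ⊆ K) : IsSimplexIntegral (faceIntegral F) F (d - 1) :=
  (M.isSimplex hK).isSimplexIntegral_face hFK (M.card_face hF) hd

theorem intFaces_subset {F : Finset (E d)} (hF : F ∈ M.intFaces) : F ∈ M.faces :=
  (M.mem_intFaces.1 hF).1

theorem bdFaces_subset {F : Finset (E d)} (hF : F ∈ M.bdFaces) : F ∈ M.faces :=
  (M.mem_bdFaces.1 hF).1

/-- The pieces of a function in `CR_p`. -/
structure IsCR (M : Mesh Ω) (p : ℕ) (v : Finset (E d) → Poly d) : Prop where
  deg : ∀ K ∈ M.elems, (v K).totalDegree ≤ p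
  int : ∀ F ∈ M.intFaces, ∀ K ∈ M.elems, ∀ K' ∈ M.elems, F ⊆ K → F ⊆ K' →
    ∀ q : Poly d, q.totalDegree ≤ p - 1 →
      faceIntegral F (fun x => ev (v K) x * ev q x) = faceIntegral F (fun x => ev (v K') x * ev q x)
  bd : ∀ F ∈ M.bdFaces, ∀ K ∈ M.elems, F ⊆ K → ∀ q : Poly d, q.totalDegree ≤ p - 1 →
    faceIntegral F (fun x => ev (v K) x * ev q x) = 0

theorem isCR_piece (hΩ : IsRegularDomain Ω) (hd : 1 ≤ d) {p : ℕ} {σ : L2 Ω}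
    (hσ : σ ∈ M.crSpace p) : M.IsCR p (piece σ) := by
  refine ⟨fun K hK => totalDegree_piece hΩ hσ.1 hK, fun F hF K hK K' hK' hFK hFK' q hq => ?_,
    hσ.2.2⟩
  by_cases hne : K = K'
  · rw [hne]
  have := hσ.2.1 F hF K hK K' hK' hne hFK hFK' q hq
  simp only [← ev_sub] at this
  rwa [(face_integral hd hK (intFaces_subset hF) hFK).ev_mul_sub, sub_eq_zero] at this

theorem IsCR.sub (hd : 1 ≤ d) {p : ℕ} {v w : Finset (E d) → Poly d} (hv : M.IsCR p v)
    (hw : M.IsCR p w) : M.IsCR p (v - w) := by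
  refine ⟨fun K hK => (MvPolynomial.totalDegree_sub _ _).trans (max_le (hv.deg K hK)
    (hw.deg K hK)), fun F hF K hK K' hK' hFK hFK' q hq => ?_, fun F hF K hK hFK q hq => ?_⟩
  · have hI := face_integral hd hK (intFaces_subset hF) hFK
    rw [Pi.sub_apply, Pi.sub_apply, hI.ev_mul_sub, hI.ev_mul_sub,
      hv.int F hF K hK K' hK' hFK hFK' q hq, hw.int F hF K hK K' hK' hFK hFK' q hq]
  · have hI := face_integral hd hK (bdFaces_subset hF) hFK
    rw [Pi.sub_apply, hI.ev_mul_sub, hv.bd F hF K hK hFK q hq, hw.bd F hF K hK hFK q hq, sub_zero]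

theorem IsConforming.isCR (hd : 1 ≤ d) {p : ℕ} {v : Finset (E d) → Poly d}
    (hv : M.IsConforming v) (hdeg : ∀ K ∈ M.elems, (v K).totalDegree ≤ p) : M.IsCR p v := by
  have hsub : ∀ {F K : Finset (E d)}, F ⊆ K → hull F ⊆ hull K := fun h =>
    convexHull_mono (Finset.coe_subset.2 h)
  refine ⟨hdeg, fun F hF K hK K' hK' hFK hFK' q hq => ?_, fun F hF K hK hFK q hq => ?_⟩
  · exact (face_integral hd hK (intFaces_subset hF) hFK).congr fun x hx => by
      rw [hv.eq K hK K' hK' x (hsub hFK hx) (hsub hFK' hx)]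
  · exact (face_integral hd hK (bdFaces_subset hF) hFK).eq_zero fun x hx => by
      rw [hv.zero K hK x (hsub hFK hx) ((M.mem_bdFaces.1 hF).2 hx), zero_mul]

theorem IsConforming.add {v w : Finset (E d) → Poly d} (hv : M.IsConforming v)
    (hw : M.IsConforming w) : M.IsConforming (v + w) :=
  ⟨fun K hK K' hK' x hx hx' => by
    simp only [Pi.add_apply, ev_add, hv.eq K hK K' hK' x hx hx', hw.eq K hK K' hK' x hx hx'],
  fun K hK x hx hxf => by
    simp only [Pi.add_apply, ev_add, hv.zero K hK x hx hxf, hw.zero K hK x hx hxf, add_zero]⟩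

/-! ### The bubble operators -/

theorem bubble_congr {K K' F : Finset (E d)} (hK : K ∈ M.elems) (hK' : K' ∈ M.elems)
    (hFK : F ⊆ K) (hFK' : F ⊆ K') {x : E d} (hx : x ∈ hull F) :
    ev (bubble F K) x = ev (bubble F K') x := by
  rw [ev_bubble, ev_bubble]
  exact Finset.prod_congr rfl fun z _ =>
    (M.isSimplex hK).lagrange_continuous le_rfl (M.isSimplex hK') hFK hFK' z hx

/-- Moments of `v` and values of the bubble on `F` do not depend on the adjacent element, so a
projection computed from one element serves the other too. This is the witness for `QF`. -/
theorem QF_spec (hd : 1 ≤ d) {p : ℕ} {v : Finset (E d) → Poly d} (hv : M.IsCR p v)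
    {F : Finset (E d)} (hF : F ∈ M.intFaces) : (M.QF p v F).totalDegree ≤ p - 1 ∧
    ∀ K ∈ M.elems, F ⊆ K → ∀ q : Poly d, q.totalDegree ≤ p - 1 →
      faceIntegral F (fun x => ev (M.QF p v F) x * ev q x * ev (bubble F K) x) =
        faceIntegral F (fun x => ev (v K) x * ev q x) := by
  refine Classical.epsilon_spec (p := fun Q : Poly d => Q.totalDegree ≤ p - 1 ∧
    ∀ K ∈ M.elems, F ⊆ K → ∀ q : Poly d, q.totalDegree ≤ p - 1 →
      faceIntegral F (fun x => ev Q x * ev q x * ev (bubble F K) x) =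
        faceIntegral F (fun x => ev (v K) x * ev q x)) ?_
  obtain ⟨K₀, hK₀, hFK₀, -⟩ := M.mem_faces.1 (intFaces_subset hF)
  have hI := face_integral hd hK₀ (intFaces_subset hF) hFK₀
  obtain ⟨Q, hQd, hQ⟩ := hI.exists_projection (M.isSimplex hK₀) hFK₀ (p - 1) (v K₀)
  refine ⟨Q, hQd, fun K hK hFK q hq => ?_⟩
  rw [hv.int F hF K hK K₀ hK₀ hFK hFK₀ q hq, ← hQ q hq]
  exact hI.congr fun x hx => by rw [bubble_congr hK hK₀ hFK hFK₀ hx]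

theorem QK_spec {p : ℕ} (v : Finset (E d) → Poly d) {K : Finset (E d)} (hK : K ∈ M.elems) :
    (QK p v K).totalDegree ≤ p - 2 ∧ ∀ r : Poly d, r.totalDegree ≤ p - 2 →
      ∫ x in hull K, ev (QK p v K) x * ev r x * ev (bubble K K) x =
        ∫ x in hull K, ev (v K) x * ev r x := by
  refine Classical.epsilon_spec (p := fun Q : Poly d => Q.totalDegree ≤ p - 2 ∧
    ∀ r : Poly d, r.totalDegree ≤ p - 2 →
      ∫ x in hull K, ev Q x * ev r x * ev (bubble K K) x = ∫ x in hull K, ev (v K) x * ev r x) ?_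
  exact (M.isSimplex hK).isSimplexIntegral.exists_projection (M.isSimplex hK) subset_rfl (p - 2)
    (v K)

/-- As `QF` is an arbitrary choice of representative, linearity is available only on the face
itself, which is all that nodal values on `F` require. Two coefficients cover sums, multiples and
zero at once. -/
theorem QF_combo (hd : 1 ≤ d) {p : ℕ} {u v w : Finset (E d) → Poly d} (hu : M.IsCR p u)
    (hv : M.IsCR p v) (hw : M.IsCR p w) {a b : ℝ} (h : ∀ K ∈ M.elems, u K = a • v K + b • w K)
    {F : Finset (E d)} (hF : F ∈ M.intFaces) {x : E d} (hx : x ∈ hull F) :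
    ev (M.QF p u F) x = a * ev (M.QF p v F) x + b * ev (M.QF p w F) x := by
  obtain ⟨K, hK, hFK, -⟩ := M.mem_faces.1 (intFaces_subset hF)
  exact (face_integral hd hK (intFaces_subset hF) hFK).projection_combo (M.isSimplex hK) hFK
    (QF_spec hd hu hF).1 (QF_spec hd hv hF).1 (QF_spec hd hw hF).1
    ((QF_spec hd hu hF).2 K hK hFK) ((QF_spec hd hv hF).2 K hK hFK)
    ((QF_spec hd hw hF).2 K hK hFK) (h K hK) x hx

theorem QK_combo {p : ℕ} {u v w : Finset (E d) → Poly d} {a b : ℝ} {K : Finset (E d)}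
    (hK : K ∈ M.elems) (h : u K = a • v K + b • w K) :
    QK p u K = a • QK p v K + b • QK p w K := by
  refine eq_of_ev_eq_on_open isOpen_interior (M.isSimplex hK).interior_nonempty fun x hx => ?_
  rw [(M.isSimplex hK).isSimplexIntegral.projection_combo (M.isSimplex hK) subset_rfl
    (QK_spec u hK).1 (QK_spec v hK).1 (QK_spec w hK).1 (QK_spec u hK).2 (QK_spec v hK).2
    (QK_spec w hK).2 h x (interior_subset hx), ev_add, ev_smul, ev_smul]

theorem elemBubble_eq {p : ℕ} (v : Finset (E d) → Poly d) {K : Finset (E d)} (hK : K ∈ M.elems) :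
    M.elemBubble p v K = QK p v K * bubble K K := by
  refine Finset.sum_eq_single_of_mem K hK fun K' hK' hne => ?_
  rw [(M.isSimplex hK).bubble_eq_zero fun h => hne ?_, mul_zero]
  exact Finset.eq_of_subset_of_card_le h (by rw [M.card_eq K hK, M.card_eq K' hK'])

theorem elemBubble_on_face {p : ℕ} (v : Finset (E d) → Poly d) {K F : Finset (E d)}
    (hK : K ∈ M.elems) (hF : F ∈ M.faces) (hFK : F ⊆ K) {x : E d} (hx : x ∈ hull F) :
    ev (M.elemBubble p v K) x = 0 := by
  rw [elemBubble_eq v hK, ev_mul, (M.isSimplex hK).bubble_eq_zero_on_face hFK _ hx, mul_zero]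
  intro h
  have := Finset.card_le_card h
  rw [M.card_eq K hK, M.card_face hF] at this
  omega

/-- The bubbles of all other faces vanish on `F`, and interpolation of order `p - 1 ≥ 1` at the
nodes of `F` reproduces the projection there. -/
theorem faceBubble_on_intFace (hd : 1 ≤ d) {p : ℕ} (hp : 2 ≤ p) {v : Finset (E d) → Poly d}
    (hv : M.IsCR p v) {K F : Finset (E d)} (hK : K ∈ M.elems) (hF : F ∈ M.intFaces) (hFK : F ⊆ K)
    {x : E d} (hx : x ∈ hull F) :
    ev (M.faceBubble p v K) x = ev (M.QF p v F) x * ev (bubble F K) x := by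
  rw [faceBubble, ev_sum, Finset.sum_eq_single_of_mem F hF]
  · rw [(M.isSimplex hK).ev_eq_sum_face (by omega : 1 ≤ p - 1) hFK (QF_spec hd hv hF).1 hx,
      Finset.sum_mul, ev_sum]
    simp only [ev_mul, ev_C]
  · intro F' hF' hne
    rw [ev_sum]
    refine Finset.sum_eq_zero fun z _ => ?_
    rw [ev_mul, (M.isSimplex hK).bubble_eq_zero_on_face hFK _ hx, mul_zero]
    exact fun h => hne (Finset.eq_of_subset_of_card_le h
      (by rw [M.card_face (intFaces_subset hF), M.card_face (intFaces_subset hF')]))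

theorem faceBubble_on_bdFace {p : ℕ} {v : Finset (E d) → Poly d}
    {K F : Finset (E d)} (hK : K ∈ M.elems) (hF : F ∈ M.bdFaces) (hFK : F ⊆ K)
    {x : E d} (hx : x ∈ hull F) : ev (M.faceBubble p v K) x = 0 := by
  rw [faceBubble, ev_sum]
  refine Finset.sum_eq_zero fun F' hF' => ?_
  rw [ev_sum]
  refine Finset.sum_eq_zero fun z _ => ?_
  rw [ev_mul, (M.isSimplex hK).bubble_eq_zero_on_face hFK _ hx, mul_zero]
  intro h
  have : F' = F := Finset.eq_of_subset_of_card_le h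
    (by rw [M.card_face (bdFaces_subset hF), M.card_face (intFaces_subset hF')])
  subst this
  exact (M.mem_intFaces.1 hF').2 (M.mem_bdFaces.1 hF).2

theorem isConforming_bubbleSmoother (hΩ : IsRegularDomain Ω) (hd : 1 ≤ d) {p : ℕ} (hp : 2 ≤ p)
    {v : Finset (E d) → Poly d} (hv : M.IsCR p v) : M.IsConforming (M.bubbleSmoother p v) := by
  refine isConforming_of_faces hΩ hd (fun K hK K' hK' _ F hF hFK hFK' x hx => ?_)
    fun K hK F hF hFK x hx => ?_
  · simp only [bubbleSmoother, Pi.add_apply, ev_add]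
    rw [elemBubble_on_face _ hK (intFaces_subset hF) hFK hx,
      elemBubble_on_face _ hK' (intFaces_subset hF) hFK' hx, faceBubble_on_intFace hd hp hv hK hF
      hFK hx, faceBubble_on_intFace hd hp hv hK' hF hFK' hx, bubble_congr hK hK' hFK hFK' hx]
  · simp only [bubbleSmoother, Pi.add_apply, ev_add]
    rw [elemBubble_on_face _ hK (bdFaces_subset hF) hFK hx, faceBubble_on_bdFace hK hF hFK hx,
      add_zero]

theorem bubbleSmoother_combo (hd : 1 ≤ d) {p : ℕ} (hp : 2 ≤ p) {u v w : Finset (E d) → Poly d}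
    (hu : M.IsCR p u) (hv : M.IsCR p v) (hw : M.IsCR p w) {a b : ℝ}
    (h : ∀ K ∈ M.elems, u K = a • v K + b • w K) {K : Finset (E d)} (hK : K ∈ M.elems) :
    M.bubbleSmoother p u K = a • M.bubbleSmoother p v K + b • M.bubbleSmoother p w K := by
  have h1 : M.faceBubble p u K = a • M.faceBubble p v K + b • M.faceBubble p w K := by
    simp only [faceBubble, Finset.smul_sum, ← Finset.sum_add_distrib]
    refine Finset.sum_congr rfl fun F hF => Finset.sum_congr rfl fun z hz => ?_
    rw [QF_combo hd hu hv hw h hF (nodes_subset_hull (by omega) hz)]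
    simp only [map_add, map_mul, MvPolynomial.smul_eq_C_mul]
    ring
  have h2 : (u - M.faceBubble p u) K = a • (v - M.faceBubble p v) K +
      b • (w - M.faceBubble p w) K := by
    simp only [Pi.sub_apply, h1, h K hK, smul_sub]
    abel
  simp only [bubbleSmoother, Pi.add_apply, elemBubble_eq _ hK, QK_combo hK h2, h1, smul_add,
    add_mul, smul_mul_assoc]
  abel

/-- The bubble smoother preserves moments on elements and faces. -/
theorem integral_sub_bubbleSmoother {p : ℕ} (v : Finset (E d) → Poly d)
    {K : Finset (E d)} (hK : K ∈ M.elems) {r : Poly d} (hr : r.totalDegree ≤ p - 2) :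
    ∫ x in hull K, ev (v K - M.bubbleSmoother p v K) x * ev r x = 0 := by
  have hI := (M.isSimplex hK).isSimplexIntegral
  have h1 : v K - M.bubbleSmoother p v K = (v - M.faceBubble p v) K -
      M.elemBubble p (v - M.faceBubble p v) K := by
    simp only [bubbleSmoother, Pi.sub_apply, Pi.add_apply]
    ring
  rw [h1, hI.ev_mul_sub, sub_eq_zero, ← (QK_spec (v - M.faceBubble p v) hK).2 r hr]
  refine hI.congr fun x _ => ?_
  rw [elemBubble_eq _ hK, ev_mul]
  ring

/-- Element bubbles vanish on faces, so the element correction leaves the face moments intact. On a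
boundary face the moments of `v` and the smoother both vanish. -/
theorem faceIntegral_sub_bubbleSmoother (hd : 1 ≤ d) {p : ℕ} (hp : 2 ≤ p)
    {v : Finset (E d) → Poly d} (hv : M.IsCR p v) {K F : Finset (E d)} (hK : K ∈ M.elems)
    (hFK : F ⊆ K) (hc : F.card = d) {q : Poly d} (hq : q.totalDegree ≤ p - 1) :
    faceIntegral F (fun x => ev (v K - M.bubbleSmoother p v K) x * ev q x) = 0 := by
  have hF : F ∈ M.faces := M.mem_faces.2 ⟨K, hK, hFK, hc⟩
  have hI := face_integral hd hK hF hFK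
  rw [hI.ev_mul_sub, sub_eq_zero]
  by_cases hFi : F ∈ M.intFaces
  · rw [← (QF_spec hd hv hFi).2 K hK hFK q hq]
    refine hI.congr fun x hx => ?_
    simp only [bubbleSmoother, Pi.add_apply, ev_add]
    rw [elemBubble_on_face _ hK hF hFK hx, faceBubble_on_intFace hd hp hv hK hFi hFK hx]
    ring
  · have hFb : F ∈ M.bdFaces := by
      rw [M.mem_bdFaces]
      rw [M.mem_intFaces] at hFi
      exact ⟨hF, by tauto⟩
    rw [hv.bd F hFb K hK hFK q hq]
    refine (hI.eq_zero fun x hx => ?_).symm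
    simp only [bubbleSmoother, Pi.add_apply, ev_add]
    rw [elemBubble_on_face _ hK hF hFK hx, faceBubble_on_bdFace hK hFb hFK hx]
    ring

/-! ### Nodal averaging -/

theorem mem_intNodes {p : ℕ} {z : E d} :
    z ∈ M.intNodes p ↔ (∃ K ∈ M.elems, z ∈ nodes p K) ∧ z ∈ Ω := by
  classical
  rw [intNodes, Finset.mem_filter]
  simp only [Finset.mem_biUnion]

theorem totalDegree_avg {p : ℕ} (hp : 1 ≤ p) (Kz : E d → Finset (E d))
    (v : Finset (E d) → Poly d) {K : Finset (E d)} (hK : K ∈ M.elems) :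
    (M.avg p Kz v K).totalDegree ≤ p := by
  refine MvPolynomial.totalDegree_finsetSum_le fun z _ => ?_
  refine (MvPolynomial.totalDegree_mul _ _).trans ?_
  rw [MvPolynomial.totalDegree_C, zero_add]
  exact (M.isSimplex hK).totalDegree_lagrange hp z

theorem isConforming_avg (hΩ : IsRegularDomain Ω) (hd : 1 ≤ d) {p : ℕ} (hp : 1 ≤ p)
    (Kz : E d → Finset (E d)) (v : Finset (E d) → Poly d) : M.IsConforming (M.avg p Kz v) := by
  refine isConforming_of_faces hΩ hd (fun K hK K' hK' _ F hF hFK hFK' x hx => ?_)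
    fun K hK F hF hFK x hx => ?_
  · simp only [avg, ev_sum, ev_mul]
    exact Finset.sum_congr rfl fun z _ => by
      rw [(M.isSimplex hK).lagrange_continuous hp (M.isSimplex hK') hFK hFK' z hx]
  · simp only [avg, ev_sum, ev_mul]
    refine Finset.sum_eq_zero fun z hz => ?_
    rw [(M.isSimplex hK).lagrange_eq_zero_on_face hp hFK (fun hzF => ?_) hx, mul_zero]
    have h1 := (M.mem_bdFaces.1 hF).2 (nodes_subset_hull hp hzF)
    rw [hΩ.isOpen.frontier_eq] at h1
    exact h1.2 (mem_intNodes.1 hz).2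

theorem ev_avg_node {p : ℕ} (hp : 1 ≤ p) (Kz : E d → Finset (E d)) (v : Finset (E d) → Poly d)
    {K : Finset (E d)} (hK : K ∈ M.elems) {z : E d} (hz : z ∈ nodes p K) :
    ev (M.avg p Kz v K) z = open Classical in if z ∈ Ω then ev (v (Kz z)) z else 0 := by
  classical
  simp only [avg, ev_sum, ev_mul, ev_C, ((M.isSimplex hK).lagrange_spec hp _).2 z hz, mul_ite,
    mul_one, mul_zero]
  rw [Finset.sum_ite_eq (M.intNodes p) z]
  refine if_congr ?_ rfl rfl
  rw [mem_intNodes]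
  exact ⟨fun h => h.2, fun h => ⟨⟨K, hK, hz⟩, h⟩⟩

theorem avg_eq_of_isConforming (hΩ : IsRegularDomain Ω) {p : ℕ} (hp : 1 ≤ p)
    {Kz : E d → Finset (E d)} (hKz : M.IsNodeChoice p Kz) {v : Finset (E d) → Poly d}
    (hv : M.IsConforming v) {K : Finset (E d)} (hK : K ∈ M.elems) (hdeg : (v K).totalDegree ≤ p) :
    M.avg p Kz v K = v K := by
  refine (M.isSimplex hK).eq_of_nodes hp (totalDegree_avg hp Kz v hK) hdeg fun z hz => ?_
  rw [ev_avg_node hp Kz v hK hz]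
  have hzK := nodes_subset_hull hp hz
  split_ifs with hzΩ
  · obtain ⟨h1, h2⟩ := hKz z (mem_intNodes.2 ⟨⟨K, hK, hz⟩, hzΩ⟩)
    exact hv.eq _ h1 K hK z h2 hzK
  · refine (hv.zero K hK z hzK ?_).symm
    rw [hΩ.isOpen.frontier_eq]
    exact ⟨M.hull_subset_closure hK hzK, hzΩ⟩

theorem avg_combo {p : ℕ} {Kz : E d → Finset (E d)} (hKz : M.IsNodeChoice p Kz)
    {u v w : Finset (E d) → Poly d} {a b : ℝ} (h : ∀ K ∈ M.elems, u K = a • v K + b • w K)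
    (K : Finset (E d)) : M.avg p Kz u K = a • M.avg p Kz v K + b • M.avg p Kz w K := by
  simp only [avg, Finset.smul_sum, ← Finset.sum_add_distrib]
  refine Finset.sum_congr rfl fun z hz => ?_
  rw [h _ (hKz z hz).1]
  simp only [ev_add, ev_mul, ev_C, map_add, map_mul, MvPolynomial.smul_eq_C_mul]
  ring

/-! ### The smoothing operator -/

theorem isCR_sub_avg (hΩ : IsRegularDomain Ω) (hd : 1 ≤ d) {p : ℕ} (hp : 1 ≤ p)
    (Kz : E d → Finset (E d)) {v : Finset (E d) → Poly d} (hv : M.IsCR p v) :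
    M.IsCR p (v - M.avg p Kz v) :=
  hv.sub hd ((isConforming_avg hΩ hd hp Kz v).isCR hd fun _ hK => totalDegree_avg hp Kz v hK)

theorem isConforming_smoothPieces (hΩ : IsRegularDomain Ω) (hd : 1 ≤ d) {p : ℕ} (hp : 2 ≤ p)
    (Kz : E d → Finset (E d)) {v : Finset (E d) → Poly d} (hv : M.IsCR p v) :
    M.IsConforming (M.smoothPieces p Kz v) :=
  (isConforming_avg hΩ hd (by omega) Kz v).add
    (isConforming_bubbleSmoother hΩ hd hp (isCR_sub_avg hΩ hd (by omega) Kz hv))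

theorem smoothPieces_combo (hΩ : IsRegularDomain Ω) (hd : 1 ≤ d) {p : ℕ} (hp : 2 ≤ p)
    {Kz : E d → Finset (E d)} (hKz : M.IsNodeChoice p Kz) {u v w : Finset (E d) → Poly d}
    (hu : M.IsCR p u) (hv : M.IsCR p v) (hw : M.IsCR p w) {a b : ℝ}
    (h : ∀ K ∈ M.elems, u K = a • v K + b • w K) {K : Finset (E d)} (hK : K ∈ M.elems) :
    M.smoothPieces p Kz u K = a • M.smoothPieces p Kz v K + b • M.smoothPieces p Kz w K := by
  have hp' : 1 ≤ p := by omega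
  simp only [smoothPieces, Pi.add_apply]
  rw [avg_combo hKz h, bubbleSmoother_combo hd hp (isCR_sub_avg hΩ hd hp' Kz hu)
    (isCR_sub_avg hΩ hd hp' Kz hv) (isCR_sub_avg hΩ hd hp' Kz hw) (a := a) (b := b) _ hK]
  · simp only [smul_add]
    abel
  · intro K hK
    simp only [Pi.sub_apply, h K hK, avg_combo hKz h, smul_sub]
    abel

theorem smoothPieces_eq_of_isConforming (hΩ : IsRegularDomain Ω) (hd : 1 ≤ d) {p : ℕ}
    (hp : 2 ≤ p) {Kz : E d → Finset (E d)} (hKz : M.IsNodeChoice p Kz)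
    {v : Finset (E d) → Poly d} (hv : M.IsConforming v)
    (hdeg : ∀ K ∈ M.elems, (v K).totalDegree ≤ p) {K : Finset (E d)} (hK : K ∈ M.elems) :
    M.smoothPieces p Kz v K = v K := by
  have hp' : 1 ≤ p := by omega
  have hcr := isCR_sub_avg hΩ hd hp' Kz (hv.isCR hd hdeg)
  -- Averaging already reproduces `v`. That the bubble smoother of the zero remainder vanishes is
  -- read off from linearity with zero coefficients.
  have h0 : ∀ K ∈ M.elems, (v - M.avg p Kz v) K = (0 : ℝ) • (v - M.avg p Kz v) K +
      (0 : ℝ) • (v - M.avg p Kz v) K := fun K hK => by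
    rw [Pi.sub_apply, avg_eq_of_isConforming hΩ hp' hKz hv hK (hdeg K hK)]
    simp
  simp only [smoothPieces, Pi.add_apply]
  rw [avg_eq_of_isConforming hΩ hp' hKz hv hK (hdeg K hK),
    bubbleSmoother_combo hd hp hcr hcr hcr h0 hK]
  simp

/-- Overconsistency of the smoothing operator on an element. -/
theorem integral_grad_sub_smoothPieces (hΩ : IsRegularDomain Ω) (hd : 1 ≤ d) {p : ℕ} (hp : 2 ≤ p)
    (Kz : E d → Finset (E d)) {v : Finset (E d) → Poly d} (hv : M.IsCR p v) {K : Finset (E d)}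
    (hK : K ∈ M.elems) {s : Poly d} (hs : s.totalDegree ≤ p) :
    ∫ x in hull K, inner ℝ (gradPoly s x) (gradPoly (v K - M.smoothPieces p Kz v K) x) = 0 := by
  have hcr := isCR_sub_avg hΩ hd (by omega : 1 ≤ p) Kz hv
  have h1 : v K - M.smoothPieces p Kz v K = (v - M.avg p Kz v) K -
      M.bubbleSmoother p (v - M.avg p Kz v) K := by
    simp only [smoothPieces, Pi.add_apply, Pi.sub_apply]
    ring
  rw [h1]
  exact (M.isSimplex hK).integral_grad_eq_zero hd hs
    (fun r hr => integral_sub_bubbleSmoother _ hK hr)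
    (fun F hFK hc q hq => faceIntegral_sub_bubbleSmoother hd hp hcr hK hFK hc hq)

end Mesh

end FEM

/-! ### Consequences of shape regularity: sizes, numbers of neighbours, chains. -/

namespace FEM

variable {d : ℕ}

/-! ### Shape regularity -/

/-- The diameter of a simplex. -/
def size (K : Finset (E d)) : ℝ := Metric.diam (hull K)

theorem size_nonneg (K : Finset (E d)) : 0 ≤ size K := Metric.diam_nonneg

theorem dist_le_size {K : Finset (E d)} {x y : E d} (hx : x ∈ hull K) (hy : y ∈ hull K) :
    dist x y ≤ size K := Metric.dist_le_diam_of_mem (isCompact_hull K).isBounded hx hy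

theorem mem_hull_of_mem {K : Finset (E d)} {z : E d} (hz : z ∈ K) : z ∈ hull K :=
  subset_convexHull ℝ _ hz

theorem two_mul_le_of_closedBall (hd : 1 ≤ d) {K : Finset (E d)} {x : E d} {r : ℝ} (hr : 0 ≤ r)
    (h : Metric.closedBall x r ⊆ hull K) : 2 * r ≤ size K := by
  let e : E d := EuclideanSpace.single ⟨0, hd⟩ 1
  have he : ‖e‖ = 1 := by simp [e]
  have h1 : x + r • e ∈ hull K := h (by simp [norm_smul, he, abs_of_nonneg hr])
  have h2 : x - r • e ∈ hull K := h (by simp [norm_smul, he, abs_of_nonneg hr])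
  have := dist_le_size h1 h2
  rwa [dist_eq_norm, show x + r • e - (x - r • e) = (2 * r) • e by module, norm_smul, he, mul_one,
    Real.norm_of_nonneg (by positivity)] at this

theorem IsSimplex.exists_closedBall {K : Finset (E d)} (hK : IsSimplex K) (hd : 1 ≤ d) {γ : ℝ}
    (hγ : 1 ≤ γ) (h : shapeCoeff K ≤ γ) :
    0 < size K ∧ ∃ x, Metric.closedBall x ((2 * γ)⁻¹ / 2 * size K) ⊆ hull K := by
  set T := {δ : ℝ | ∃ (x : E d) (r : ℝ), 0 ≤ r ∧ δ = 2 * r ∧ Metric.closedBall x r ⊆ hull K}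
    with hT
  have hbdd : BddAbove T := ⟨size K, by
    rintro _ ⟨x, r, hr, rfl, hx⟩
    exact two_mul_le_of_closedBall hd hr hx⟩
  obtain ⟨x₀, hx₀⟩ := hK.interior_nonempty
  obtain ⟨ε, hε, hball⟩ := Metric.isOpen_iff.1 isOpen_interior x₀ hx₀
  have hmem : 2 * (ε / 2) ∈ T := ⟨x₀, ε / 2, by positivity, rfl,
    (Metric.closedBall_subset_ball (half_lt_self hε)).trans (hball.trans interior_subset)⟩
  have hin : 0 < inDiam K := lt_of_lt_of_le (by positivity) (le_csSup hbdd hmem)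
  have hsz : 0 < size K := hin.trans_le (csSup_le ⟨_, hmem⟩ (by
    rintro _ ⟨x, r, hr, rfl, hx⟩
    exact two_mul_le_of_closedBall hd hr hx))
  refine ⟨hsz, ?_⟩
  rw [shapeCoeff, div_le_iff₀ hin] at h
  -- The extra factor `2` makes the inequality strict, so that some inscribed ball exceeds the bound
  -- without knowing that the supremum is attained.
  have hlt : (2 * γ)⁻¹ * size K < inDiam K := by
    have h1 : size K ≤ γ * inDiam K := h
    rw [inv_mul_lt_iff₀ (by positivity)]
    nlinarith
  obtain ⟨_, ⟨x, r, hr, rfl, hx⟩, hlt'⟩ := exists_lt_of_lt_csSup ⟨_, hmem⟩ hlt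
  exact ⟨x, (Metric.closedBall_subset_closedBall (by linarith)).trans hx⟩

/-- Distinct vertices have at least the distance of the diameter of an inscribed ball. -/
theorem IsSimplex.two_mul_le_dist {K : Finset (E d)} (hK : IsSimplex K) {x a b : E d} {r : ℝ}
    (hr : 0 ≤ r) (h : Metric.closedBall x r ⊆ hull K) (ha : a ∈ K) (hb : b ∈ K) (hab : a ≠ b) :
    2 * r ≤ dist b a := by
  have hpos : 0 < ‖b - a‖ := norm_pos_iff.2 (sub_ne_zero.2 (Ne.symm hab))
  -- Moving by `r` both ways along `b - a` changes the coordinate of `b` by `t` each time. As it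
  -- stays in `[0, 1]`, one gets `2 * t ≤ 1`.
  set t := r / ‖b - a‖ with ht
  have ht0 : 0 ≤ t := by positivity
  have htr : t * ‖b - a‖ = r := div_mul_cancel₀ _ hpos.ne'
  have h1 : x + t • (b - a) ∈ hull K := h (by
    simp [norm_smul, abs_of_nonneg ht0, htr])
  have h2 : x + (-t) • (b - a) ∈ hull K := h (by
    simp [norm_smul, abs_of_nonneg ht0, htr])
  have e1 := hK.lam_le_one h1 b
  have e2 := hK.lam_nonneg h2 b
  rw [hK.lam_add_smul_sub, hK.lam_vertex hb, hK.lam_vertex ha, if_pos rfl, if_neg hab] at e1 e2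
  have e3 : 2 * t ≤ 1 := by linarith
  rw [dist_eq_norm, ← htr]
  nlinarith

/-- Volume of the unit ball. -/
def unitVol (d : ℕ) : ℝ := (volume (Metric.ball (0 : E d) 1)).toReal

theorem unitVol_pos (d : ℕ) : 0 < unitVol d :=
  ENNReal.toReal_pos (Metric.measure_ball_pos volume _ one_pos).ne'
    Metric.isBounded_ball.measure_lt_top.ne

theorem volume_closedBall_toReal (x : E d) {r : ℝ} (hr : 0 ≤ r) :
    (volume (Metric.closedBall x r)).toReal = r ^ d * unitVol d := by
  rw [Measure.addHaar_closedBall _ _ hr, ENNReal.toReal_mul, ENNReal.toReal_ofReal (by positivity)]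
  simp [unitVol]

theorem volume_hull_le {K : Finset (E d)} (hK : IsSimplex K) :
    (volume (hull K)).toReal ≤ size K ^ d * unitVol d := by
  obtain ⟨z, hz⟩ := hK.nonempty
  rw [← volume_closedBall_toReal z (size_nonneg K)]
  refine ENNReal.toReal_mono (isCompact_closedBall z _).measure_lt_top.ne (measure_mono fun x hx => ?_)
  exact dist_le_size hx (mem_hull_of_mem hz)

theorem le_volume_hull {K : Finset (E d)} {x : E d} {r : ℝ} (hr : 0 ≤ r)
    (h : Metric.closedBall x r ⊆ hull K) : r ^ d * unitVol d ≤ (volume (hull K)).toReal := by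
  rw [← volume_closedBall_toReal x hr]
  exact ENNReal.toReal_mono (isCompact_hull K).measure_lt_top.ne (measure_mono h)

namespace Mesh

variable {Ω : Set (E d)} {M : Mesh Ω}

/-- Every element contains a ball of radius `κ` times its diameter. -/
structure IsShapeRegular (M : Mesh Ω) (κ : ℝ) : Prop where
  pos : 0 < κ
  le : κ ≤ 1 / 2
  size_pos : ∀ K ∈ M.elems, 0 < size K
  ball : ∀ K ∈ M.elems, ∃ x, Metric.closedBall x (κ * size K) ⊆ hull K

theorem isShapeRegular_of_shape_le (hd : 1 ≤ d) {γ : ℝ} (hγ : 1 ≤ γ) (h : M.shape ≤ γ) :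
    M.IsShapeRegular ((2 * γ)⁻¹ / 2) := by
  have key : ∀ K ∈ M.elems, shapeCoeff K ≤ γ := fun K hK => by
    refine le_trans ?_ h
    exact le_ciSup (f := fun K : {K : Finset (E d) // K ∈ M.elems} => shapeCoeff K.1)
      (Set.finite_range _).bddAbove ⟨K, hK⟩
  refine ⟨by positivity, ?_, fun K hK => ((M.isSimplex hK).exists_closedBall hd hγ (key K hK)).1,
    fun K hK => ((M.isSimplex hK).exists_closedBall hd hγ (key K hK)).2⟩
  have : (2 * γ)⁻¹ ≤ 1 := inv_le_one_of_one_le₀ (by linarith)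
  linarith

/-- Elements sharing two vertices have comparable diameters. -/
theorem IsShapeRegular.size_le {κ : ℝ} (hM : M.IsShapeRegular κ) {K K' : Finset (E d)}
    (hK : K ∈ M.elems) {a b : E d} (hab : a ≠ b) (ha : a ∈ K)
    (hb : b ∈ K) (ha' : a ∈ K') (hb' : b ∈ K') : 2 * κ * size K ≤ size K' := by
  obtain ⟨x, hx⟩ := hM.ball K hK
  have := (M.isSimplex hK).two_mul_le_dist (mul_nonneg hM.pos.le (size_nonneg K)) hx ha hb hab
  linarith [dist_le_size (mem_hull_of_mem hb') (mem_hull_of_mem ha')]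

variable (M) in
/-- The elements with a given vertex. -/
def vertexStar (v : E d) : Finset (Finset (E d)) :=
  open Classical in M.elems.filter fun K => v ∈ K

theorem mem_vertexStar {v : E d} {K : Finset (E d)} :
    K ∈ M.vertexStar v ↔ K ∈ M.elems ∧ v ∈ K := by
  classical
  simp [vertexStar]

/-- The number of elements sharing a vertex is bounded in terms of the shape regularity. -/
theorem IsShapeRegular.card_vertexStar_le {κ : ℝ} (hM : M.IsShapeRegular κ) (v : E d) :
    ((M.vertexStar v).card : ℝ) ≤ (3 / κ) ^ d := by
  have hκ := hM.pos
  choose! x hx using hM.ball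
  -- Each element is rescaled about `v` to unit diameter; the inscribed ball becomes a ball of
  -- radius `κ` around `c K`. These balls are disjoint and lie within distance `3` of `v`, so their
  -- number is bounded by comparing volumes.
  let c : Finset (E d) → E d := fun K => v + (size K)⁻¹ • (x K - v)
  have key : ∀ K ∈ M.vertexStar v, ∀ y ∈ Metric.ball (c K) κ, ∀ t, 0 < t → t ≤ size K →
      v + t • (y - v) ∈ interior (hull K) := by
    intro K hKv y hy t ht htK
    obtain ⟨hK, hvK⟩ := mem_vertexStar.1 hKv
    have hs := hM.size_pos K hK
    have hy' : v + size K • (y - v) ∈ interior (hull K) := by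
      refine interior_mono (hx K hK) (Metric.ball_subset_interior_closedBall ?_)
      rw [Metric.mem_ball, dist_eq_norm] at hy ⊢
      have : v + size K • (y - v) - x K = size K • (y - c K) := by
        simp only [c, smul_sub, smul_add, smul_smul, mul_inv_cancel₀ hs.ne', one_smul]
        module
      rw [this, norm_smul, Real.norm_of_nonneg hs.le, mul_comm κ]
      exact mul_lt_mul_of_pos_left hy hs
    rw [(M.isSimplex hK).mem_interior] at hy' ⊢
    intro z hz
    have hcomb : v + t • (y - v) = (1 - t / size K) • v + (t / size K) • (v + size K • (y - v)) := by
      simp only [smul_add, smul_smul, div_mul_cancel₀ _ hs.ne']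
      module
    rw [hcomb, (M.isSimplex hK).lam_combo _ _ _ _ _ (by ring)]
    have h1 : 0 ≤ 1 - t / size K := by rw [sub_nonneg, div_le_one hs]; exact htK
    have h2 : 0 < t / size K := by positivity
    have := mul_nonneg h1 ((M.isSimplex hK).lam_nonneg (mem_hull_of_mem hvK) z)
    have := mul_pos h2 (hy' z hz)
    linarith
  -- If two of the balls met, scaling a common point back towards `v` by the smaller diameter would
  -- give a point interior to both elements.
  have hdisj : ((M.vertexStar v : Finset (Finset (E d))) : Set (Finset (E d))).PairwiseDisjoint
      fun K => Metric.ball (c K) κ := by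
    intro K hK K' hK' hne
    refine Set.disjoint_left.2 fun y hy hy' => hne ?_
    have hKe := (mem_vertexStar.1 hK).1
    have hKe' := (mem_vertexStar.1 hK').1
    have ht : 0 < min (size K) (size K') := lt_min (hM.size_pos K hKe) (hM.size_pos K' hKe')
    exact M.eq_of_mem_interior hKe hKe' (key K hK y hy _ ht (min_le_left _ _))
      (interior_subset (key K' hK' y hy' _ ht (min_le_right _ _)))
  have hsub : (⋃ K ∈ M.vertexStar v, Metric.ball (c K) κ) ⊆ Metric.closedBall v 3 := by
    refine Set.iUnion₂_subset fun K hKv y hy => ?_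
    obtain ⟨hK, hvK⟩ := mem_vertexStar.1 hKv
    have hs := hM.size_pos K hK
    have hxK : x K ∈ hull K := hx K hK (Metric.mem_closedBall_self (by positivity))
    have h1 : dist (c K) v ≤ 1 := by
      rw [dist_eq_norm, add_sub_cancel_left, norm_smul, norm_inv, Real.norm_of_nonneg hs.le,
        inv_mul_le_iff₀ hs, mul_one, ← dist_eq_norm]
      exact dist_le_size hxK (mem_hull_of_mem hvK)
    rw [Metric.mem_closedBall]
    have := dist_triangle y (c K) v
    have h2 := Metric.mem_ball.1 hy
    have := hM.le
    linarith
  have hvol := measure_mono (μ := volume) hsub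
  rw [measure_biUnion_finset hdisj fun _ _ => Metric.isOpen_ball.measurableSet] at hvol
  have hball : ∀ K ∈ M.vertexStar v, volume (Metric.ball (c K) κ) =
      volume (Metric.closedBall (0 : E d) κ) := by
    intro K _
    rw [Measure.addHaar_ball_of_pos _ _ hκ, Measure.addHaar_closedBall _ _ hκ.le]
  rw [Finset.sum_congr rfl hball, Finset.sum_const, nsmul_eq_mul] at hvol
  have hreal := ENNReal.toReal_mono (isCompact_closedBall v 3).measure_lt_top.ne hvol
  rw [ENNReal.toReal_mul, volume_closedBall_toReal _ hκ.le, volume_closedBall_toReal _ (by norm_num),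
    ENNReal.toReal_natCast, ← mul_assoc] at hreal
  have h3 := le_of_mul_le_mul_right hreal (unitVol_pos d)
  rw [div_pow, le_div_iff₀ (by positivity)]
  exact h3

/-- Any vertex with positive coordinate at `z` belongs to all elements containing `z`. The elements
around an arbitrary node are thus counted by the star of one vertex. -/
theorem exists_common_vertex {K : Finset (E d)} (hK : K ∈ M.elems) {z : E d} (hz : z ∈ hull K) :
    ∃ v ∈ K, ∀ K' ∈ M.elems, z ∈ hull K' → v ∈ K' := by
  obtain ⟨v, hv, hpos⟩ : ∃ v ∈ K, 0 < lam K v z := by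
    by_contra! h
    have := (M.isSimplex hK).sum_lam z
    have h2 : ∑ v ∈ K, lam K v z ≤ 0 := Finset.sum_nonpos h
    linarith
  exact ⟨v, hv, fun K' hK' hz' => M.mem_of_lam_pos hK hK' hz hz' hpos⟩

variable (M) in
/-- The graph of the elements containing `z`, adjacent if they share an interior face
containing `z`. -/
def nodeGraph (z : E d) : SimpleGraph {K : Finset (E d) // K ∈ M.elems ∧ z ∈ hull K} where
  Adj K K' := K ≠ K' ∧ ∃ F ∈ M.intFaces, F ⊆ K.1 ∧ F ⊆ K'.1 ∧ z ∈ hull F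
  symm := ⟨fun _ _ ⟨hne, F, hF, h1, h2, hz⟩ => ⟨hne.symm, F, hF, h2, h1, hz⟩⟩
  loopless := ⟨fun _ h => h.1 rfl⟩

theorem propagates_reachable (z : E d) (K₀ : {K : Finset (E d) // K ∈ M.elems ∧ z ∈ hull K}) :
    M.Propagates z fun K => ∃ h : K ∈ M.elems ∧ z ∈ hull K,
      (M.nodeGraph z).Reachable K₀ ⟨K, h⟩ := by
  rintro K hK K' hK' F hF hFK hFK' hz ⟨h, hr⟩
  have h' : K' ∈ M.elems ∧ z ∈ hull K' := ⟨hK', convexHull_mono (Finset.coe_subset.2 hFK') hz⟩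
  refine ⟨h', ?_⟩
  by_cases hne : K = K'
  · subst hne
    exact hr
  · exact hr.trans (SimpleGraph.Adj.reachable ⟨fun h => hne (congrArg Subtype.val h), F, hF, hFK,
      hFK', hz⟩)

/-- A path visits each element at most once, and all its elements share a vertex. -/
theorem IsShapeRegular.exists_walk {κ : ℝ} (hM : M.IsShapeRegular κ) {z : E d}
    {K K' : {K : Finset (E d) // K ∈ M.elems ∧ z ∈ hull K}}
    (h : (M.nodeGraph z).Reachable K K') :
    ∃ w : (M.nodeGraph z).Walk K K', (w.length : ℝ) ≤ (3 / κ) ^ d := by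
  classical
  obtain ⟨w, hw⟩ := h.exists_isPath
  refine ⟨w, ?_⟩
  obtain ⟨v, _, hv⟩ := exists_common_vertex K.2.1 K.2.2
  have hfin : Finite {K : Finset (E d) // K ∈ M.elems ∧ z ∈ hull K} :=
    Finite.of_injective (β := {K // K ∈ M.elems}) (fun K => ⟨K.1, K.2.1⟩) fun a b hab =>
      Subtype.ext (congrArg (fun K : {K // K ∈ M.elems} => K.1) hab)
  let _ := Fintype.ofFinite {K : Finset (E d) // K ∈ M.elems ∧ z ∈ hull K}
  have hcard : Fintype.card {K : Finset (E d) // K ∈ M.elems ∧ z ∈ hull K} ≤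
      (M.vertexStar v).card := by
    rw [← Fintype.card_coe]
    exact Fintype.card_le_of_injective
      (fun K => (⟨K.1, mem_vertexStar.2 ⟨K.2.1, hv _ K.2.1 K.2.2⟩⟩ : {K // K ∈ M.vertexStar v}))
      fun a b hab => Subtype.ext (congrArg (fun K : {K // K ∈ M.vertexStar v} => K.1) hab)
  have h1 : w.length ≤ (M.vertexStar v).card := hw.length_lt.le.trans hcard
  exact (Nat.cast_le.2 h1).trans (hM.card_vertexStar_le v)

end Mesh

end FEM

/-! ### Nodal estimates for averaging and maximum norm bounds for the bubble smoother. -/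

namespace FEM

variable {d : ℕ}

namespace Mesh

variable {Ω : Set (E d)} {M : Mesh Ω}

/-! ### Nodal estimates -/

variable (M) in
/-- The elements sharing a vertex with `K` that are not much smaller than `K`. -/
def patch (θ : ℝ) (K : Finset (E d)) : Finset (Finset (E d)) :=
  open Classical in M.elems.filter fun K' => (∃ v ∈ K, v ∈ K') ∧ θ * size K ≤ size K'

theorem mem_patch {θ : ℝ} {K K' : Finset (E d)} :
    K' ∈ M.patch θ K ↔ K' ∈ M.elems ∧ (∃ v ∈ K, v ∈ K') ∧ θ * size K ≤ size K' := by
  classical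
  simp [patch]

/-- `o` bounds the oscillation of the pieces. -/
def OscBound (M : Mesh Ω) (v : Finset (E d) → Poly d) (o : Finset (E d) → ℝ) : Prop :=
  ∀ K ∈ M.elems, 0 ≤ o K ∧ ∀ x ∈ hull K, ∀ y ∈ hull K, |ev (v K) x - ev (v K) y| ≤ o K

/-- The moment against `1` shows that the jump has mean zero on the face, so it is bounded by its
own oscillation there. -/
theorem OscBound.abs_jump_le (hd : 1 ≤ d) {p : ℕ} {v : Finset (E d) → Poly d} (hv : M.IsCR p v)
    {o : Finset (E d) → ℝ} (ho : M.OscBound v o) {K K' F : Finset (E d)} (hK : K ∈ M.elems)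
    (hK' : K' ∈ M.elems) (hF : F ∈ M.intFaces) (hFK : F ⊆ K) (hFK' : F ⊆ K') {z : E d}
    (hz : z ∈ hull F) : |ev (v K) z - ev (v K') z| ≤ o K + o K' := by
  have hsub : ∀ {K : Finset (E d)}, F ⊆ K → hull F ⊆ hull K := fun h =>
    convexHull_mono (Finset.coe_subset.2 h)
  have hI := face_integral hd hK (intFaces_subset hF) hFK
  have h0 : faceIntegral F (fun x => ev (v K - v K') x) = 0 := by
    have := hv.int F hF K hK K' hK' hFK hFK' 1 (by simp)
    rw [← sub_eq_zero, ← hI.ev_mul_sub] at this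
    simpa using this
  have := hI.abs_le_of_mean_zero (continuous_ev _) h0 (x := z) (B := o K + o K') fun y hy => by
    have h1 := (ho K hK).2 z (hsub hFK hz) y (hsub hFK hy)
    have h2 := (ho K' hK').2 z (hsub hFK' hz) y (hsub hFK' hy)
    rw [ev_sub, ev_sub]
    rw [abs_le] at h1 h2 ⊢
    constructor <;> linarith
  rwa [ev_sub] at this

theorem OscBound.abs_le_of_bdFace (hd : 1 ≤ d) {p : ℕ} {v : Finset (E d) → Poly d}
    (hv : M.IsCR p v) {o : Finset (E d) → ℝ} (ho : M.OscBound v o) {K F : Finset (E d)}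
    (hK : K ∈ M.elems) (hF : F ∈ M.bdFaces) (hFK : F ⊆ K) {z : E d} (hz : z ∈ hull F) :
    |ev (v K) z| ≤ o K := by
  have hsub : hull F ⊆ hull K := convexHull_mono (Finset.coe_subset.2 hFK)
  refine (face_integral hd hK (bdFaces_subset hF) hFK).abs_le_of_mean_zero (continuous_ev _) ?_
    fun y hy => (ho K hK).2 z (hsub hz) y (hsub hy)
  simpa using hv.bd F hF K hK hFK 1 (by simp)

/-- Jumps telescope along the walk, each bounded by two oscillations. Consecutive elements share a
face, which for `d ≥ 2` has two vertices, so sizes shrink by at most the factor `2 * κ`. The index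
`j` counts the steps already taken from `K₀` and keeps the whole walk in the patch. -/
theorem IsShapeRegular.walk_bound {κ : ℝ} (hM : M.IsShapeRegular κ) (hd : 2 ≤ d) {p : ℕ}
    {v : Finset (E d) → Poly d} (hv : M.IsCR p v) {o : Finset (E d) → ℝ} (ho : M.OscBound v o)
    {z : E d} {K₀ : Finset (E d)} (hK₀ : K₀ ∈ M.elems) (hz₀ : z ∈ hull K₀) {N : ℕ}
    {A B : {K : Finset (E d) // K ∈ M.elems ∧ z ∈ hull K}} (w : (M.nodeGraph z).Walk A B) :
    ∀ j : ℕ, (2 * κ) ^ j * size K₀ ≤ size A.1 → j + w.length ≤ N →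
      |ev (v A.1) z - ev (v B.1) z| ≤
          2 * w.length * ∑ K ∈ M.patch ((2 * κ) ^ N) K₀, o K ∧
        B.1 ∈ M.patch ((2 * κ) ^ N) K₀ := by
  have hκ := hM.pos
  have hpatch : ∀ (j : ℕ) (A : {K : Finset (E d) // K ∈ M.elems ∧ z ∈ hull K}),
      (2 * κ) ^ j * size K₀ ≤ size A.1 → j ≤ N → A.1 ∈ M.patch ((2 * κ) ^ N) K₀ := by
    intro j A hj hjN
    obtain ⟨x, hx, hxv⟩ := exists_common_vertex hK₀ hz₀
    refine mem_patch.2 ⟨A.2.1, ⟨x, hx, hxv _ A.2.1 A.2.2⟩, le_trans ?_ hj⟩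
    have : (2 * κ) ^ N ≤ (2 * κ) ^ j :=
      pow_le_pow_of_le_one (by positivity) (by linarith [hM.le]) hjN
    exact mul_le_mul_of_nonneg_right this (size_nonneg _)
  have hle : ∀ K ∈ M.patch ((2 * κ) ^ N) K₀, o K ≤ ∑ K ∈ M.patch ((2 * κ) ^ N) K₀, o K :=
    fun K hK => Finset.single_le_sum (f := o) (fun K' hK' => (ho K' (mem_patch.1 hK').1).1) hK
  induction w with
  | nil =>
    intro j hj hjN
    exact ⟨by simp, hpatch j _ hj (by simpa using hjN)⟩
  | @cons A A' B hadj w ih =>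
    intro j hj hjN
    rw [SimpleGraph.Walk.length_cons] at hjN ⊢
    obtain ⟨-, F, hF, hFA, hFA', hzF⟩ := hadj
    obtain ⟨a, ha, b, hb, hab⟩ := Finset.one_lt_card.1
      (show 1 < F.card by rw [M.card_face (intFaces_subset hF)]; omega)
    have hsz := hM.size_le A.2.1 hab (hFA ha) (hFA hb) (hFA' ha) (hFA' hb)
    have hj' : (2 * κ) ^ (j + 1) * size K₀ ≤ size A'.1 := by
      rw [pow_succ]
      nlinarith
    obtain ⟨h1, h2⟩ := ih (j + 1) hj' (by omega)
    refine ⟨?_, h2⟩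
    have h3 := ho.abs_jump_le (by omega) hv A.2.1 A'.2.1 hF hFA hFA' hzF
    have h4 := hle _ (hpatch j A hj (by omega))
    have h5 := hle _ (hpatch (j + 1) A' hj' (by omega))
    have h6 := abs_sub_le (ev (v A.1) z) (ev (v A'.1) z) (ev (v B.1) z)
    push_cast
    linarith

variable (d) in
/-- An upper bound for the number of elements sharing a vertex. -/
def starBound (κ : ℝ) : ℕ := ⌈(3 / κ) ^ d⌉₊

/-- At an interior node the chain leads from `K` to the chosen element. At a boundary node the
average is zero and the chain ends at a boundary face, where the value is bounded by one further
oscillation; this is the `+ 1`. -/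
theorem IsShapeRegular.abs_sub_avg_node_le (hΩ : IsRegularDomain Ω) {κ : ℝ}
    (hM : M.IsShapeRegular κ) (hd : 2 ≤ d) {p : ℕ} (hp : 1 ≤ p) {Kz : E d → Finset (E d)}
    (hKz : M.IsNodeChoice p Kz) {v : Finset (E d) → Poly d} (hv : M.IsCR p v)
    {o : Finset (E d) → ℝ} (ho : M.OscBound v o) {K : Finset (E d)} (hK : K ∈ M.elems) {z : E d}
    (hz : z ∈ nodes p K) :
    |ev ((v - M.avg p Kz v) K) z| ≤ (2 * starBound d κ + 1) *
      ∑ K' ∈ M.patch ((2 * κ) ^ starBound d κ) K, o K' := by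
  classical
  have hzK := nodes_subset_hull hp hz
  have hlen : ∀ {A B : {K : Finset (E d) // K ∈ M.elems ∧ z ∈ hull K}},
      (M.nodeGraph z).Reachable A B → ∃ w : (M.nodeGraph z).Walk A B,
        w.length ≤ starBound d κ := by
    intro A B hr
    obtain ⟨w, hw⟩ := hM.exists_walk hr
    exact ⟨w, by exact_mod_cast hw.trans (Nat.le_ceil _)⟩
  set S := ∑ K' ∈ M.patch ((2 * κ) ^ starBound d κ) K, o K' with hS
  have hS0 : 0 ≤ S := Finset.sum_nonneg fun K' hK' => (ho K' (mem_patch.1 hK').1).1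
  have hwalk : ∀ K' (h : K' ∈ M.elems ∧ z ∈ hull K'),
      (M.nodeGraph z).Reachable ⟨K, hK, hzK⟩ ⟨K', h⟩ →
      |ev (v K) z - ev (v K') z| ≤ 2 * starBound d κ * S ∧
        K' ∈ M.patch ((2 * κ) ^ starBound d κ) K := by
    intro K' h hr
    obtain ⟨w, hw⟩ := hlen hr
    obtain ⟨h1, h2⟩ := hM.walk_bound hd hv ho hK hzK (N := starBound d κ) w 0 (by simp)
      (by omega)
    refine ⟨h1.trans ?_, h2⟩
    have : (w.length : ℝ) ≤ starBound d κ := by exact_mod_cast hw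
    gcongr
  have hprop := M.propagates_reachable z ⟨K, hK, hzK⟩
  have hstart : ∃ h : K ∈ M.elems ∧ z ∈ hull K,
      (M.nodeGraph z).Reachable ⟨K, hK, hzK⟩ ⟨K, h⟩ := ⟨⟨hK, hzK⟩, SimpleGraph.Reachable.refl _⟩
  rw [Pi.sub_apply, ev_sub, ev_avg_node hp Kz v hK hz]
  split_ifs with hzΩ
  · obtain ⟨h1, h2⟩ := hKz z (mem_intNodes.2 ⟨⟨K, hK, hz⟩, hzΩ⟩)
    obtain ⟨h, hr⟩ := M.propagate_interior hΩ.isOpen (by omega) hzΩ hprop hK h1 hzK h2 hstart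
    linarith [(hwalk _ h hr).1]
  · obtain ⟨K', hK', ⟨h, hr⟩, F, hF, hFK', hzF⟩ := M.propagate_boundary hΩ.interior_closure
      hΩ.isOpen (by omega) hzΩ hprop hK hzK hstart
    obtain ⟨h1, h2⟩ := hwalk _ h hr
    have h3 := ho.abs_le_of_bdFace (by omega) hv hK' hF hFK' hzF
    have h4 : o K' ≤ S := Finset.single_le_sum (f := o)
      (fun K' hK' => (ho K' (mem_patch.1 hK').1).1) h2
    rw [sub_zero]
    rw [abs_le] at h1 h3 ⊢
    constructor <;> linarith

/-! ### Stability of the bubble smoother in the maximum norm -/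

theorem exists_faceBubble_bound (d p : ℕ) (hd : 1 ≤ d) (hp : 2 ≤ p) : ∃ A : ℝ, 0 ≤ A ∧
    ∀ {Ω : Set (E d)} {M : Mesh Ω} {u : Finset (E d) → Poly d}, M.IsCR p u →
      ∀ {K : Finset (E d)}, K ∈ M.elems → ∀ {B : ℝ}, (∀ x ∈ hull K, |ev (u K) x| ≤ B) →
      ∀ x ∈ hull K, |ev (M.faceBubble p u K) x| ≤ A * B := by
  obtain ⟨A, hA, h⟩ := exists_projection_bound (d - 1) (p - 1)
  -- The factors bound the number of faces of `K` by the number of its vertex subsets, the number of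
  -- nodes of order `p - 1` on a face, the projection, and a Lagrange function of order `p - 1`.
  refine ⟨2 ^ (d + 1) * (p ^ d * (A * ((p - 1 : ℕ) : ℝ) ^ (p - 1))), by positivity, ?_⟩
  intro Ω M u hu K hK B hB x hx
  classical
  have hs := M.isSimplex hK
  have hB0 : 0 ≤ B := (abs_nonneg _).trans (hB x hx)
  have hQ : ∀ F ∈ M.intFaces, F ⊆ K → ∀ y ∈ hull F, |ev (M.QF p u F) y| ≤ A * B := by
    intro F hF hFK
    have hspec := QF_spec hd hu hF
    exact h (face_integral hd hK (intFaces_subset hF) hFK) hs hFK _ (u K) B hspec.1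
      (fun y hy => hB y (convexHull_mono (Finset.coe_subset.2 hFK) hy)) (hspec.2 K hK hFK _ hspec.1)
  have hF : ∀ F ∈ M.intFaces, |ev (∑ z ∈ nodes (p - 1) F, MvPolynomial.C (ev (M.QF p u F) z) *
      lagrange (p - 1) z K * bubble F K) x| ≤
      if F ⊆ K then p ^ d * (A * ((p - 1 : ℕ) : ℝ) ^ (p - 1) * B) else 0 := by
    intro F hF
    split_ifs with hFK
    · rw [ev_sum]
      refine (Finset.abs_sum_le_sum_abs _ _).trans ?_
      have hcard : ((nodes (p - 1) F).card : ℝ) ≤ p ^ d := by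
        have := card_nodes_le (p - 1) F
        rw [M.card_face (intFaces_subset hF), Nat.sub_add_cancel (by omega)] at this
        exact_mod_cast this
      refine (Finset.sum_le_card_nsmul _ _ (A * ((p - 1 : ℕ) : ℝ) ^ (p - 1) * B) fun z hz => ?_).trans
        (by rw [nsmul_eq_mul]; gcongr)
      rw [ev_mul, ev_mul, ev_C, abs_mul, abs_mul]
      have h1 := hQ F hF hFK z (nodes_subset_hull (by omega) hz)
      have h2 := hs.abs_lagrange_le (by omega : 1 ≤ p - 1) z hx
      have h3 : |ev (bubble F K) x| ≤ 1 :=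
        abs_le.2 ⟨by linarith [hs.bubble_nonneg F hx], hs.bubble_le_one F hx⟩
      calc _ ≤ A * B * ((p - 1 : ℕ) : ℝ) ^ (p - 1) * 1 := by gcongr
        _ = _ := by ring
    · rw [ev_sum]
      refine le_of_eq ?_
      rw [abs_eq_zero]
      refine Finset.sum_eq_zero fun z _ => ?_
      rw [hs.bubble_eq_zero hFK, mul_zero, ev_zero]
  rw [faceBubble, ev_sum]
  refine (Finset.abs_sum_le_sum_abs _ _).trans ((Finset.sum_le_sum hF).trans ?_)
  rw [← Finset.sum_filter, Finset.sum_const, nsmul_eq_mul]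
  have hcard : ((M.intFaces.filter fun F => F ⊆ K).card : ℝ) ≤ 2 ^ (d + 1) := by
    have h1 : M.intFaces.filter (fun F => F ⊆ K) ⊆ K.powerset := fun F hF =>
      Finset.mem_powerset.2 (Finset.mem_filter.1 hF).2
    have h2 := Finset.card_le_card h1
    rw [Finset.card_powerset, M.card_eq K hK] at h2
    exact_mod_cast h2
  calc _ ≤ (2 : ℝ) ^ (d + 1) * (p ^ d * (A * ((p - 1 : ℕ) : ℝ) ^ (p - 1) * B)) := by gcongr
    _ = _ := by ring

theorem exists_sub_bubbleSmoother_bound (d p : ℕ) (hd : 1 ≤ d) (hp : 2 ≤ p) : ∃ A : ℝ, 0 ≤ A ∧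
    ∀ {Ω : Set (E d)} {M : Mesh Ω} {u : Finset (E d) → Poly d}, M.IsCR p u →
      ∀ {K : Finset (E d)}, K ∈ M.elems → ∀ {B : ℝ}, (∀ x ∈ hull K, |ev (u K) x| ≤ B) →
      ∀ x ∈ hull K, |ev (u K - M.bubbleSmoother p u K) x| ≤ A * B := by
  obtain ⟨A₁, hA₁, h₁⟩ := exists_faceBubble_bound d p hd hp
  obtain ⟨A₂, hA₂, h₂⟩ := exists_projection_bound d (p - 2)
  refine ⟨(1 + A₂) * (1 + A₁), by positivity, ?_⟩
  intro Ω M u hu K hK B hB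
  have hs := M.isSimplex hK
  set r := u - M.faceBubble p u with hr
  have hrB : ∀ x ∈ hull K, |ev (r K) x| ≤ (1 + A₁) * B := fun x hx => by
    rw [hr, Pi.sub_apply, ev_sub]
    refine (abs_sub _ _).trans ?_
    linarith [hB x hx, h₁ hu hK hB x hx]
  have hQ : ∀ x ∈ hull K, |ev (QK p r K) x| ≤ A₂ * ((1 + A₁) * B) :=
    h₂ hs.isSimplexIntegral hs subset_rfl _ (r K) _ (QK_spec r hK).1 hrB
      ((QK_spec r hK).2 _ (QK_spec r hK).1)
  intro x hx
  have e : u K - M.bubbleSmoother p u K = r K - QK p r K * bubble K K := by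
    simp only [bubbleSmoother, Pi.add_apply, elemBubble_eq _ hK, hr, Pi.sub_apply]
    ring
  rw [e, ev_sub, ev_mul]
  have h3 : |ev (bubble K K) x| ≤ 1 :=
    abs_le.2 ⟨by linarith [hs.bubble_nonneg K hx], hs.bubble_le_one K hx⟩
  have h4 : |ev (QK p r K) x * ev (bubble K K) x| ≤ A₂ * ((1 + A₁) * B) := by
    rw [abs_mul]
    have h5 := hQ x hx
    calc _ ≤ |ev (QK p r K) x| * 1 := by gcongr
      _ ≤ _ := by rw [mul_one]; exact h5
  refine (abs_sub _ _).trans ?_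
  linarith [hrB x hx]

theorem totalDegree_bubbleSmoother {p : ℕ} (hp : 2 ≤ p) (u : Finset (E d) → Poly d)
    {K : Finset (E d)} (hK : K ∈ M.elems) :
    (M.bubbleSmoother p u K).totalDegree ≤ p + d := by
  have hs := M.isSimplex hK
  refine (MvPolynomial.totalDegree_add _ _).trans (max_le ?_ ?_)
  · refine MvPolynomial.totalDegree_finsetSum_le fun F hF => ?_
    refine MvPolynomial.totalDegree_finsetSum_le fun z _ => ?_
    refine (MvPolynomial.totalDegree_mul _ _).trans ?_
    have h1 := MvPolynomial.totalDegree_mul (MvPolynomial.C (ev (M.QF p u F) z))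
      (lagrange (p - 1) z K)
    rw [MvPolynomial.totalDegree_C] at h1
    have h2 := hs.totalDegree_lagrange (by omega : 1 ≤ p - 1) z
    have h3 := hs.totalDegree_bubble F
    rw [M.card_face (intFaces_subset hF)] at h3
    omega
  · rw [elemBubble_eq _ hK]
    refine (MvPolynomial.totalDegree_mul _ _).trans ?_
    have h1 := (QK_spec (p := p) (u - M.faceBubble p u) hK).1
    have h3 := hs.totalDegree_bubble K
    rw [M.card_eq K hK] at h3
    omega

end Mesh

end FEM

/-! ### Energy norm stability of the smoothing operator. -/

namespace FEM

variable {d : ℕ}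

namespace Mesh

variable {Ω : Set (E d)} {M : Mesh Ω}

/-! ### Stability of the smoothing operator in the energy norm -/

theorem IsShapeRegular.card_vertexStar_le_starBound {κ : ℝ} (hM : M.IsShapeRegular κ) (v : E d) :
    (M.vertexStar v).card ≤ starBound d κ := by
  exact_mod_cast (hM.card_vertexStar_le v).trans (Nat.le_ceil _)

theorem IsShapeRegular.card_biUnion_le {κ : ℝ} (hM : M.IsShapeRegular κ) {K : Finset (E d)}
    (hK : K ∈ M.elems) {T : Finset (Finset (E d))}
    (hT : ∀ K' ∈ T, K' ∈ M.elems ∧ ∃ v ∈ K, v ∈ K') : T.card ≤ (d + 1) * starBound d κ := by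
  classical
  have h1 : T ⊆ K.biUnion M.vertexStar := fun K' hK' => by
    obtain ⟨h, v, hv, hv'⟩ := hT K' hK'
    exact Finset.mem_biUnion.2 ⟨v, hv, mem_vertexStar.2 ⟨h, hv'⟩⟩
  refine (Finset.card_le_card h1).trans ?_
  rw [← M.card_eq K hK]
  exact Finset.card_biUnion_le_card_mul _ _ _ fun v _ => hM.card_vertexStar_le_starBound v

/-- Exchanging the sums reduces the claim to finite overlap: an element belongs only to patches of
elements with which it shares a vertex. -/
theorem IsShapeRegular.sum_patch_le {κ θ : ℝ} (hM : M.IsShapeRegular κ)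
    {g : Finset (E d) → ℝ} (hg : ∀ K, 0 ≤ g K) :
    ∑ K ∈ M.elems, ∑ K' ∈ M.patch θ K, g K' ≤
      ((d + 1) * starBound d κ : ℕ) * ∑ K ∈ M.elems, g K := by
  classical
  rw [Finset.sum_comm' (t' := M.elems) (s' := fun K' => M.elems.filter fun K => K' ∈ M.patch θ K)
    (fun K K' => by
      simp only [Finset.mem_filter]
      exact ⟨fun h => ⟨⟨h.1, h.2⟩, (mem_patch.1 h.2).1⟩, fun h => ⟨h.1.1, h.1.2⟩⟩), Finset.mul_sum]
  refine Finset.sum_le_sum fun K' hK' => ?_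
  rw [Finset.sum_const, nsmul_eq_mul]
  refine mul_le_mul_of_nonneg_right (Nat.cast_le.2 ?_) (hg K')
  refine hM.card_biUnion_le hK' fun K hK => ?_
  obtain ⟨h1, h2⟩ := Finset.mem_filter.1 hK
  obtain ⟨-, ⟨v, hv, hv'⟩, -⟩ := mem_patch.1 h2
  exact ⟨h1, v, hv', hv⟩

/-- Volumes behave like the `d`-th power of the diameter. For `d ≥ 2` the quotient of volume by
squared diameter has exponent `m = d - 2 ≥ 0`, so a lower bound for the size of `K'` is enough; this
is why `patch` restricts sizes on one side only. -/
theorem IsShapeRegular.volume_mul_le {κ θ : ℝ} (hM : M.IsShapeRegular κ) {m : ℕ} (hm : d = m + 2)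
    (hθ : 0 ≤ θ) {K K' : Finset (E d)} (hK : K ∈ M.elems) (hK' : K' ∈ M.elems)
    (h : θ * size K ≤ size K') :
    θ ^ m * κ ^ d * (volume (hull K)).toReal * size K' ^ 2 ≤
      size K ^ 2 * (volume (hull K')).toReal := by
  have hκ := hM.pos
  obtain ⟨x, hx⟩ := hM.ball K' hK'
  have h0 := size_nonneg K
  have h0' := size_nonneg K'
  have h1 := volume_hull_le (M.isSimplex hK)
  have h2 := le_volume_hull (mul_nonneg hκ.le h0') hx
  have hω := (unitVol_pos d).le
  have hpow : ∀ t : ℝ, t ^ d = t ^ m * t ^ 2 := fun t => by rw [hm, pow_add]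
  calc θ ^ m * κ ^ d * (volume (hull K)).toReal * size K' ^ 2
      ≤ θ ^ m * κ ^ d * (size K ^ d * unitVol d) * size K' ^ 2 := by gcongr
    _ = size K ^ 2 * ((κ ^ d * ((θ * size K) ^ m * size K' ^ 2)) * unitVol d) := by
        rw [hpow (size K)]; ring
    _ ≤ size K ^ 2 * ((κ ^ d * (size K' ^ m * size K' ^ 2)) * unitVol d) := by
        have := pow_le_pow_left₀ (mul_nonneg hθ h0) h m
        gcongr
    _ = size K ^ 2 * ((κ * size K') ^ d * unitVol d) := by
        rw [mul_pow, hpow (size K')]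
    _ ≤ _ := by gcongr

/-- Gradients bound oscillations, oscillations bound nodal values of `v - A_p v`, nodal values bound
the maximum norm, which the bubble smoother respects, and the inverse estimate returns to gradients.
The powers of the diameter cancel by `volume_mul_le`. -/
theorem exists_smoother_bound (d p : ℕ) (hd : 2 ≤ d) (hp : 2 ≤ p) (κ : ℝ) (hκ : 0 < κ) :
    ∃ C : ℝ, 0 ≤ C ∧ ∀ {Ω : Set (E d)} {M : Mesh Ω}, IsRegularDomain Ω → M.IsShapeRegular κ →
      ∀ {Kz : E d → Finset (E d)}, M.IsNodeChoice p Kz →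
      ∀ {v : Finset (E d) → Poly d}, M.IsCR p v →
      ∑ K ∈ M.elems, ∫ x in hull K, ‖gradPoly (v K - M.smoothPieces p Kz v K) x‖ ^ 2 ≤
        C * ∑ K ∈ M.elems, ∫ x in hull K, ‖gradPoly (v K) x‖ ^ 2 := by
  obtain ⟨m, hm⟩ : ∃ m, d = m + 2 := ⟨d - 2, by omega⟩
  obtain ⟨A₁, hA₁, h₁⟩ := exists_osc_bound d p
  obtain ⟨A₂, hA₂, h₂⟩ := exists_inverse_bound d (p + d)
  obtain ⟨A₃, hA₃, h₃⟩ := exists_sub_bubbleSmoother_bound d p (by omega) hp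
  set N := starBound d κ
  set θ := (2 * κ) ^ N with hθ
  have hθ0 : 0 < θ := by positivity
  set c : ℝ := A₃ * ((p + 1) ^ (d + 1) * p ^ p * (2 * N + 1)) with hc
  set L : ℕ := (d + 1) * N with hL
  set C₀ : ℝ := A₂ * c ^ 2 * L * A₁ / (κ ^ 2 * (θ ^ m * κ ^ d)) with hC₀
  refine ⟨C₀ * L, by positivity, ?_⟩
  intro Ω M hΩ hM Kz hKz v hv
  let G : Finset (E d) → ℝ := fun K => ∫ x in hull K, ‖gradPoly (v K) x‖ ^ 2
  have hG : ∀ K, 0 ≤ G K := fun K => integral_nonneg fun x => by positivity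
  let vol : Finset (E d) → ℝ := fun K => (volume (hull K)).toReal
  have hvol : ∀ K ∈ M.elems, 0 < vol K := fun K hK => by
    obtain ⟨x, hx⟩ := hM.ball K hK
    have hs := hM.size_pos K hK
    have := unitVol_pos d
    exact lt_of_lt_of_le (by positivity) (le_volume_hull (by positivity) hx)
  -- The oscillation bound furnished by the reference estimate `h₁`, solved for the difference of
  -- two values.
  let o : Finset (E d) → ℝ := fun K => Real.sqrt (A₁ * size K ^ 2 * G K / vol K)
  have hosq : ∀ K ∈ M.elems, o K ^ 2 * vol K = A₁ * size K ^ 2 * G K := fun K hK => by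
    have h0 := hG K
    have h1 := hvol K hK
    rw [Real.sq_sqrt (by positivity), div_mul_cancel₀ _ h1.ne']
  have ho : M.OscBound v o := fun K hK => by
    refine ⟨Real.sqrt_nonneg _, fun x hx y hy => Real.abs_le_sqrt ?_⟩
    rw [le_div_iff₀ (hvol K hK)]
    exact h₁ (M.isSimplex hK) (v K) (hv.deg K hK) x hx y hy
  have key : ∀ K ∈ M.elems, ∫ x in hull K, ‖gradPoly (v K - M.smoothPieces p Kz v K) x‖ ^ 2 ≤
      C₀ * ∑ K' ∈ M.patch θ K, G K' := by
    intro K hK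
    have hs := M.isSimplex hK
    have hcr := isCR_sub_avg hΩ (by omega : 1 ≤ d) (by omega : 1 ≤ p) Kz hv
    set S := ∑ K' ∈ M.patch θ K, o K' with hS
    have hu : ∀ x ∈ hull K, |ev ((v - M.avg p Kz v) K) x| ≤
        (p + 1) ^ (d + 1) * p ^ p * ((2 * N + 1) * S) := fun x hx =>
      hs.abs_ev_le_of_nodes (by omega) (hcr.deg K hK) (fun z hz =>
        hM.abs_sub_avg_node_le hΩ hd (by omega) hKz hv ho hK hz) hx
    have e : v K - M.smoothPieces p Kz v K = (v - M.avg p Kz v) K -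
        M.bubbleSmoother p (v - M.avg p Kz v) K := by
      simp only [smoothPieces, Pi.add_apply, Pi.sub_apply]
      ring
    have hw : ∀ x ∈ hull K, |ev (v K - M.smoothPieces p Kz v K) x| ≤ c * S := fun x hx => by
      rw [e]
      refine (h₃ hcr hK hu x hx).trans (le_of_eq ?_)
      rw [hc]; ring
    have hdeg : (v K - M.smoothPieces p Kz v K).totalDegree ≤ p + d := by
      rw [e]
      exact (MvPolynomial.totalDegree_sub _ _).trans (max_le ((hcr.deg K hK).trans (by omega))
        (totalDegree_bubbleSmoother hp _ hK))
    obtain ⟨x₀, hx₀⟩ := hM.ball K hK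
    have hsz := hM.size_pos K hK
    have hinv := h₂ hs _ hdeg (c * S) (κ * size K) x₀ (by positivity) hx₀ hw
    -- Cauchy–Schwarz; `L` bounds the number of elements in a patch, and it reappears below as the
    -- overlap of patches.
    have hS2 : S ^ 2 ≤ L * ∑ K' ∈ M.patch θ K, o K' ^ 2 := by
      refine sq_sum_le_card_mul_sum_sq.trans ?_
      refine mul_le_mul_of_nonneg_right (Nat.cast_le.2 ?_)
        (Finset.sum_nonneg fun _ _ => sq_nonneg _)
      exact hM.card_biUnion_le hK fun K' hK' => ⟨(mem_patch.1 hK').1, (mem_patch.1 hK').2.1⟩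
    have hterm : ∀ K' ∈ M.patch θ K, vol K * o K' ^ 2 * (θ ^ m * κ ^ d) ≤
        A₁ * size K ^ 2 * G K' := by
      intro K' hK'
      obtain ⟨hKe, -, hθK⟩ := mem_patch.1 hK'
      have h4 := hM.volume_mul_le hm hθ0.le hK hKe hθK
      have h5 := hosq K' hKe
      have h6 := hvol K' hKe
      refine le_of_mul_le_mul_right ?_ h6
      calc vol K * o K' ^ 2 * (θ ^ m * κ ^ d) * vol K'
          = θ ^ m * κ ^ d * vol K * (o K' ^ 2 * vol K') := by ring
        _ = A₁ * G K' * (θ ^ m * κ ^ d * vol K * size K' ^ 2) := by rw [h5]; ring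
        _ ≤ A₁ * G K' * (size K ^ 2 * vol K') := by
            have := hG K'
            gcongr
        _ = A₁ * size K ^ 2 * G K' * vol K' := by ring
    have hsum : vol K * (θ ^ m * κ ^ d) * ∑ K' ∈ M.patch θ K, o K' ^ 2 ≤
        A₁ * size K ^ 2 * ∑ K' ∈ M.patch θ K, G K' := by
      rw [Finset.mul_sum, Finset.mul_sum]
      refine Finset.sum_le_sum fun K' hK' => ?_
      have := hterm K' hK'
      linarith
    rw [hC₀, div_mul_eq_mul_div, le_div_iff₀ (by positivity)]
    refine le_of_mul_le_mul_right ?_ (pow_pos hsz 2)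
    set D := ∫ x in hull K, ‖gradPoly (v K - M.smoothPieces p Kz v K) x‖ ^ 2
    have hv0 : 0 ≤ vol K := (hvol K hK).le
    calc D * (κ ^ 2 * (θ ^ m * κ ^ d)) * size K ^ 2
        = (θ ^ m * κ ^ d) * ((κ * size K) ^ 2 * D) := by ring
      _ ≤ (θ ^ m * κ ^ d) * (A₂ * vol K * (c * S) ^ 2) := by gcongr
      _ = A₂ * c ^ 2 * (vol K * (θ ^ m * κ ^ d) * S ^ 2) := by ring
      _ ≤ A₂ * c ^ 2 * (vol K * (θ ^ m * κ ^ d) * (L * ∑ K' ∈ M.patch θ K, o K' ^ 2)) := by gcongr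
      _ = A₂ * c ^ 2 * L * (vol K * (θ ^ m * κ ^ d) * ∑ K' ∈ M.patch θ K, o K' ^ 2) := by ring
      _ ≤ A₂ * c ^ 2 * L * (A₁ * size K ^ 2 * ∑ K' ∈ M.patch θ K, G K') := by gcongr
      _ = _ := by ring
  refine (Finset.sum_le_sum key).trans ?_
  rw [← Finset.mul_sum, mul_assoc]
  have := hM.sum_patch_le (θ := θ) hG
  have hC₀0 : 0 ≤ C₀ := by positivity
  gcongr

end Mesh

end FEM

/-! ### Quasi-optimality of overconsistent methods with stable smoother -/

namespace Nonconforming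

variable {X H : Type*} [AddCommGroup X] [Module ℝ X] {V S : Submodule ℝ X}
  [NormedAddCommGroup H] [InnerProductSpace ℝ H]

/-- With `τ = P - s`, the discrete equation and overconsistency give `‖τ‖² = a(u - s, E τ)`. Hence
`‖τ‖ ≤ C ‖u - s‖` by stability, and the triangle inequality adds `1`. -/
theorem Method.quasiOptimalWith_of_stable (MS : Method V S)
    {aext : LinearMap.BilinForm ℝ ↥(V ⊔ S)} (G : ↥(V ⊔ S) →ₗ[ℝ] H)
    (ha : ∀ w w', aext w w' = inner ℝ (G w) (G w'))
    (hb : ∀ s σ, MS.b s σ = aext (inclS V S s) (inclS V S σ))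
    (hcons : ∀ s σ, aext (inclS V S s) (inclS V S σ - inclV V S (MS.E σ)) = 0) {C : ℝ}
    (hC : 0 ≤ C) (hE : ∀ σ, ‖G (inclV V S (MS.E σ))‖ ≤ C * ‖G (inclS V S σ)‖) :
    MS.QuasiOptimalWith aext (1 + C) := by
  have hnorm : ∀ w, energyNorm aext w = ‖G w‖ := fun w => by
    rw [energyNorm, ha, real_inner_self_eq_norm_sq, Real.sqrt_sq (norm_nonneg _)]
  refine ⟨by linarith, fun u => ?_⟩
  rw [Real.mul_iInf_of_nonneg (by linarith)]
  refine le_ciInf fun s => ?_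
  rw [hnorm, hnorm]
  set P := MS.approx aext u
  set g := G (inclV V S u - inclS V S s)
  set τ : S := P - s
  have h1 : ‖G (inclS V S τ)‖ ^ 2 = inner ℝ g (G (inclV V S (MS.E τ))) := by
    have e1 : aext (inclS V S P) (inclS V S τ) = aext (inclV V S u) (inclV V S (MS.E τ)) := by
      rw [← hb]
      exact MS.app_spec _ τ
    have e2 : aext (inclS V S s) (inclS V S τ) = aext (inclS V S s) (inclV V S (MS.E τ)) := by
      rw [← sub_eq_zero, ← map_sub]
      exact hcons s τ
    rw [← real_inner_self_eq_norm_sq, ← ha]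
    change _ = inner ℝ (G (inclV V S u - inclS V S s)) (G (inclV V S (MS.E τ)))
    rw [← ha]
    have e0 : aext (inclS V S τ) = aext (inclS V S P) - aext (inclS V S s) := by
      rw [← map_sub, ← map_sub]
    rw [e0, LinearMap.sub_apply, e1, e2, map_sub aext, LinearMap.sub_apply]
  have h2 : ‖G (inclS V S τ)‖ ≤ C * ‖g‖ := by
    have h3 := (real_inner_le_norm g (G (inclV V S (MS.E τ)))).trans
      (mul_le_mul_of_nonneg_left (hE τ) (norm_nonneg _))
    rw [← h1] at h3
    rcases (norm_nonneg (G (inclS V S τ))).eq_or_lt with h0 | h0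
    · rw [← h0]
      positivity
    · refine le_of_mul_le_mul_right ?_ h0
      linarith
  have h4 : inclV V S u - inclS V S P = (inclV V S u - inclS V S s) - inclS V S τ := by
    rw [show inclS V S τ = inclS V S P - inclS V S s from map_sub _ _ _]
    abel
  rw [h4, map_sub]
  refine (norm_sub_le _ _).trans ?_
  change ‖g‖ + _ ≤ _
  linarith

theorem Method.Cqopt_le {MS : Method V S} {aext : LinearMap.BilinForm ℝ ↥(V ⊔ S)} {C : ℝ}
    (h : MS.QuasiOptimalWith aext C) : MS.Cqopt aext ≤ C :=
  csInf_le ⟨1, fun _ hc => hc.1⟩ h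

end Nonconforming

/-! ### The form and the method on V + S. -/

namespace FEM

variable {d : ℕ}

namespace Mesh

variable {Ω : Set (E d)} {M : Mesh Ω} {p : ℕ} {S : Submodule ℝ (L2 Ω)}

theorem piece_add (hΩ : IsRegularDomain Ω) {s t : L2 Ω} (hs : s ∈ M.polySpace p)
    (ht : t ∈ M.polySpace p) {K : Finset (E d)} (hK : K ∈ M.elems) :
    piece (s + t) K = piece s K + piece t K :=
  ((isPiece_piece hs hK).add hΩ hK (isPiece_piece ht hK)).piece_eq hΩ hK

theorem piece_smul (hΩ : IsRegularDomain Ω) {s : L2 Ω} (hs : s ∈ M.polySpace p) (c : ℝ)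
    {K : Finset (E d)} (hK : K ∈ M.elems) : piece (c • s) K = c • piece s K :=
  ((isPiece_piece hs hK).smul hΩ hK c).piece_eq hΩ hK

theorem finiteDimensional_of_le_polySpace (hΩ : IsRegularDomain Ω) (hS : S ≤ M.polySpace p) :
    FiniteDimensional ℝ S := by
  let f : S →ₗ[ℝ] ({K // K ∈ M.elems} → MvPolynomial.restrictTotalDegree (Fin d) ℝ p) :=
    { toFun := fun s K => ⟨piece s.1 K.1, (MvPolynomial.mem_restrictTotalDegree _ _ _).2
        (totalDegree_piece hΩ (hS s.2) K.2)⟩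
      map_add' := fun s t => funext fun K => Subtype.ext
        (piece_add hΩ (hS s.2) (hS t.2) K.2)
      map_smul' := fun c s => funext fun K => Subtype.ext (piece_smul hΩ (hS s.2) c K.2) }
  refine FiniteDimensional.of_injective f fun s t hst => Subtype.ext ?_
  refine ext_of_isPiece hΩ (M := M) (v := piece s.1) (fun K hK => isPiece_piece (hS s.2) hK)
    fun K hK => ?_
  have : piece s.1 K = piece t.1 K := congrArg Subtype.val (congrFun hst ⟨K, hK⟩)
  rw [this]
  exact isPiece_piece (hS t.2) hK

variable (M) in
/-- The piecewise gradient as a linear map on `V + S`. -/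
def gradMap (hΩ : IsRegularDomain Ω) (hS : S ≤ M.polySpace p) :
    ↥(H10 Ω ⊔ S) →ₗ[ℝ] L2Vec Ω where
  toFun w := M.grad w
  map_add' w w' := ((isBrokenGrad_grad (mem_H1_of_mem_sup hΩ hS w.2)).add hΩ
    (isBrokenGrad_grad (mem_H1_of_mem_sup hΩ hS w'.2))).grad_eq hΩ
  map_smul' c w := ((isBrokenGrad_grad (mem_H1_of_mem_sup hΩ hS w.2)).smul hΩ c).grad_eq hΩ

/-- The piecewise gradient is injective on `V + S`. -/
theorem eq_zero_of_grad_eq_zero (hΩ : IsRegularDomain Ω) (hd : 1 ≤ d) (hS : S ≤ M.polySpace p)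
    (hcr : (S : Set (L2 Ω)) ⊆ M.crSpace p) {w : L2 Ω} (hw : w ∈ H10 Ω ⊔ S) (h : M.grad w = 0) :
    w = 0 := by
  have hbg := isBrokenGrad_grad (mem_H1_of_mem_sup hΩ hS hw)
  rw [h] at hbg
  choose! c hc using fun K (hK : K ∈ M.elems) => exists_const_of_grad_eq_zero hΩ hbg hK
  obtain ⟨v, hv, s, hs, rfl⟩ := Submodule.mem_sup.1 hw
  -- The conforming part `v` is the piecewise constant minus `s`, thus a piecewise polynomial in
  -- H^1_0, so it is continuous and zero on the boundary.
  have hpv : ∀ K ∈ M.elems, IsPiece v K (MvPolynomial.C (c K) - piece s K) := fun K hK => by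
    have := (hc K hK).add hΩ hK ((isPiece_piece (hS hs) hK).smul hΩ hK (-1))
    simpa [sub_eq_add_neg, add_assoc] using this
  have hconf := isConforming_of_mem_H10 hΩ hd hv hpv
  have hscr := isCR_piece hΩ hd (hcr hs)
  have hsub : ∀ {F K : Finset (E d)}, F ⊆ K → hull F ⊆ hull K := fun h =>
    convexHull_mono (Finset.coe_subset.2 h)
  have hconst : ∀ {F K : Finset (E d)}, K ∈ M.elems → F ∈ M.faces → F ⊆ K → ∀ (a : ℝ)
      (q : Poly d), (∀ x ∈ hull F, ev q x = a) → faceIntegral F (fun x => ev q x * ev 1 x) = 0 →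
      a = 0 := by
    intro F K hK hF hFK a q hq h0
    have hI := face_integral hd hK hF hFK
    have h1 : faceIntegral F (fun x => ev q x * ev 1 x) = a * faceIntegral F fun _ => 1 := by
      rw [← hI.const_mul]
      exact hI.congr fun x hx => by rw [hq x hx, ev_one]
    rw [h1, mul_eq_zero, or_iff_left hI.one_pos.ne'] at h0
    exact h0
  -- As `v` has no jumps, the jump of `s` on `F` is the constant `c K - c K'`; its mean vanishes, so
  -- it is zero.
  have hint : ∀ K ∈ M.elems, ∀ K' ∈ M.elems, ∀ F ∈ M.intFaces, F ⊆ K → F ⊆ K' → c K = c K' := by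
    intro K hK K' hK' F hF hFK hFK'
    rw [← sub_eq_zero]
    refine hconst hK (intFaces_subset hF) hFK _ (piece s K - piece s K') (fun x hx => ?_) ?_
    · have := hconf.eq K hK K' hK' x (hsub hFK hx) (hsub hFK' hx)
      simp only [ev_sub, ev_C] at this ⊢
      linarith
    · rw [(face_integral hd hK (intFaces_subset hF) hFK).ev_mul_sub, sub_eq_zero]
      exact hscr.int F hF K hK K' hK' hFK hFK' 1 (by simp)
  -- Equal constants propagate to an element with a boundary face, where `s` equals that constant
  -- and has mean zero.
  have hzero : ∀ K ∈ M.elems, c K = 0 := by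
    intro K hK
    obtain ⟨K', hK', hc', F, hF, hFK'⟩ := M.propagate_global hΩ.isOpen hd
      (P := fun K' => c K' = c K)
      (fun z K₁ h₁ K₂ h₂ F hF hF₁ hF₂ _ he => (hint K₁ h₁ K₂ h₂ F hF hF₁ hF₂).symm.trans he) hK rfl
    rw [← hc']
    refine hconst hK' (bdFaces_subset hF) hFK' _ (piece s K') (fun x hx => ?_)
      (hscr.bd F hF K' hK' hFK' 1 (by simp))
    have := hconf.zero K' hK' x (hsub hFK' hx) ((M.mem_bdFaces.1 hF).2 hx)
    simp only [ev_sub, ev_C] at this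
    linarith
  refine ext_of_isPiece (M := M) hΩ (v := fun _ => 0) (fun K hK => ?_) fun K hK => ?_
  · have := hc K hK
    rwa [hzero K hK, map_zero] at this
  · have := (hc K hK).smul hΩ hK 0
    simpa using this

theorem smoother_mem_H10 (hΩ : IsRegularDomain Ω) (hd : 1 ≤ d) (hp : 2 ≤ p)
    (Kz : E d → Finset (E d)) {σ : L2 Ω} (hσ : σ ∈ M.crSpace p) :
    M.smoother p Kz σ ∈ H10 Ω :=
  (isConforming_smoothPieces hΩ hd hp Kz (isCR_piece hΩ hd hσ)).glue_mem_H10 hΩ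

variable (M) in
/-- The smoothing operator as a linear map. -/
def smootherMap (hΩ : IsRegularDomain Ω) (hd : 1 ≤ d) (hp : 2 ≤ p) {Kz : E d → Finset (E d)}
    (hKz : M.IsNodeChoice p Kz) (hcr : (S : Set (L2 Ω)) ⊆ M.crSpace p) : S →ₗ[ℝ] H10 Ω where
  toFun σ := ⟨M.smoother p Kz σ, smoother_mem_H10 hΩ hd hp Kz (hcr σ.2)⟩
  map_add' σ τ := Subtype.ext <| by
    have hS : ∀ s : S, M.IsCR p (piece s.1) := fun s => isCR_piece hΩ hd (hcr s.2)
    refine ext_of_isPiece (M := M) hΩ (fun K hK => isPiece_glue hΩ _ hK) fun K hK => ?_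
    rw [smoothPieces_combo hΩ hd hp hKz (hS (σ + τ)) (hS σ) (hS τ) (a := 1) (b := 1)
      (fun K hK => by
        rw [one_smul, one_smul]
        exact piece_add hΩ (hcr σ.2).1 (hcr τ.2).1 hK) hK, one_smul, one_smul]
    exact (isPiece_glue hΩ _ hK).add hΩ hK (isPiece_glue hΩ _ hK)
  map_smul' c σ := Subtype.ext <| by
    have hS : ∀ s : S, M.IsCR p (piece s.1) := fun s => isCR_piece hΩ hd (hcr s.2)
    refine ext_of_isPiece (M := M) hΩ (fun K hK => isPiece_glue hΩ _ hK) fun K hK => ?_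
    rw [smoothPieces_combo hΩ hd hp hKz (hS (c • σ)) (hS σ) (hS σ) (a := c) (b := 0)
      (fun K hK => by
        rw [zero_smul, add_zero]
        exact piece_smul hΩ (hcr σ.2).1 c hK) hK, zero_smul, add_zero]
    exact (isPiece_glue hΩ _ hK).smul hΩ hK c

theorem smoother_eq_of_mem_H10 (hΩ : IsRegularDomain Ω) (hd : 1 ≤ d) (hp : 2 ≤ p)
    {Kz : E d → Finset (E d)} (hKz : M.IsNodeChoice p Kz) {s : L2 Ω} (hs : s ∈ M.polySpace p)
    (hsV : s ∈ H10 Ω) : M.smoother p Kz s = s := by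
  have hpc : ∀ K ∈ M.elems, IsPiece s K (piece s K) := fun K hK => isPiece_piece hs hK
  have hconf := isConforming_of_mem_H10 hΩ hd hsV hpc
  refine ext_of_isPiece (M := M) hΩ (fun K hK => isPiece_glue hΩ _ hK) fun K hK => ?_
  rw [smoothPieces_eq_of_isConforming hΩ hd hp hKz hconf (fun K hK => totalDegree_piece hΩ hs hK)
    hK]
  exact hpc K hK

theorem isPiece_sub_smoother (hΩ : IsRegularDomain Ω) (Kz : E d → Finset (E d)) {σ : L2 Ω}
    (hσ : σ ∈ M.polySpace p) {K : Finset (E d)} (hK : K ∈ M.elems) :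
    IsPiece (σ - M.smoother p Kz σ) K
      (piece σ K - M.smoothPieces p Kz (piece σ) K) := by
  have := (isPiece_piece hσ hK).add hΩ hK
    ((isPiece_glue hΩ (M.smoothPieces p Kz (piece σ)) hK).smul hΩ hK (-1))
  rw [neg_one_smul, neg_one_smul, ← sub_eq_add_neg, ← sub_eq_add_neg] at this
  exact this

/-- The smoothing operator is overconsistent. -/
theorem aM_sub_smoother_eq_zero (hΩ : IsRegularDomain Ω) (hd : 1 ≤ d) (hp : 2 ≤ p)
    (Kz : E d → Finset (E d)) {s σ : L2 Ω} (hs : s ∈ M.polySpace p) (hσ : σ ∈ M.crSpace p) :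
    M.aM s (σ - M.smoother p Kz σ) = 0 := by
  rw [aM_eq_sum hΩ (fun K hK => isPiece_piece hs hK)
    fun K hK => isPiece_sub_smoother hΩ Kz hσ.1 hK]
  exact Finset.sum_eq_zero fun K hK => integral_grad_sub_smoothPieces hΩ hd hp Kz
    (isCR_piece hΩ hd hσ) hK (totalDegree_piece hΩ hs hK)

theorem exists_grad_sub_smoother_bound (d p : ℕ) (hd : 2 ≤ d) (hp : 2 ≤ p) (γ : ℝ) (hγ : 1 ≤ γ) :
    ∃ C : ℝ, 0 ≤ C ∧ ∀ {Ω : Set (E d)} {M : Mesh Ω}, IsRegularDomain Ω → M.shape ≤ γ →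
      ∀ {Kz : E d → Finset (E d)}, M.IsNodeChoice p Kz → ∀ {σ : L2 Ω}, σ ∈ M.crSpace p →
      ‖M.grad (σ - M.smoother p Kz σ)‖ ≤ C * ‖M.grad σ‖ := by
  obtain ⟨C, hC, h⟩ := exists_smoother_bound d p hd hp ((2 * γ)⁻¹ / 2) (by positivity)
  refine ⟨Real.sqrt C, Real.sqrt_nonneg _, ?_⟩
  intro Ω M hΩ hsh Kz hKz σ hσ
  have h1 := h hΩ (isShapeRegular_of_shape_le (by omega) hγ hsh) hKz (isCR_piece hΩ (by omega) hσ)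
  simp only [← real_inner_self_eq_norm_sq] at h1
  rw [← aM_eq_sum hΩ (fun K hK => isPiece_sub_smoother hΩ Kz hσ.1 hK)
      fun K hK => isPiece_sub_smoother hΩ Kz hσ.1 hK,
    ← aM_eq_sum hΩ (fun K hK => isPiece_piece hσ.1 hK) fun K hK => isPiece_piece hσ.1 hK,
    aM_eq_inner, aM_eq_inner, real_inner_self_eq_norm_sq, real_inner_self_eq_norm_sq] at h1
  refine le_of_sq_le_sq ?_ (by positivity)
  rwa [mul_pow, Real.sq_sqrt hC]

/-- The method `(S, a_M, E_p)` is well defined, Galerkin, and quasi-optimal if its smoothing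
operator is stable. -/
theorem exists_method (hΩ : IsRegularDomain Ω) (hd : 1 ≤ d) (hp : 2 ≤ p)
    {Kz : E d → Finset (E d)} (hKz : M.IsNodeChoice p Kz)
    (hcr : (S : Set (L2 Ω)) ⊆ M.crSpace p) {C : ℝ} (hC : 0 ≤ C)
    (hE : ∀ σ ∈ S, ‖M.grad (σ - M.smoother p Kz σ)‖ ≤ C * ‖M.grad σ‖) :
    ∃ aext : LinearMap.BilinForm ℝ ↥(H10 Ω ⊔ S),
      (∀ w₁ w₂, aext w₁ w₂ = M.aM w₁ w₂) ∧ Nonconforming.IsScalarProduct aext ∧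
      ∃ MS : Nonconforming.Method (H10 Ω) S,
        (∀ s σ : S, MS.b s σ = M.aM s σ) ∧
        (∀ σ : S, (MS.E σ : L2 Ω) = M.smoother p Kz σ) ∧
        MS.IsGalerkin aext ∧ MS.QuasiOptimalWith aext (1 + (1 + C)) := by
  have hS : S ≤ M.polySpace p := fun s hs => (hcr hs).1
  let G := M.gradMap hΩ hS
  let aext : LinearMap.BilinForm ℝ ↥(H10 Ω ⊔ S) := (innerₗ (L2Vec Ω)).compl₁₂ G G
  have ha : ∀ w w', aext w w' = inner ℝ (G w) (G w') := fun _ _ => rfl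
  have haM : ∀ w w', aext w w' = M.aM w w' := fun w w' => (aM_eq_inner _ _).symm
  have hpos : ∀ w, w ≠ 0 → 0 < aext w w := fun w hw => by
    rw [ha, real_inner_self_eq_norm_sq]
    refine pow_pos (norm_pos_iff.2 fun h0 => hw (Subtype.ext ?_)) 2
    exact eq_zero_of_grad_eq_zero hΩ hd hS hcr w.2 h0
  let MS : Nonconforming.Method (H10 Ω) S :=
    { finiteDim := finiteDimensional_of_le_polySpace hΩ hS
      b := aext.compl₁₂ (Nonconforming.inclS _ _) (Nonconforming.inclS _ _)
      nondegenerate := fun s h => by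
        by_contra hne
        refine (hpos (Nonconforming.inclS _ _ s) fun h0 => hne ?_).ne' (h s)
        exact Submodule.inclusion_injective _ (h0.trans (map_zero _).symm)
      E := M.smootherMap hΩ hd hp hKz hcr }
  have hb : ∀ s σ, MS.b s σ = aext (Nonconforming.inclS _ _ s) (Nonconforming.inclS _ _ σ) :=
    fun _ _ => rfl
  refine ⟨aext, haM, ⟨fun v w => by rw [ha, ha, real_inner_comm], hpos⟩, MS, fun s σ => haM _ _,
    fun σ => rfl, ⟨fun s σ _ _ => hb s σ, fun s hs => ?_⟩, ?_⟩
  · exact smoother_eq_of_mem_H10 hΩ hd hp hKz (hS s.2) hs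
  · refine MS.quasiOptimalWith_of_stable G ha hb (fun s σ => ?_) (by linarith) fun σ => ?_
    · exact (haM _ _).trans (aM_sub_smoother_eq_zero hΩ hd hp Kz (hS s.2) (hcr σ.2))
    · have h1 : G (Nonconforming.inclV _ _ (MS.E σ)) = G (Nonconforming.inclS _ _ σ) -
          G (Nonconforming.inclS _ _ σ - Nonconforming.inclV _ _ (MS.E σ)) := by
        rw [map_sub, sub_sub_cancel]
      rw [h1]
      refine (norm_sub_le _ _).trans ?_
      rw [add_mul, one_mul]
      exact add_le_add le_rfl (hE σ σ.2)

end Mesh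

end FEM

end

theorem theoremT :
    ∃ C : ℕ → ℕ → ℝ → ℝ,
      (∀ d p, Monotone (fun γ => C d p γ)) ∧ (∀ d γ, Monotone (fun p => C d p γ)) ∧
      ∀ (d p : ℕ), 2 ≤ d → 2 ≤ p →
      ∀ (Ω : Set (FEM.E d)), IsOpen Ω → Bornology.IsBounded Ω → IsConnected Ω →
        FEM.HasLipschitzBoundary Ω →
      ∀ (M : FEM.Mesh Ω), 1 < M.elems.card →
      ∀ (Kz : FEM.E d → Finset (FEM.E d)), M.IsNodeChoice p Kz →
      ∀ (S : Submodule ℝ (FEM.L2 Ω)),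
        M.lagrangeSpace p ≤ S → (S : Set (FEM.L2 Ω)) ⊆ M.crSpace p →
      -- the extended form is well defined and a scalar product on `V + S`
      (∀ w ∈ FEM.H10 Ω ⊔ S, w ∈ M.H1) ∧
      ∃ aext : LinearMap.BilinForm ℝ ↥(FEM.H10 Ω ⊔ S),
        (∀ w₁ w₂, aext w₁ w₂ = M.aM w₁ w₂) ∧ Nonconforming.IsScalarProduct aext ∧
      -- the method `(S, a_M, E_p)`
      ∃ MS : Nonconforming.Method (FEM.H10 Ω) S,
        (∀ s σ : S, MS.b s σ = M.aM s σ) ∧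
        (∀ σ : S, (MS.E σ : FEM.L2 Ω) = M.smoother p Kz σ) ∧
        MS.IsGalerkin aext ∧
        MS.IsQuasiOptimal aext ∧
        MS.Cqopt aext ≤ C d p M.shape := by
  -- Constants are fixed for integer bounds on the shape only, so that they can be summed. The bound
  -- `n + 1` is at least `1`, as the estimate requires; for other `d` and `p` the value `0` is a
  -- filler.
  have hex : ∀ d p n : ℕ, ∃ C : ℝ, 0 ≤ C ∧ (2 ≤ d → 2 ≤ p →
      ∀ {Ω : Set (FEM.E d)} {M : FEM.Mesh Ω}, FEM.IsRegularDomain Ω → M.shape ≤ (n : ℝ) + 1 →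
      ∀ {Kz : FEM.E d → Finset (FEM.E d)}, M.IsNodeChoice p Kz →
      ∀ {σ : FEM.L2 Ω}, σ ∈ M.crSpace p →
        ‖M.grad (σ - M.smoother p Kz σ)‖ ≤ C * ‖M.grad σ‖) := by
    intro d p n
    by_cases h : 2 ≤ d ∧ 2 ≤ p
    · obtain ⟨C, hC, hCs⟩ := FEM.Mesh.exists_grad_sub_smoother_bound d p h.1 h.2 ((n : ℝ) + 1)
        (by simp)
      exact ⟨C, hC, fun _ _ => hCs⟩
    · exact ⟨0, le_rfl, fun h1 h2 => absurd ⟨h1, h2⟩ h⟩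
  choose c hc0 hc using hex
  -- Summing the nonnegative constants over all smaller `q` and `m` enforces monotonicity in `p` and
  -- `γ`. The `2` is the one in `1 + (1 + C)`.
  refine ⟨fun d p γ => 2 + ∑ q ∈ Finset.range (p + 1), ∑ m ∈ Finset.range (⌈γ⌉₊ + 1), c d q m,
    fun d p γ γ' h => ?_, fun d γ p p' h => ?_, ?_⟩
  · refine add_le_add le_rfl (Finset.sum_le_sum fun q _ => ?_)
    refine Finset.sum_le_sum_of_subset_of_nonneg (Finset.range_mono ?_) fun m _ _ => hc0 d q m
    exact Nat.succ_le_succ (Nat.ceil_mono h)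
  · refine add_le_add le_rfl ?_
    exact Finset.sum_le_sum_of_subset_of_nonneg (Finset.range_mono (Nat.succ_le_succ h))
      fun q _ _ => Finset.sum_nonneg fun m _ => hc0 d q m
  intro d p hd hp Ω ho hb _ hL M _ Kz hKz S _ hcr
  have hΩ : FEM.IsRegularDomain Ω := ⟨ho, hb, FEM.interior_closure_eq ho hL⟩
  have hS : S ≤ M.polySpace p := fun s hs => (hcr hs).1
  refine ⟨fun w hw => FEM.Mesh.mem_H1_of_mem_sup hΩ hS hw, ?_⟩
  have hsh : M.shape ≤ (⌈M.shape⌉₊ : ℝ) + 1 := (Nat.le_ceil _).trans (by simp)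
  obtain ⟨aext, h1, h2, MS, h3, h4, h5, h6⟩ := FEM.Mesh.exists_method hΩ (by omega) hp hKz hcr
    (hc0 d p ⌈M.shape⌉₊) fun σ hσ => hc d p ⌈M.shape⌉₊ hd hp hΩ hsh hKz (hcr hσ)
  refine ⟨aext, h1, h2, MS, h3, h4, h5, ⟨_, h6⟩, (Nonconforming.Method.Cqopt_le h6).trans ?_⟩
  have h7 : c d p ⌈M.shape⌉₊ ≤ ∑ m ∈ Finset.range (⌈M.shape⌉₊ + 1), c d p m :=
    Finset.single_le_sum (fun m _ => hc0 d p m) (Finset.self_mem_range_succ _)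
  have h8 : ∑ m ∈ Finset.range (⌈M.shape⌉₊ + 1), c d p m ≤
      ∑ q ∈ Finset.range (p + 1), ∑ m ∈ Finset.range (⌈M.shape⌉₊ + 1), c d q m :=
    Finset.single_le_sum (f := fun q => ∑ m ∈ Finset.range (⌈M.shape⌉₊ + 1), c d q m)
      (fun q _ => Finset.sum_nonneg fun m _ => hc0 d q m) (Finset.self_mem_range_succ _)
  linarith
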